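/- Let $S$ be a complex manifold and let $(\mathcal H,\nabla^{\mathcal H},\bar{\ },(\,,\,),\mathcal F)$ be a polarized variation of real Hodge structure of weight one over $S$: a complex vector bundle $\mathcal H$ of finite rank with a flat connection $\nabla^{\mathcal H}$, a flat fibrewise anti-involution $a\mapsto\bar a$, a flat symplectic form with $(\bar a,\bar b)=\overline{(a,b)}$, and a holomorphic subbundle $\mathcal F\subset\mathcal H$ (for the holomorphic structure on $\mathcal H$ in which flat sections are holomorphic), such that in every fibre $F$ is totally isotropic, $H=F\oplus\bar F$, and $\sqrt{-1}(a,\bar a)>0$ for $0\ne a\in F$. Let $\nabla^{\mathcal F}$, resp. $\nabla^{\bar{\mathcal F}}$, be the connection on $\mathcal F$, resp. $\bar{\mathcal F}$, obtained from $\nabla^{\mathcal H}$ by projecting along $\bar{\mathcal F}$, resp. $\mathcal F$. Let $\sigma$ be the second fundamental form of $\mathcal F$, the $1$-form with values in $\mathrm{Hom}(\mathcal F,\bar{\mathcal F})$ that assigns to a section $a$ of $\mathcal F$ the projection of $\nabla^{\mathcal H}a$ to $\bar{\mathcal F}$ along $\mathcal F$, and let $\bar\sigma$ be its complex conjugate,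 with values in $\mathrm{Hom}(\bar{\mathcal F},\mathcal F)$. Let $s$ and $\bar s$ be the $1$-forms with values in $\mathcal F\otimes\mathcal F$ and $\bar{\mathcal F}\otimes\bar{\mathcal F}$ that correspond to $\bar\sigma$ and $\sigma$ under $a\otimes b\mapsto\big(x\mapsto 2(b,x)a\big)$. The Fock bundle $\mathbb F(\mathcal H,\mathcal F)$ has as fibre the quotient of the universal enveloping algebra $U\hat H$ of the Heisenberg algebra $\hat H=H\oplus\mathbb C\hbar$, $[a+\lambda\hbar,b+\mu\hbar]=(a,b)\hbar$, by the left ideal generated by $F$ and $\hbar-1$; let $\rho$ be the action of $U\hat H$ on it by left multiplication, in which $a\otimes b\in H\otimes H$ acts as $\rho(a)\rho(b)$, and let $v_o$ be the image of $1$. The map $p\mapsto p\,v_o$ identifies $\mathrm{Sym}_\bullet(\bar{\mathcal F})$ with $\mathbb F(\mathcal H,\mathcal F)$. This gives the Fock bundle the inner product for which different degrees are orthogonal and $\langle \bar z_1\cdots\bar z_n,\bar w_1\cdots\bar w_n\rangle=\sum_{\tau\in\mathcal S_n}\prod_i\langle\bar z_i,\bar w_{\tau(i)}\rangle$, with $\langle\bar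 z,\bar w\rangle=\sqrt{-1}(w,\bar z)$ for $z,w\in F$. The connection $\nabla^{\bar{\mathcal F}}$ extends uniquely as a derivation to $\mathrm{Sym}_\bullet(\bar{\mathcal F})$; regard this extension as a connection, still written $\nabla^{\bar{\mathcal F}}$, on the Fock bundle. Then $\nabla^{\mathbb F}:=\nabla^{\bar{\mathcal F}}+\rho(s+\bar s)$ is a unitary connection on $\mathbb F(\mathcal H,\mathcal F)$. Its curvature is multiplication by the scalar $2$-form $$-\tfrac12\,\mathrm{tr}(\bar\sigma\wedge\sigma)=\tfrac12\,\mathrm{tr}(\sigma\wedge\bar\sigma),$$ where $(\bar\sigma\wedge\sigma)(X,Y)=\bar\sigma(X)\sigma(Y)-\bar\sigma(Y)\sigma(X)\in\mathrm{End}(\mathcal F)$ and similarly for $\sigma\wedge\bar\sigma$. This is half the curvature $-\mathrm{tr}(\bar\sigma\wedge\sigma)$ of the connection that $\nabla^{\mathcal F}$ induces on the determinant line bundle $\det(\mathcal F)$. In particular, the connection $\nabla^{\mathbb F}$ is projectively flat. -/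

import Mathlib

open scoped TensorProduct

noncomputable section

section SymmetricAlgebraTools

variable {k M A : Type*} [Field k] [AddCommGroup M] [Module k M] [Ring A] [Algebra k A]

/-- The algebra map out of a symmetric algebra defined by a linear map to a possibly
noncommutative algebra whose values commute with each other. -/
def symLift (f : M →ₗ[k] A) (hf : ∀ x y, f x * f y = f y * f x) :
    SymmetricAlgebra k M →ₐ[k] A :=
  RingCon.liftₐEquiv (TensorAlgebra.symRingCon k M) ⟨TensorAlgebra.lift k f, by
    refine RingCon.ringConGen_le.2 (fun x y h' => ?_)
    induction h' with | mul_comm x y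
    rw [RingCon.ker_apply]
    simp [hf x y]⟩

theorem symLift_ι (f : M →ₗ[k] A) (hf : ∀ x y, f x * f y = f y * f x) (x : M) :
    symLift f hf (SymmetricAlgebra.ι k M x) = f x := by
  have : symLift f hf (SymmetricAlgebra.ι k M x) = TensorAlgebra.lift k f (TensorAlgebra.ι k x) :=
    rfl
  rw [this, TensorAlgebra.lift_ι_apply]

/-- The algebra map `p ↦ p + ε ∂p` that encodes the derivation extending `c`. -/
def symDerAux (c : M →ₗ[k] k) :
    SymmetricAlgebra k M →ₐ[k] TrivSqZeroExt (SymmetricAlgebra k M) (SymmetricAlgebra k M) :=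
  SymmetricAlgebra.lift
    ((TrivSqZeroExt.inlAlgHom k _ _).toLinearMap ∘ₗ SymmetricAlgebra.ι k M +
      ((TrivSqZeroExt.inrHom (SymmetricAlgebra k M) (SymmetricAlgebra k M)).restrictScalars k) ∘ₗ
        (Algebra.linearMap k (SymmetricAlgebra k M)) ∘ₗ c)

theorem symDerAux_fst (c : M →ₗ[k] k) (p : SymmetricAlgebra k M) :
    (symDerAux c p).fst = p := by
  have : (TrivSqZeroExt.fstHom k _ _).comp (symDerAux c) = AlgHom.id k _ := by
    apply SymmetricAlgebra.algHom_ext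
    ext x
    simp [symDerAux]
  exact congr($this p)

/-- The derivation of the symmetric algebra whose restriction to the generators is the linear
form `c`. -/
def symDer (c : M →ₗ[k] k) : SymmetricAlgebra k M →ₗ[k] SymmetricAlgebra k M :=
  ((TrivSqZeroExt.sndHom (SymmetricAlgebra k M) (SymmetricAlgebra k M)).restrictScalars k) ∘ₗ
    (symDerAux c).toLinearMap

theorem symDer_ι (c : M →ₗ[k] k) (x : M) :
    symDer c (SymmetricAlgebra.ι k M x) = algebraMap k _ (c x) := by
  simp [symDer, symDerAux, Algebra.algebraMap_eq_smul_one]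

theorem symDer_mul (c : M →ₗ[k] k) (p q : SymmetricAlgebra k M) :
    symDer c (p * q) = p * symDer c q + symDer c p * q := by
  simp [symDer, symDerAux_fst, mul_comm]

theorem symDer_algebraMap (c : M →ₗ[k] k) (r : k) :
    symDer c (algebraMap k _ r) = 0 := by
  simp [symDer, TrivSqZeroExt.algebraMap_eq_inl']

theorem symDer_one (c : M →ₗ[k] k) : symDer c (1 : SymmetricAlgebra k M) = 0 := by
  simp [symDer]

theorem symDer_comm (c d : M →ₗ[k] k) (p : SymmetricAlgebra k M) :
    symDer c (symDer d p) = symDer d (symDer c p) := by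
  induction p using SymmetricAlgebra.induction with
  | algebraMap r => simp [symDer_algebraMap]
  | ι x => simp [symDer_ι, symDer_algebraMap]
  | mul a b ha hb => simp only [symDer_mul, map_add, ha, hb]; ring
  | add a b ha hb => simp only [map_add, ha, hb]

theorem symDer_add (c d : M →ₗ[k] k) (p : SymmetricAlgebra k M) :
    symDer (c + d) p = symDer c p + symDer d p := by
  induction p using SymmetricAlgebra.induction with
  | algebraMap r => simp [symDer_algebraMap]
  | ι x => simp [symDer_ι]
  | mul a b ha hb => simp only [symDer_mul, ha, hb]; ring
  | add a b ha hb => simp only [map_add, ha, hb]; ring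

theorem symDer_smul (t : k) (c : M →ₗ[k] k) (p : SymmetricAlgebra k M) :
    symDer (t • c) p = t • symDer c p := by
  induction p using SymmetricAlgebra.induction with
  | algebraMap r => simp [symDer_algebraMap]
  | ι x => simp [symDer_ι, Algebra.smul_def]
  | mul a b ha hb => simp only [symDer_mul, ha, hb, smul_add, mul_smul_comm, smul_mul_assoc]
  | add a b ha hb => simp only [map_add, ha, hb, smul_add]

theorem symDer_prod {α : Type*} [DecidableEq α] (c : M →ₗ[k] k) (t : Finset α) (w : α → M) :
    symDer c (∏ i ∈ t, SymmetricAlgebra.ι k M (w i)) =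
      ∑ j ∈ t, c (w j) • ∏ i ∈ t.erase j, SymmetricAlgebra.ι k M (w i) := by
  induction t using Finset.induction_on with
  | empty => simp [symDer_one]
  | insert a t ha ih =>
    rw [Finset.prod_insert ha, symDer_mul, ih, symDer_ι, Finset.sum_insert ha,
      Finset.erase_insert ha, Algebra.smul_def, add_comm, Finset.mul_sum]
    congr 1
    refine Finset.sum_congr rfl fun j hj => ?_
    have hne : a ≠ j := fun h => ha (h ▸ hj)
    rw [Finset.erase_insert_of_ne hne, Finset.prod_insert (by simp [ha]), mul_smul_comm]

theorem prod_erase_eq {A : Type*} [CommMonoid A] {n : ℕ} (g : Fin (n + 1) → A) (j : Fin (n + 1)) :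
    ∏ i ∈ Finset.univ.erase j, g i = ∏ l : Fin n, g (Equiv.swap 0 j l.succ) := by
  have h : Finset.univ.erase j =
      (Finset.univ : Finset (Fin n)).map
        ((Fin.succEmb n).trans (Equiv.swap 0 j).toEmbedding) := by
    ext i
    simp only [Finset.mem_erase, Finset.mem_univ, and_true, Finset.mem_map, true_and,
      Function.Embedding.trans_apply, Equiv.coe_toEmbedding]
    constructor
    · intro hi
      have h0 : Equiv.swap 0 j i ≠ 0 := by
        intro h0
        apply hi
        have h3 := congrArg (Equiv.swap 0 j) h0
        rwa [Equiv.swap_apply_self, Equiv.swap_apply_left] at h3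
      obtain ⟨l, hl⟩ := Fin.exists_succ_eq.2 h0
      exact ⟨l, by change Equiv.swap 0 j l.succ = i; rw [hl, Equiv.swap_apply_self]⟩
    · rintro ⟨l, rfl⟩ h
      have h2 := congrArg (Equiv.swap 0 j) h
      rw [Equiv.swap_apply_self, Equiv.swap_apply_right] at h2
      exact Fin.succ_ne_zero l h2
  rw [h, Finset.prod_map]
  rfl

end SymmetricAlgebraTools

section Fock

variable {k H : Type*} [Field k] [AddCommGroup H] [Module k H]

/-- The Heisenberg Lie algebra `H ⊕ k ħ` of an alternating form, with bracket
`[a + λ ħ, b + μ ħ] = (a, b) ħ`. -/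
def Heisenberg (ω : LinearMap.BilinForm k H) (_ : ω.IsAlt) : Type _ := H × k

namespace Heisenberg

variable {ω : LinearMap.BilinForm k H} {hω : ω.IsAlt}

instance : AddCommGroup (Heisenberg ω hω) := inferInstanceAs (AddCommGroup (H × k))

instance : Module k (Heisenberg ω hω) := inferInstanceAs (Module k (H × k))

instance : Bracket (Heisenberg ω hω) (Heisenberg ω hω) :=
  ⟨fun a b => ((0 : H), ω a.1 b.1)⟩

theorem bracket_def (a b : Heisenberg ω hω) :
    ⁅a, b⁆ = (((0 : H), ω a.1 b.1) : H × k) := rfl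

instance : LieRing (Heisenberg ω hω) where
  add_lie a b c := by
    refine Prod.ext ((add_zero (0 : H)).symm) ?_
    exact LinearMap.congr_fun (map_add ω a.1 b.1) c.1
  lie_add a b c := by
    refine Prod.ext ((add_zero (0 : H)).symm) ?_
    exact map_add (ω a.1) b.1 c.1
  lie_self a := Prod.ext rfl (hω a.1)
  leibniz_lie a b c := by
    refine Prod.ext (add_zero (0 : H)).symm ?_
    change ω a.1 0 = ω 0 c.1 + ω b.1 0
    simp

instance : LieAlgebra k (Heisenberg ω hω) where
  lie_smul t a b := by
    refine Prod.ext (smul_zero t).symm ?_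
    exact map_smul (ω a.1) t b.1

variable (hω) in
/-- The inclusion of `H` in the Heisenberg algebra. -/
def ofVector : H →ₗ[k] Heisenberg ω hω := LinearMap.inl k H k

variable (hω) in
/-- The central element `ħ`. -/
def hbar : Heisenberg ω hω := ((0 : H), (1 : k))

attribute [local instance] LieRing.ofAssociativeRing in
variable (hω) in
/-- The inclusion of `H` in the universal enveloping algebra of the Heisenberg algebra. -/
def envVector : H →ₗ[k] UniversalEnvelopingAlgebra k (Heisenberg ω hω) :=
  (UniversalEnvelopingAlgebra.ι k :
    Heisenberg ω hω →ₗ⁅k⁆ UniversalEnvelopingAlgebra k (Heisenberg ω hω)).toLinearMap ∘ₗ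
      ofVector hω

variable (hω) in
/-- The element `ħ` of the universal enveloping algebra. -/
def envHbar : UniversalEnvelopingAlgebra k (Heisenberg ω hω) :=
  UniversalEnvelopingAlgebra.ι k (hbar hω)

attribute [local instance] LieRing.ofAssociativeRing in
/-- The commutation relation `a b - b a = (a, b) ħ`. -/
theorem envVector_mul (a b : H) :
    envVector hω a * envVector hω b = envVector hω b * envVector hω a + ω a b • envHbar hω := by
  have h : ⁅ofVector hω a, ofVector hω b⁆ = ω a b • hbar hω :=
    Prod.ext (smul_zero _).symm (mul_one (ω a b)).symm
  have h2 := congrArg (UniversalEnvelopingAlgebra.ι k) h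
  rw [LieHom.map_lie, map_smul, LieRing.of_associative_ring_bracket] at h2
  exact sub_eq_iff_eq_add'.1 h2

attribute [local instance] LieRing.ofAssociativeRing in
theorem envHbar_comm (a : H) :
    envHbar hω * envVector hω a = envVector hω a * envHbar hω := by
  have h : ⁅hbar hω, ofVector hω a⁆ = 0 :=
    Prod.ext rfl (by change ω 0 a = 0; simp)
  have h2 := congrArg (UniversalEnvelopingAlgebra.ι k) h
  rw [LieHom.map_lie, map_zero, LieRing.of_associative_ring_bracket, sub_eq_zero] at h2
  exact h2

end Heisenberg

/-- The left ideal of the universal enveloping algebra of the Heisenberg algebra generated by `F`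
and `ħ - 1`. -/
def fockIdeal (ω : LinearMap.BilinForm k H) (hω : ω.IsAlt) (F : Submodule k H) :
    Submodule (UniversalEnvelopingAlgebra k (Heisenberg ω hω))
      (UniversalEnvelopingAlgebra k (Heisenberg ω hω)) :=
  Submodule.span _
    (Heisenberg.envVector hω '' (F : Set H) ∪ {Heisenberg.envHbar hω - 1})

/-- The Fock representation `𝔽(H, F)`: the representation of the Heisenberg algebra induced from
the character of `F ⊕ k ħ` given by the coefficient of `ħ`. The action of the enveloping algebra
is the module structure. -/
def FockSpace (ω : LinearMap.BilinForm k H) (hω : ω.IsAlt) (F : Submodule k H) : Type _ :=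
  UniversalEnvelopingAlgebra k (Heisenberg ω hω) ⧸ fockIdeal ω hω F

namespace FockSpace

variable {ω : LinearMap.BilinForm k H} {hω : ω.IsAlt} {F F' : Submodule k H}

open Heisenberg

instance : AddCommGroup (FockSpace ω hω F) :=
  inferInstanceAs (AddCommGroup (_ ⧸ fockIdeal ω hω F))

instance : Module (UniversalEnvelopingAlgebra k (Heisenberg ω hω)) (FockSpace ω hω F) :=
  inferInstanceAs (Module _ (_ ⧸ fockIdeal ω hω F))

instance : Module k (FockSpace ω hω F) :=
  inferInstanceAs (Module k (_ ⧸ fockIdeal ω hω F))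

instance : IsScalarTower k (UniversalEnvelopingAlgebra k (Heisenberg ω hω)) (FockSpace ω hω F) :=
  inferInstanceAs (IsScalarTower k _ (_ ⧸ fockIdeal ω hω F))

variable (ω hω F) in
/-- The quotient map from the enveloping algebra. -/
def mk : UniversalEnvelopingAlgebra k (Heisenberg ω hω)
    →ₗ[UniversalEnvelopingAlgebra k (Heisenberg ω hω)] FockSpace ω hω F :=
  (fockIdeal ω hω F).mkQ

variable (ω hω F) in
/-- The generator `v_o` of the Fock representation. -/
def vacuum : FockSpace ω hω F := mk ω hω F 1

theorem smul_vacuum (u : UniversalEnvelopingAlgebra k (Heisenberg ω hω)) :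
    u • vacuum ω hω F = mk ω hω F u := by
  rw [vacuum, ← map_smul, smul_eq_mul, mul_one]

theorem mk_eq_zero {u : UniversalEnvelopingAlgebra k (Heisenberg ω hω)} :
    mk ω hω F u = 0 ↔ u ∈ fockIdeal ω hω F :=
  Submodule.Quotient.mk_eq_zero _

theorem envVector_smul_vacuum (f : H) (hf : f ∈ F) : envVector hω f • vacuum ω hω F = 0 := by
  rw [smul_vacuum, mk_eq_zero]
  exact Submodule.subset_span (Or.inl ⟨f, hf, rfl⟩)

theorem envHbar_smul_vacuum : envHbar hω • vacuum ω hω F = vacuum ω hω F := by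
  rw [smul_vacuum, vacuum, ← sub_eq_zero, ← map_sub, mk_eq_zero]
  exact Submodule.subset_span (Or.inr rfl)

/-- The algebra map `Sym F' = U F' → U Ĥ` for an isotropic subspace `F'`. -/
def symToEnv (hω : ω.IsAlt) (F' : Submodule k H) (hF' : ∀ a ∈ F', ∀ b ∈ F', ω a b = 0) :
    SymmetricAlgebra k F' →ₐ[k] UniversalEnvelopingAlgebra k (Heisenberg ω hω) :=
  symLift (envVector hω ∘ₗ F'.subtype)
    (fun x y => by simpa [hF' x x.2 y y.2] using envVector_mul (hω := hω) (x : H) (y : H))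

theorem symToEnv_ι (hF' : ∀ a ∈ F', ∀ b ∈ F', ω a b = 0) (x : F') :
    symToEnv hω F' hF' (SymmetricAlgebra.ι k F' x) = envVector hω x :=
  symLift_ι _ _ x

theorem ι_mul_symToEnv (hF' : ∀ a ∈ F', ∀ b ∈ F', ω a b = 0) (f : H)
    (p : SymmetricAlgebra k F') :
    envVector hω f * symToEnv hω F' hF' p =
      symToEnv hω F' hF' p * envVector hω f +
        symToEnv hω F' hF' (symDer (ω f ∘ₗ F'.subtype) p) * envHbar hω := by
  induction p using SymmetricAlgebra.induction with
  | algebraMap r => simp [symDer_algebraMap, Algebra.commutes]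
  | ι x =>
    rw [symToEnv_ι, envVector_mul, symDer_ι, AlgHom.commutes, Algebra.smul_def]
    rfl
  | mul a b ha hb =>
    have hc : ∀ q, envHbar hω * symToEnv hω F' hF' q =
        symToEnv hω F' hF' q * envHbar hω := by
      intro q
      induction q using SymmetricAlgebra.induction with
      | algebraMap r => simp [Algebra.commutes]
      | ι x => rw [symToEnv_ι, envHbar_comm]
      | mul a b ha hb => rw [map_mul, ← mul_assoc, ha, mul_assoc, hb, mul_assoc]
      | add a b ha hb => rw [map_add, mul_add, ha, hb, add_mul]
    rw [map_mul, ← mul_assoc, ha, add_mul, mul_assoc, hb, mul_assoc _ _ (symToEnv hω F' hF' b), hc,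
      symDer_mul, map_add, map_mul, map_mul]
    noncomm_ring
  | add a b ha hb => simp only [map_add, mul_add, add_mul, ha, hb]; abel

variable (hω F F') in
/-- The map `Sym F' → 𝔽(H, F)`, `p ↦ p v_o`. -/
def ofSym (hF' : ∀ a ∈ F', ∀ b ∈ F', ω a b = 0) :
    SymmetricAlgebra k F' →ₗ[k] FockSpace ω hω F :=
  (LinearMap.toSpanSingleton (UniversalEnvelopingAlgebra k (Heisenberg ω hω)) _
    (vacuum ω hω F)).restrictScalars k ∘ₗ (symToEnv hω F' hF').toLinearMap

theorem ofSym_apply (hF' : ∀ a ∈ F', ∀ b ∈ F', ω a b = 0) (p : SymmetricAlgebra k F') :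
    ofSym hω F F' hF' p = symToEnv hω F' hF' p • vacuum ω hω F := rfl

/-- The action of `a + λ ħ` on `Sym F'`: elements of `F'` act by multiplication, elements of `F`
by contraction, and `ħ` as the identity. -/
def heisAction (hω : ω.IsAlt) (h : IsCompl F F') :
    Heisenberg ω hω →ₗ[k] Module.End k (SymmetricAlgebra k F') where
  toFun a := symDer (ω (F.projectionOnto F' h a.1) ∘ₗ F'.subtype) +
    LinearMap.mulLeft k (SymmetricAlgebra.ι k F' (F'.projectionOnto F h.symm a.1)) +
    a.2 • LinearMap.id
  map_add' a b := by
    have h1 : (a + b).1 = a.1 + b.1 := rfl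
    have h2 : (a + b).2 = a.2 + b.2 := rfl
    rw [h1, h2]
    ext1 p
    simp only [map_add, Submodule.coe_add, LinearMap.add_comp, LinearMap.add_apply, symDer_add,
      LinearMap.mulLeft_apply, LinearMap.smul_apply, LinearMap.id_apply, add_mul, add_smul]
    abel
  map_smul' t a := by
    have h1 : (t • a).1 = t • a.1 := rfl
    have h2 : (t • a).2 = t • a.2 := rfl
    rw [h1, h2]
    ext1 p
    simp only [map_smul, Submodule.coe_smul, LinearMap.smul_comp, LinearMap.add_apply, symDer_smul,
      LinearMap.mulLeft_apply, LinearMap.smul_apply, LinearMap.id_apply, smul_mul_assoc, smul_add,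
      RingHom.id_apply, smul_smul, smul_eq_mul]

theorem heisAction_apply (h : IsCompl F F') (a : Heisenberg ω hω) (p : SymmetricAlgebra k F') :
    heisAction hω h a p = symDer (ω (F.projectionOnto F' h a.1) ∘ₗ F'.subtype) p +
      SymmetricAlgebra.ι k F' (F'.projectionOnto F h.symm a.1) * p + a.2 • p := rfl

theorem form_eq (h : IsCompl F F') (hF : ∀ a ∈ F, ∀ b ∈ F, ω a b = 0)
    (hF' : ∀ a ∈ F', ∀ b ∈ F', ω a b = 0) (a b : H) :
    ω a b = ω (F.projectionOnto F' h a) (F'.projectionOnto F h.symm b) +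
      ω (F'.projectionOnto F h.symm a) (F.projectionOnto F' h b) := by
  have ha : (F.projectionOnto F' h a : H) + (F'.projectionOnto F h.symm a : H) = a :=
    Submodule.projection_add_projection_eq_self h a
  have hb : (F.projectionOnto F' h b : H) + (F'.projectionOnto F h.symm b : H) = b :=
    Submodule.projection_add_projection_eq_self h b
  conv_lhs => rw [← ha, ← hb]
  simp only [map_add, LinearMap.add_apply]
  rw [hF _ (Subtype.mem _) _ (Subtype.mem _), hF' _ (Subtype.mem _) _ (Subtype.mem _)]
  ring

attribute [local instance] LieRing.ofAssociativeRing in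
/-- The action of the enveloping algebra on `Sym F'`. -/
def symAction (hω : ω.IsAlt) (h : IsCompl F F') (hF : ∀ a ∈ F, ∀ b ∈ F, ω a b = 0)
    (hF' : ∀ a ∈ F', ∀ b ∈ F', ω a b = 0) :
    UniversalEnvelopingAlgebra k (Heisenberg ω hω) →ₐ[k]
      Module.End k (SymmetricAlgebra k F') :=
  UniversalEnvelopingAlgebra.lift k
    { heisAction hω h with
      map_lie' := fun {a b} => by
        ext1 p
        change heisAction hω h ⁅a, b⁆ p = ⁅heisAction hω h a, heisAction hω h b⁆ p
        have h1 : ⁅a, b⁆.1 = 0 := rfl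
        have h2 : ⁅a, b⁆.2 = ω a.1 b.1 := rfl
        rw [LieRing.of_associative_ring_bracket, LinearMap.sub_apply, Module.End.mul_apply,
          Module.End.mul_apply]
        simp only [heisAction_apply, h1, h2, map_add, map_smul, symDer_mul, symDer_ι, map_zero,
          LinearMap.zero_comp, ZeroMemClass.coe_zero, LinearMap.comp_apply, Submodule.subtype_apply]
        rw [symDer_comm (ω (F.projectionOnto F' h b.1) ∘ₗ F'.subtype)]
        have hz : symDer (0 : F' →ₗ[k] k) p = 0 := by
          have := symDer_smul 0 (0 : F' →ₗ[k] k) p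
          simpa using this
        rw [hz, form_eq h hF hF' a.1 b.1,
          ← hω.neg_eq (F'.projectionOnto F h.symm a.1 : H) (F.projectionOnto F' h b.1 : H)]
        simp only [Algebra.smul_def, map_add, map_neg]
        ring }

attribute [local instance] LieRing.ofAssociativeRing in
theorem symAction_ι (h : IsCompl F F') (hF : ∀ a ∈ F, ∀ b ∈ F, ω a b = 0)
    (hF' : ∀ a ∈ F', ∀ b ∈ F', ω a b = 0) (a : Heisenberg ω hω) :
    symAction hω h hF hF' (UniversalEnvelopingAlgebra.ι k a) = heisAction hω h a :=
  UniversalEnvelopingAlgebra.lift_ι_apply k _ a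

theorem symAction_envVector (h : IsCompl F F') (hF : ∀ a ∈ F, ∀ b ∈ F, ω a b = 0)
    (hF' : ∀ a ∈ F', ∀ b ∈ F', ω a b = 0) (a : H) (p : SymmetricAlgebra k F') :
    symAction hω h hF hF' (envVector hω a) p =
      symDer (ω (F.projectionOnto F' h a) ∘ₗ F'.subtype) p +
        SymmetricAlgebra.ι k F' (F'.projectionOnto F h.symm a) * p := by
  have := congr($(symAction_ι (hω := hω) h hF hF' (ofVector hω a)) p)
  refine this.trans ?_
  rw [heisAction_apply]
  have h1 : (ofVector hω a).1 = a := rfl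
  have h2 : (ofVector hω a).2 = 0 := rfl
  rw [h1, h2, zero_smul, add_zero]

theorem symAction_envHbar (h : IsCompl F F') (hF : ∀ a ∈ F, ∀ b ∈ F, ω a b = 0)
    (hF' : ∀ a ∈ F', ∀ b ∈ F', ω a b = 0) :
    symAction hω h hF hF' (envHbar hω) = 1 := by
  refine (symAction_ι (hω := hω) h hF hF' (hbar hω)).trans ?_
  ext1 p
  rw [heisAction_apply]
  have h1 : (hbar hω).1 = 0 := rfl
  have h2 : (hbar hω).2 = 1 := rfl
  have hz : symDer (0 : F' →ₗ[k] k) p = 0 := by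
    have := symDer_smul 0 (0 : F' →ₗ[k] k) p
    simpa using this
  simp [h1, h2, hz]

theorem symAction_symToEnv (h : IsCompl F F') (hF : ∀ a ∈ F, ∀ b ∈ F, ω a b = 0)
    (hF' : ∀ a ∈ F', ∀ b ∈ F', ω a b = 0) (p q : SymmetricAlgebra k F') :
    symAction hω h hF hF' (symToEnv hω F' hF' p) q = p * q := by
  induction p using SymmetricAlgebra.induction generalizing q with
  | algebraMap r => simp [Algebra.smul_def]
  | ι x =>
    rw [symToEnv_ι, symAction_envVector]
    have hz : symDer (0 : F' →ₗ[k] k) q = 0 := by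
      have := symDer_smul 0 (0 : F' →ₗ[k] k) q
      simpa using this
    simp [hz]
  | mul a b ha hb => rw [map_mul, map_mul, Module.End.mul_apply, hb, ha, mul_assoc]
  | add a b ha hb => rw [map_add, map_add, LinearMap.add_apply, ha, hb, add_mul]

attribute [local instance] LieRing.ofAssociativeRing in
/-- The intertwining property of `Sym F' → 𝔽(H, F)`. -/
theorem smul_ofSym (h : IsCompl F F') (hF : ∀ a ∈ F, ∀ b ∈ F, ω a b = 0)
    (hF' : ∀ a ∈ F', ∀ b ∈ F', ω a b = 0)
    (u : UniversalEnvelopingAlgebra k (Heisenberg ω hω)) (p : SymmetricAlgebra k F') :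
    u • ofSym hω F F' hF' p = ofSym hω F F' hF' (symAction hω h hF hF' u p) := by
  let A : Subalgebra k (UniversalEnvelopingAlgebra k (Heisenberg ω hω)) :=
    { carrier := {u | ∀ p, u • ofSym hω F F' hF' p = ofSym hω F F' hF' (symAction hω h hF hF' u p)}
      mul_mem' := fun {a b} ha hb p => by
        rw [mul_smul, hb, ha, map_mul, Module.End.mul_apply]
      add_mem' := fun {a b} ha hb p => by
        rw [add_smul, hb, ha, map_add, LinearMap.add_apply, map_add]
      algebraMap_mem' := fun r p => by
        rw [algebraMap_smul, AlgHom.commutes, Module.algebraMap_end_apply, map_smul] }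
  have hvec : ∀ a : H, envVector hω a ∈ A := by
    intro a p
    rw [symAction_envVector, map_add, ofSym_apply, ofSym_apply, ofSym_apply, smul_smul, map_mul,
      symToEnv_ι]
    conv_lhs => rw [← Submodule.projection_add_projection_eq_self h a]
    rw [map_add, add_mul, add_smul]
    congr 1
    change (envVector hω (F.projectionOnto F' h a : H) * _) • _ = _
    rw [ι_mul_symToEnv hF', add_smul, mul_smul, mul_smul,
      envVector_smul_vacuum _ (Subtype.mem _), smul_zero, zero_add, envHbar_smul_vacuum]
  have hbarmem : envHbar hω ∈ A := by
    intro p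
    rw [symAction_envHbar, Module.End.one_apply]
    induction p using SymmetricAlgebra.induction with
    | algebraMap r =>
      rw [ofSym_apply, AlgHom.commutes, smul_smul, ← Algebra.commutes, mul_smul,
        envHbar_smul_vacuum]
    | ι x =>
      rw [ofSym_apply, symToEnv_ι, smul_smul, envHbar_comm, mul_smul, envHbar_smul_vacuum]
    | mul a b ha hb =>
      have hc : ∀ q, envHbar hω * symToEnv hω F' hF' q =
          symToEnv hω F' hF' q * envHbar hω := by
        intro q
        induction q using SymmetricAlgebra.induction with
        | algebraMap r => simp [Algebra.commutes]
        | ι x => rw [symToEnv_ι, envHbar_comm]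
        | mul a b ha hb => rw [map_mul, ← mul_assoc, ha, mul_assoc, hb, mul_assoc]
        | add a b ha hb => rw [map_add, mul_add, ha, hb, add_mul]
      rw [ofSym_apply, smul_smul, hc, mul_smul, envHbar_smul_vacuum]
    | add a b ha hb => rw [map_add, smul_add, ha, hb]
  have hι : ∀ a : Heisenberg ω hω, UniversalEnvelopingAlgebra.ι k a ∈ A := by
    intro a
    have ha : a = ofVector hω a.1 + a.2 • hbar hω :=
      Prod.ext (by change a.1 = a.1 + a.2 • (0 : H); simp)
        (by change a.2 = 0 + a.2 * 1; simp)
    rw [ha, map_add, map_smul]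
    exact A.add_mem (hvec a.1) (A.smul_mem hbarmem a.2)
  have key : (A.val).comp (UniversalEnvelopingAlgebra.lift k
      { toFun := fun a => (⟨UniversalEnvelopingAlgebra.ι k a, hι a⟩ : A)
        map_add' := fun a b => Subtype.ext (map_add _ a b)
        map_smul' := fun t a => Subtype.ext (map_smul _ t a)
        map_lie' := fun {a b} => Subtype.ext (LieHom.map_lie _ a b) }) = AlgHom.id k _ := by
    apply UniversalEnvelopingAlgebra.hom_ext
    ext a
    change ((UniversalEnvelopingAlgebra.lift k _ (UniversalEnvelopingAlgebra.ι k a) : A) :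
      UniversalEnvelopingAlgebra k (Heisenberg ω hω)) = _
    rw [UniversalEnvelopingAlgebra.lift_ι_apply]
    rfl
  have hu : u ∈ A := by
    have h3 := congr($key u)
    rw [AlgHom.id_apply] at h3
    rw [← h3]
    exact Subtype.mem _
  exact hu p

theorem ofSym_one (hF' : ∀ a ∈ F', ∀ b ∈ F', ω a b = 0) :
    ofSym hω F F' hF' 1 = vacuum ω hω F := by
  rw [ofSym_apply, map_one, one_smul]

theorem ofSym_bijective (h : IsCompl F F') (hF : ∀ a ∈ F, ∀ b ∈ F, ω a b = 0)
    (hF' : ∀ a ∈ F', ∀ b ∈ F', ω a b = 0) : Function.Bijective (ofSym hω F F' hF') := by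
  constructor
  · rw [injective_iff_map_eq_zero]
    intro p hp
    rw [ofSym_apply, smul_vacuum, mk_eq_zero] at hp
    have key : ∀ u ∈ fockIdeal ω hω F, symAction hω h hF hF' u 1 = 0 := by
      intro u hu
      induction hu using Submodule.span_induction with
      | mem x hx =>
        rcases hx with ⟨f, hf, rfl⟩ | rfl
        · rw [symAction_envVector, symDer_one,
            (Submodule.projectionOnto_apply_eq_zero_iff h.symm).2 hf, map_zero, zero_mul, add_zero]
        · rw [map_sub, symAction_envHbar, map_one (symAction hω h hF hF'), sub_self,
            LinearMap.zero_apply]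
      | zero => rw [map_zero, LinearMap.zero_apply]
      | add x y _ _ hx hy => rw [map_add, LinearMap.add_apply, hx, hy, add_zero]
      | smul a x _ hx => rw [smul_eq_mul, map_mul, Module.End.mul_apply, hx, map_zero]
    have := key _ hp
    rwa [symAction_symToEnv, mul_one] at this
  · intro x
    obtain ⟨u, rfl⟩ := Submodule.mkQ_surjective (fockIdeal ω hω F) x
    refine ⟨symAction hω h hF hF' u 1, ?_⟩
    rw [← smul_ofSym h hF hF', ofSym_one, smul_vacuum]
    rfl

variable (hω) in
/-- The isomorphism `Sym F' ≃ 𝔽(H, F)` of `F'`-modules defined by an isotropic complement `F'` of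
the isotropic subspace `F`. -/
def symEquiv (h : IsCompl F F') (hF : ∀ a ∈ F, ∀ b ∈ F, ω a b = 0)
    (hF' : ∀ a ∈ F', ∀ b ∈ F', ω a b = 0) :
    SymmetricAlgebra k F' ≃ₗ[k] FockSpace ω hω F :=
  LinearEquiv.ofBijective (ofSym hω F F' hF') (ofSym_bijective h hF hF')

end FockSpace
end Fock

/-- A polarized real Hodge structure of weight one on the complex vector space `H`. The real
structure is given by the anti-involution `conj`; `F` is the summand `H^{1,0}`. -/
structure PolarizedHodgeStructure (H : Type*) [AddCommGroup H] [Module ℂ H] where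
  /-- The symplectic form. -/
  form : LinearMap.BilinForm ℂ H
  form_alt : form.IsAlt
  form_nondeg : form.Nondegenerate
  /-- The complex conjugation. -/
  conj : H →ₗ⋆[ℂ] H
  conj_conj : ∀ a, conj (conj a) = a
  form_conj : ∀ a b, form (conj a) (conj b) = starRingEnd ℂ (form a b)
  /-- The summand `H^{1,0}`. -/
  F : Submodule ℂ H
  isotropic : ∀ a ∈ F, ∀ b ∈ F, form a b = 0
  isCompl : IsCompl F (F.map conj)
  pos : ∀ a ∈ F, a ≠ 0 → 0 < (Complex.I * form a (conj a)).re

namespace PolarizedHodgeStructure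

variable {H : Type*} [AddCommGroup H] [Module ℂ H] (P : PolarizedHodgeStructure H)

/-- The summand `F̄ = H^{0,1}`. -/
def Fbar : Submodule ℂ H := P.F.map P.conj

theorem isCompl_Fbar : IsCompl P.F P.Fbar := P.isCompl

theorem conj_mem_Fbar {a : H} (ha : a ∈ P.F) : P.conj a ∈ P.Fbar := ⟨a, ha, rfl⟩

theorem conj_mem_F {a : H} (ha : a ∈ P.Fbar) : P.conj a ∈ P.F := by
  obtain ⟨b, hb, rfl⟩ := ha
  rwa [P.conj_conj]

theorem isotropic_Fbar : ∀ a ∈ P.Fbar, ∀ b ∈ P.Fbar, P.form a b = 0 := by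
  rintro _ ⟨a, ha, rfl⟩ _ ⟨b, hb, rfl⟩
  rw [P.form_conj, P.isotropic a ha b hb, map_zero]

/-- The projection `H → F` along `F̄`. -/
def prF : H →ₗ[ℂ] P.F := P.F.projectionOnto P.Fbar P.isCompl_Fbar

/-- The projection `H → F̄` along `F`. -/
def prFbar : H →ₗ[ℂ] P.Fbar := P.Fbar.projectionOnto P.F P.isCompl_Fbar.symm

/-- Complex conjugation `F → F̄`. -/
def conjF : P.F →ₗ⋆[ℂ] P.Fbar :=
  (P.conj.comp P.F.subtype).codRestrict P.Fbar fun a => P.conj_mem_Fbar a.2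

/-- Complex conjugation `F̄ → F`. -/
def conjFbar : P.Fbar →ₗ⋆[ℂ] P.F :=
  (P.conj.comp P.Fbar.subtype).codRestrict P.F fun a => P.conj_mem_F a.2

/-- The Fock space `𝔽(H, F)`. -/
abbrev Fock : Type _ := FockSpace P.form P.form_alt P.F

/-- The enveloping algebra `U Ĥ` of the Heisenberg algebra; it acts on the Fock space. -/
abbrev Env : Type _ := UniversalEnvelopingAlgebra ℂ (Heisenberg P.form P.form_alt)

/-- The isomorphism `Sym F̄ ≃ 𝔽(H, F)`, `p ↦ p v_o`, of `F̄`-modules. -/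
def symEquiv : SymmetricAlgebra ℂ P.Fbar ≃ₗ[ℂ] P.Fock :=
  FockSpace.symEquiv P.form_alt P.isCompl_Fbar P.isotropic P.isotropic_Fbar

/-- The inner product `⟨z̄, w̄⟩ = √-1 (w, z̄)` on `F̄`, linear in the first variable. -/
def innerFbar (u v : P.Fbar) : ℂ := Complex.I * P.form (P.conj v) u

/-- The linear form `u ↦ ⟨u, z⟩` on `F̄`. -/
def innerForm (z : P.Fbar) : P.Fbar →ₗ[ℂ] ℂ :=
  (Complex.I • P.form (P.conj z)) ∘ₗ P.Fbar.subtype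

/-- The action of `z ∈ F̄` on antilinear forms on `Sym F̄` that is the transpose of the
contraction with `z`. -/
def innerAux : P.Fbar →ₗ[ℂ] Module.End ℂ (SymmetricAlgebra ℂ P.Fbar →ₗ⋆[ℂ] ℂ) where
  toFun z :=
    { toFun := fun φ => φ.comp (symDer (P.innerForm z))
      map_add' := fun _ _ => rfl
      map_smul' := fun _ _ => rfl }
  map_add' z w := by
    ext φ p
    have : P.innerForm (z + w) = P.innerForm z + P.innerForm w := by
      ext u; simp [innerForm]
    simp [this, symDer_add]
  map_smul' t z := by
    ext φ p
    have : P.innerForm (t • z) = (starRingEnd ℂ t) • P.innerForm z := by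
      ext u; simp [innerForm]; ring
    simp [this, symDer_smul]

theorem innerAux_comm (z w : P.Fbar) : P.innerAux z * P.innerAux w = P.innerAux w * P.innerAux z := by
  ext φ p
  exact congrArg φ (symDer_comm _ _ p)

/-- The inner product on `Sym F̄`, linear in the first and antilinear in the second variable.
It is characterised by `innerSym_prod`. -/
def innerSym : SymmetricAlgebra ℂ P.Fbar →ₗ[ℂ] SymmetricAlgebra ℂ P.Fbar →ₗ⋆[ℂ] ℂ :=
  (LinearMap.applyₗ ((starRingEnd ℂ).toSemilinearMap.comp
    (SymmetricAlgebra.algebraMapInv (R := ℂ) (M := P.Fbar)).toLinearMap)) ∘ₗ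
    (symLift P.innerAux P.innerAux_comm).toLinearMap

theorem innerSym_one (q : SymmetricAlgebra ℂ P.Fbar) :
    P.innerSym 1 q = starRingEnd ℂ (SymmetricAlgebra.algebraMapInv q) := by
  simp [innerSym]

/-- Multiplication by `z` is adjoint to contraction with `z`. -/
theorem innerSym_ι_mul (z : P.Fbar) (p q : SymmetricAlgebra ℂ P.Fbar) :
    P.innerSym (SymmetricAlgebra.ι ℂ P.Fbar z * p) q =
      P.innerSym p (symDer (P.innerForm z) q) := by
  have : symLift P.innerAux P.innerAux_comm (SymmetricAlgebra.ι ℂ P.Fbar z * p) =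
      P.innerAux z * symLift P.innerAux P.innerAux_comm p := by
    rw [map_mul, symLift_ι]
  simp only [innerSym, LinearMap.comp_apply, AlgHom.toLinearMap_apply, this]
  rfl

theorem conj_innerForm (z u : P.Fbar) :
    starRingEnd ℂ (P.innerForm z u) = P.innerFbar z u := by
  have h := P.form_conj (P.conj z) u
  rw [P.conj_conj, ← P.form_alt.neg_eq] at h
  simp [innerForm, innerFbar, ← h]

theorem innerSym_prod {n m : ℕ} (z : Fin n → P.Fbar) (w : Fin m → P.Fbar) :
    P.innerSym (∏ i, SymmetricAlgebra.ι ℂ P.Fbar (z i)) (∏ i, SymmetricAlgebra.ι ℂ P.Fbar (w i)) =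
      if h : n = m then
        ∑ τ : Equiv.Perm (Fin n), ∏ i, P.innerFbar (z i) (w (Fin.cast h (τ i)))
      else 0 := by
  induction n generalizing m with
  | zero =>
    rcases m with _ | m
    · simp [innerSym_one]
    · simp [innerSym_one, Fin.prod_univ_succ, SymmetricAlgebra.algebraMapInv_ι]
  | succ n ih =>
    rw [Fin.prod_univ_succ, innerSym_ι_mul, symDer_prod]
    rcases m with _ | m
    · simp
    · simp only [map_sum, LinearMap.map_smulₛₗ, conj_innerForm, prod_erase_eq, ih, smul_eq_mul]
      by_cases h : n = m
      · subst h
        simp only [dite_true, Fin.cast_refl, id_eq]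
        rw [← Equiv.sum_comp Equiv.Perm.decomposeFin.symm, Fintype.sum_prod_type]
        refine Finset.sum_congr rfl fun j _ => ?_
        rw [Finset.mul_sum]
        refine Finset.sum_congr rfl fun τ _ => ?_
        rw [Fin.prod_univ_succ]
        simp
      · simp [h]

/-- The inner product on the Fock space. -/
def innerFock (u v : P.Fock) : ℂ := P.innerSym (P.symEquiv.symm u) (P.symEquiv.symm v)

section

variable [FiniteDimensional ℂ H]

/-- The isomorphism `E : H ⊗ H ≃ End H`, `E (a ⊗ b) x = 2 (b, x) a`. -/
def tensorEnd : H ⊗[ℂ] H ≃ₗ[ℂ] (H →ₗ[ℂ] H) :=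
  TensorProduct.comm ℂ H H ≪≫ₗ
    TensorProduct.congr (P.form.toDual P.form_nondeg) (LinearEquiv.refl ℂ H) ≪≫ₗ
    dualTensorHomEquiv ℂ H H ≪≫ₗ
    LinearEquiv.smulOfNeZero ℂ (H →ₗ[ℂ] H) (2 : ℂ) two_ne_zero

theorem tensorEnd_tmul (a b x : H) : P.tensorEnd (a ⊗ₜ b) x = (2 * P.form b x) • a := by
  simp [tensorEnd, mul_smul, LinearMap.BilinForm.toDual_def]

end

/-- The image of an element of `H ⊗ H` in the enveloping algebra: `a ⊗ b ↦ a ∘ b`. -/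
def quad : H ⊗[ℂ] H →ₗ[ℂ] P.Env :=
  TensorProduct.lift ((LinearMap.mul ℂ P.Env).compl₁₂ (Heisenberg.envVector P.form_alt)
    (Heisenberg.envVector P.form_alt))

theorem quad_tmul (a b : H) :
    P.quad (a ⊗ₜ b) = Heisenberg.envVector P.form_alt a * Heisenberg.envVector P.form_alt b := rfl

end PolarizedHodgeStructure

section Geometry

open Bundle Filter
open scoped Manifold ContDiff Topology

/-- A complex manifold is a smooth real manifold of class `C^n` for every `n`. -/
instance isManifold_real_of_complex {E S : Type*} [NormedAddCommGroup E] [NormedSpace ℂ E]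
    [TopologicalSpace S] [ChartedSpace E S] [IsManifold 𝓘(ℂ, E) ω S] (n : ℕ∞ω) :
    IsManifold 𝓘(ℝ, E) n S := by
  have h : IsManifold 𝓘(ℂ, E) n S := IsManifold.of_le (n := ω) le_top
  refine isManifold_of_contDiffOn 𝓘(ℝ, E) n S fun e e' he he' => ?_
  have h2 := (contDiffGroupoid n 𝓘(ℂ, E)).compatible he he'
  exact ((mem_groupoid_of_pregroupoid.1 h2).1).restrict_scalars ℝ

section Basic

variable {E S : Type*} [NormedAddCommGroup E] [NormedSpace ℂ E]
  [TopologicalSpace S] [ChartedSpace E S]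

/-- The complex-valued function `f` is smooth (`C^∞` over `ℝ`) near `x`. -/
def SmoothFunNear (E : Type*) {S : Type*} [NormedAddCommGroup E] [NormedSpace ℂ E]
    [TopologicalSpace S] [ChartedSpace E S] (x : S) (f : S → ℂ) : Prop :=
  ∀ᶠ y in 𝓝 x, ContMDiffAt 𝓘(ℝ, E) 𝓘(ℝ, ℂ) ∞ f y

/-- The real vector field `X` is smooth near `x`. -/
def SmoothFieldNear [IsManifold 𝓘(ℂ, E) ω S] (x : S)
    (X : ∀ y : S, TangentSpace 𝓘(ℝ, E) y) : Prop :=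
  ∀ᶠ y in 𝓝 x, ContMDiffAt 𝓘(ℝ, E) (𝓘(ℝ, E).prod 𝓘(ℝ, E)) ∞
    (fun z => (⟨z, X z⟩ : TotalSpace E (TangentSpace 𝓘(ℝ, E) : S → Type _))) y

/-- The derivative `X f` of the complex-valued function `f` in the direction `X` at `x`. -/
def dirDeriv (f : S → ℂ) (x : S) (X : TangentSpace 𝓘(ℝ, E) x) : ℂ :=
  mvfderiv 𝓘(ℝ, E) f x X

/-- The complex structure on the real tangent spaces of a complex manifold. -/
def tangentI (x : S) (X : TangentSpace 𝓘(ℝ, E) x) : TangentSpace 𝓘(ℝ, E) x :=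
  (fun u : E => Complex.I • u) X

/-- The curvature `∇_X ∇_Y v - ∇_Y ∇_X v - ∇_{[X, Y]} v` at `x`. Here `N v x X` stands for
`(∇_X v)(x)`. -/
def curvatureOf {W : S → Type*} [∀ x, AddCommGroup (W x)]
    (N : (∀ y, W y) → ∀ x : S, TangentSpace 𝓘(ℝ, E) x → W x)
    (X Y : ∀ y : S, TangentSpace 𝓘(ℝ, E) y) (v : ∀ y, W y) (x : S) : W x :=
  N (fun y => N v y (Y y)) x (X x) - N (fun y => N v y (X y)) x (Y x) -
    N v x (VectorField.mlieBracket 𝓘(ℝ, E) X Y x)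

/-- `N` is a connection on a complex vector bundle with fibres `W x`, where `Sm x v` says that the
section `v` is smooth near `x`: `N v x` depends only on the germ of `v` at `x`, is `ℝ`-linear in
the tangent vector, additive in `v`, satisfies the Leibniz rule for smooth complex-valued
functions, and covariant derivatives of smooth sections along smooth vector fields are smooth. -/
structure IsConnection [IsManifold 𝓘(ℂ, E) ω S] (W : S → Type*) [∀ x, AddCommGroup (W x)]
    [∀ x, Module ℂ (W x)] (Sm : S → (∀ y, W y) → Prop)
    (N : (∀ y, W y) → ∀ x : S, TangentSpace 𝓘(ℝ, E) x → W x) : Prop where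
  congr : ∀ x v w, Sm x v → (∀ᶠ y in 𝓝 x, v y = w y) → N v x = N w x
  smooth : ∀ x v X, Sm x v → SmoothFieldNear x X → Sm x (fun y => N v y (X y))
  add : ∀ x v w X, Sm x v → Sm x w → N (fun y => v y + w y) x X = N v x X + N w x X
  leibniz : ∀ x f v X, SmoothFunNear E x f → Sm x v →
    N (fun y => f y • v y) x X = dirDeriv f x X • v x + f x • N v x X
  add_tangent : ∀ x v X Y, Sm x v → N v x (X + Y) = N v x X + N v x Y
  smul_tangent : ∀ x v (r : ℝ) X, Sm x v → N v x (r • X) = (r : ℂ) • N v x X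

/-- The connection `N` is unitary for the inner products `h x` on the fibres `W x`:
`X h(v, w) = h(∇_X v, w) + h(v, ∇_X w)` for smooth sections `v`, `w` and real tangent vectors
`X`. -/
def IsUnitaryConnection (W : S → Type*) (Sm : S → (∀ y, W y) → Prop)
    (h : ∀ x, W x → W x → ℂ) (N : (∀ y, W y) → ∀ x : S, TangentSpace 𝓘(ℝ, E) x → W x) : Prop :=
  ∀ x v w, Sm x v → Sm x w → SmoothFunNear E x (fun y => h y (v y) (w y)) ∧
    ∀ X : TangentSpace 𝓘(ℝ, E) x, dirDeriv (fun y => h y (v y) (w y)) x X =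
      h x (N v x X) (w x) + h x (v x) (N w x X)

/-- The connection `N` has scalar curvature equal to the complex-valued two-form `Ω`. -/
def HasScalarCurvature [IsManifold 𝓘(ℂ, E) ω S] (W : S → Type*) [∀ x, AddCommGroup (W x)]
    [∀ x, Module ℂ (W x)] (Sm : S → (∀ y, W y) → Prop)
    (N : (∀ y, W y) → ∀ x : S, TangentSpace 𝓘(ℝ, E) x → W x)
    (Ω : ∀ x : S, TangentSpace 𝓘(ℝ, E) x → TangentSpace 𝓘(ℝ, E) x → ℂ) : Prop :=
  ∀ x X Y v, SmoothFieldNear x X → SmoothFieldNear x Y → Sm x v →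
    curvatureOf N X Y v x = Ω x (X x) (Y x) • v x

/-- The connection `N` is projectively flat: its curvature is scalar. -/
def IsProjectivelyFlat [IsManifold 𝓘(ℂ, E) ω S] (W : S → Type*) [∀ x, AddCommGroup (W x)]
    [∀ x, Module ℂ (W x)] (Sm : S → (∀ y, W y) → Prop)
    (N : (∀ y, W y) → ∀ x : S, TangentSpace 𝓘(ℝ, E) x → W x) : Prop :=
  ∃ Ω : ∀ x : S, TangentSpace 𝓘(ℝ, E) x → TangentSpace 𝓘(ℝ, E) x → ℂ,
    HasScalarCurvature W Sm N Ω

end Basic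

section VHS

variable {E S Hm : Type*} [NormedAddCommGroup E] [NormedSpace ℂ E]
  [TopologicalSpace S] [ChartedSpace E S]
  [NormedAddCommGroup Hm] [NormedSpace ℂ Hm]
  {H : S → Type*} [∀ x, AddCommGroup (H x)] [∀ x, Module ℂ (H x)]
  [TopologicalSpace (TotalSpace Hm H)] [∀ x, TopologicalSpace (H x)]

/-- The section `a` is smooth near `x`. -/
def SmoothNear (E Hm : Type*) {S : Type*} [NormedAddCommGroup E] [NormedSpace ℂ E]
    [TopologicalSpace S] [ChartedSpace E S]
    [NormedAddCommGroup Hm] [NormedSpace ℂ Hm]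
    {H : S → Type*} [∀ x, AddCommGroup (H x)] [∀ x, Module ℂ (H x)]
    [TopologicalSpace (TotalSpace Hm H)] [∀ x, TopologicalSpace (H x)] [FiberBundle Hm H]
    (x : S) (a : ∀ y, H y) : Prop :=
  ∀ᶠ y in 𝓝 x, ContMDiffAt 𝓘(ℝ, E) (𝓘(ℝ, E).prod 𝓘(ℝ, Hm)) ∞
    (fun z => (⟨z, a z⟩ : TotalSpace Hm H)) y

section Smoothness

variable [FiberBundle Hm H]

theorem SmoothNear.add [VectorBundle ℝ Hm H] {x : S} {a b : ∀ y, H y} (ha : SmoothNear E Hm x a)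
    (hb : SmoothNear E Hm x b) : SmoothNear E Hm x (fun y => a y + b y) := by
  filter_upwards [ha, hb] with y hya hyb
  exact hya.add_section hyb

theorem SmoothNear.smul [VectorBundle ℂ Hm H] [VectorBundle ℝ Hm H]
    [ContMDiffVectorBundle ∞ Hm H 𝓘(ℝ, E)] {x : S} {a : ∀ y, H y} (c : ℂ)
    (ha : SmoothNear E Hm x a) :
    SmoothNear E Hm x (fun y => c • a y) := by
  filter_upwards [ha] with y hy
  rw [contMDiffAt_section] at hy ⊢
  have h2 : ContMDiffAt 𝓘(ℝ, E) 𝓘(ℝ, Hm) ∞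
      (fun z => c • (trivializationAt Hm H y ⟨z, a z⟩).2) y :=
    ((contDiff_const_smul c).contDiffAt (𝕜 := ℝ)).contMDiffAt.comp y hy
  refine h2.congr_of_eventuallyEq ?_
  filter_upwards [(trivializationAt Hm H y).open_baseSet.mem_nhds
    (mem_baseSet_trivializationAt Hm H y)] with z hz
  exact ((trivializationAt Hm H y).linear ℂ hz).map_smul c (a z)

end Smoothness

theorem finiteDimensional_fiber (Hm : Type*) {S : Type*} [TopologicalSpace S]
    [NormedAddCommGroup Hm] [NormedSpace ℂ Hm] [FiniteDimensional ℂ Hm]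
    (H : S → Type*) [∀ x, AddCommGroup (H x)] [∀ x, Module ℂ (H x)]
    [TopologicalSpace (TotalSpace Hm H)] [∀ x, TopologicalSpace (H x)] [FiberBundle Hm H]
    [VectorBundle ℂ Hm H] (x : S) : FiniteDimensional ℂ (H x) :=
  (Trivialization.continuousLinearEquivAt ℂ (trivializationAt Hm H x) x
    (mem_baseSet_trivializationAt Hm H x)).symm.toLinearEquiv.finiteDimensional

section Induced

/- Extension of a connection `D` on a subbundle `G` of `H` to a bundle of algebras with fibres `A x`
that is generated by `G` (through maps `gen x : G x → A x`), as a derivation. -/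
variable [FiberBundle Hm H] (G : ∀ x, Submodule ℂ (H x))
  (D : (∀ y, G y) → ∀ x : S, TangentSpace 𝓘(ℝ, E) x → G x)
  (A : S → Type*) [∀ x, Ring (A x)] [∀ x, Algebra ℂ (A x)] (gen : ∀ x, G x →ₗ[ℂ] A x)

/-- A section of the bundle of algebras `A` is smooth near `x` if near `x` it is a polynomial
expression in smooth functions and smooth sections of `G`. -/
def AlgSmoothNear (E Hm : Type*) {S : Type*} [NormedAddCommGroup E] [NormedSpace ℂ E]
    [TopologicalSpace S] [ChartedSpace E S] [NormedAddCommGroup Hm] [NormedSpace ℂ Hm]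
    {H : S → Type*} [∀ x, AddCommGroup (H x)] [∀ x, Module ℂ (H x)]
    [TopologicalSpace (TotalSpace Hm H)] [∀ x, TopologicalSpace (H x)] [FiberBundle Hm H]
    (G : ∀ x, Submodule ℂ (H x)) (A : S → Type*) [∀ x, Ring (A x)] [∀ x, Algebra ℂ (A x)]
    (gen : ∀ x, G x →ₗ[ℂ] A x) (x : S) (v : ∀ y, A y) : Prop :=
  ∃ w ∈ Algebra.adjoin ℂ
      ({w : ∀ y, A y | ∃ f : S → ℂ, SmoothFunNear E x f ∧ w = fun y => algebraMap ℂ (A y) (f y)} ∪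
        {w : ∀ y, A y | ∃ a : ∀ y, G y, SmoothNear E Hm x (fun y => (a y : H y)) ∧
          w = fun y => gen y (a y)}),
    ∀ᶠ y in 𝓝 x, v y = w y

/-- `InducedDeriv G D A gen x v L`: the covariant derivative at `x` of the section `v` of `A`, for
the connection that is a derivation, is `d` on functions and is `D` on sections of `G`, is the
function `L` of the tangent vector. -/
inductive InducedDeriv (x : S) :
    (∀ y, A y) → (TangentSpace 𝓘(ℝ, E) x → A x) → Prop
  | function (f : S → ℂ) (hf : SmoothFunNear E x f) :
      InducedDeriv x (fun y => algebraMap ℂ (A y) (f y))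
        (fun X => algebraMap ℂ (A x) (dirDeriv f x X))
  | generator (a : ∀ y, G y) (ha : SmoothNear E Hm x (fun y => (a y : H y))) :
      InducedDeriv x (fun y => gen y (a y)) (fun X => gen x (D a x X))
  | add {v w : ∀ y, A y} {L M : TangentSpace 𝓘(ℝ, E) x → A x}
      (hv : InducedDeriv x v L) (hw : InducedDeriv x w M) :
      InducedDeriv x (fun y => v y + w y) (fun X => L X + M X)
  | mul {v w : ∀ y, A y} {L M : TangentSpace 𝓘(ℝ, E) x → A x}
      (hv : InducedDeriv x v L) (hw : InducedDeriv x w M) :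
      InducedDeriv x (fun y => v y * w y) (fun X => L X * w x + v x * M X)
  | congr {v w : ∀ y, A y} {L : TangentSpace 𝓘(ℝ, E) x → A x}
      (hv : InducedDeriv x v L) (h : ∀ᶠ y in 𝓝 x, v y = w y) : InducedDeriv x w L

open Classical in
/-- The connection on the bundle of algebras `A` induced by the connection `D` on `G`. -/
def inducedConn (v : ∀ y, A y) (x : S) (X : TangentSpace 𝓘(ℝ, E) x) : A x :=
  if h : ∃ L, InducedDeriv (Hm := Hm) G D A gen x v L then h.choose X else 0

/-- The connection `D` on `G` extends to the bundle of algebras `A`: every smooth section has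
exactly one covariant derivative in the sense of `InducedDeriv`. -/
def ExtendsUniquely : Prop :=
  ∀ x v, AlgSmoothNear E Hm G A gen x v → ∃! L, InducedDeriv (Hm := Hm) G D A gen x v L

end Induced

/-- A polarized variation of real Hodge structure of weight one over the complex manifold `S`
(with model space `E`), on a smooth complex vector bundle `H` (with model fibre `Hm`). Smooth
sections are smooth over `ℝ`; `conn a x X` is the covariant derivative of the section `a` at `x`
along the real tangent vector `X`. -/
structure PolarizedVHS (E Hm : Type*) {S : Type*} [NormedAddCommGroup E] [NormedSpace ℂ E]
    [TopologicalSpace S] [ChartedSpace E S] [IsManifold 𝓘(ℂ, E) ω S]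
    [NormedAddCommGroup Hm] [NormedSpace ℂ Hm]
    (H : S → Type*) [∀ x, AddCommGroup (H x)] [∀ x, Module ℂ (H x)]
    [TopologicalSpace (TotalSpace Hm H)] [∀ x, TopologicalSpace (H x)]
    [∀ x, IsTopologicalAddGroup (H x)] [∀ x, ContinuousSMul ℝ (H x)] [FiberBundle Hm H] where
  /-- The polarized Hodge structure on the fibres. -/
  fiber : ∀ x, PolarizedHodgeStructure (H x)
  /-- The flat connection. -/
  conn : CovariantDerivative 𝓘(ℝ, E) Hm H
  conn_smooth : ∀ x X a, SmoothFieldNear x X → SmoothNear E Hm x a →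
    SmoothNear E Hm x (fun y => conn a y (X y))
  conn_I : ∀ x a X, SmoothNear E Hm x a →
    conn (fun y => Complex.I • a y) x X = Complex.I • conn a x X
  flat : ∀ x X Y a, SmoothFieldNear x X → SmoothFieldNear x Y → SmoothNear E Hm x a →
    curvatureOf (fun a x X => conn a x X) X Y a x = 0
  /-- The conjugation is smooth and flat. -/
  conj_smooth : ∀ x a, SmoothNear E Hm x a → SmoothNear E Hm x (fun y => (fiber y).conj (a y))
  conj_flat : ∀ x a X, SmoothNear E Hm x a →
    conn (fun y => (fiber y).conj (a y)) x X = (fiber x).conj (conn a x X)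
  /-- The symplectic form is smooth and flat. -/
  form_smooth : ∀ x a b, SmoothNear E Hm x a → SmoothNear E Hm x b →
    SmoothFunNear E x (fun y => (fiber y).form (a y) (b y))
  form_flat : ∀ x a b X, SmoothNear E Hm x a → SmoothNear E Hm x b →
    dirDeriv (E := E) (fun y => (fiber y).form (a y) (b y)) x X =
      (fiber x).form (conn a x X) (b x) + (fiber x).form (a x) (conn b x X)
  /-- `F` is a holomorphic subbundle: locally it has a frame consisting of smooth sections of `H`
  that are holomorphic, i.e. annihilated by the `(0,1)`-part of the connection. -/
  holomorphic : ∀ x, ∃ (n : ℕ) (a : Fin n → ∀ y, (fiber y).F),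
    (∀ i, SmoothNear E Hm x (fun y => (a i y : H y)) ∧
      ∀ᶠ y in 𝓝 x, ∀ X, conn (fun z => (a i z : H z)) y (tangentI y X) =
        Complex.I • conn (fun z => (a i z : H z)) y X) ∧
    ∀ᶠ y in 𝓝 x, LinearIndependent ℂ (fun i => a i y) ∧
      Submodule.span ℂ (Set.range fun i => a i y) = ⊤

namespace PolarizedVHS

variable [IsManifold 𝓘(ℂ, E) ω S]
    [∀ x, IsTopologicalAddGroup (H x)] [∀ x, ContinuousSMul ℝ (H x)] [FiberBundle Hm H]
  (V : PolarizedVHS E Hm H)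

/-- The subspace `F x` of the fibre `H x`. -/
abbrev F (x : S) : Submodule ℂ (H x) := (V.fiber x).F

/-- The subspace `F̄ x` of the fibre `H x`. -/
abbrev Fbar (x : S) : Submodule ℂ (H x) := (V.fiber x).Fbar

/-- The connection `∇^F` on `F`: the connection of `H` followed by projection along `F̄`. -/
def connF (a : ∀ y, V.F y) (x : S) (X : TangentSpace 𝓘(ℝ, E) x) : V.F x :=
  (V.fiber x).prF (V.conn (fun y => (a y : H y)) x X)

/-- The connection `∇^F̄` on `F̄`: the connection of `H` followed by projection along `F`. -/
def connFbar (a : ∀ y, V.Fbar y) (x : S) (X : TangentSpace 𝓘(ℝ, E) x) : V.Fbar x :=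
  (V.fiber x).prFbar (V.conn (fun y => (a y : H y)) x X)

section Sigma

theorem conn_add (x : S) (a b : ∀ y, H y) (X : TangentSpace 𝓘(ℝ, E) x)
    (ha : SmoothNear E Hm x a) (hb : SmoothNear E Hm x b) :
    V.conn (fun y => a y + b y) x X = V.conn a x X + V.conn b x X := by
  have h := V.conn.isCovariantDerivativeOnUniv.add
    (ha.self_of_nhds.mdifferentiableAt (by simp)) (hb.self_of_nhds.mdifferentiableAt (by simp))
  exact congr($h X)

theorem prFbar_conn_eq_zero (x : S) (X : TangentSpace 𝓘(ℝ, E) x) (d : ∀ y, V.F y)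
    (hd : SmoothNear E Hm x (fun y => (d y : H y))) (hdx : d x = 0) :
    (V.fiber x).prFbar (V.conn (fun y => (d y : H y)) x X) = 0 := by
  set P := V.fiber x
  set u := V.conn (fun y => (d y : H y)) x X
  obtain ⟨n, a, ha, hfr⟩ := V.holomorphic x
  have h1 : ∀ w : P.F, P.form u w = 0 := by
    have hj : ∀ j, P.form u (a j x) = 0 := by
      intro j
      have h := V.form_flat x _ _ X hd (ha j).1
      have h0 : (fun y => (V.fiber y).form (d y : H y) (a j y : H y)) = fun _ => 0 :=
        funext fun y => (V.fiber y).isotropic _ (Subtype.mem _) _ (Subtype.mem _)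
      rw [h0, hdx] at h
      simpa [dirDeriv, mvfderiv] using h.symm
    intro w
    have hw : w ∈ Submodule.span ℂ (Set.range fun i => a i x) := by
      rw [hfr.self_of_nhds.2]; trivial
    induction hw using Submodule.span_induction with
    | mem y hy => obtain ⟨j, rfl⟩ := hy; exact hj j
    | zero => simp
    | add y z _ _ hy hz => rw [Submodule.coe_add, map_add, hy, hz, add_zero]
    | smul c y _ hy => rw [Submodule.coe_smul, map_smul, hy, smul_zero]
  have hu : (P.prF u : H x) + (P.prFbar u : H x) = u :=
    Submodule.projection_add_projection_eq_self P.isCompl_Fbar u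
  have h2 : ∀ w ∈ P.F, P.form (P.prFbar u : H x) w = 0 := by
    intro w hw
    have h := h1 ⟨w, hw⟩
    rw [← hu, map_add, LinearMap.add_apply, P.isotropic _ (Subtype.mem _) _ hw, zero_add] at h
    exact h
  have h3 : ∀ w, P.form (P.prFbar u : H x) w = 0 := by
    intro w
    have hw : (P.prF w : H x) + (P.prFbar w : H x) = w :=
      Submodule.projection_add_projection_eq_self P.isCompl_Fbar w
    rw [← hw, map_add, h2 _ (Subtype.mem _),
      P.isotropic_Fbar _ (Subtype.mem _) _ (Subtype.mem _), add_zero]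
  exact Subtype.ext (P.form_nondeg.1 _ h3)

variable [VectorBundle ℂ Hm H] [VectorBundle ℝ Hm H] [ContMDiffVectorBundle ∞ Hm H 𝓘(ℝ, E)]

theorem conn_smul (x : S) (a : ∀ y, H y) (X : TangentSpace 𝓘(ℝ, E) x) (c : ℂ)
    (ha : SmoothNear E Hm x a) :
    V.conn (fun y => c • a y) x X = c • V.conn a x X := by
  have hr : ∀ (r : ℝ) (b : ∀ y, H y), SmoothNear E Hm x b →
      V.conn (fun y => (r : ℂ) • b y) x X = (r : ℂ) • V.conn b x X := by
    intro r b hb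
    have h := V.conn.isCovariantDerivativeOnUniv.smul_const r
      (hb.self_of_nhds.mdifferentiableAt (by simp))
    exact congr($h X)
  have hc : (fun y => c • a y) =
      fun y => (c.re : ℂ) • a y + (c.im : ℂ) • (Complex.I • a y) := by
    funext y
    rw [smul_smul, ← add_smul, Complex.re_add_im]
  rw [hc, V.conn_add x _ _ X (ha.smul _) ((ha.smul _).smul _), hr _ _ ha, hr _ _ (ha.smul _),
    V.conn_I x a X ha, smul_smul, ← add_smul, Complex.re_add_im]

/-- The second fundamental form exists: `σ (a) = pr_F̄ (∇ a)` is `C^∞`-linear in the section `a`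
of `F`. -/
theorem exists_sigma (x : S) (X : TangentSpace 𝓘(ℝ, E) x) :
    ∃ σ : V.F x →ₗ[ℂ] V.Fbar x, ∀ a : ∀ y, V.F y, SmoothNear E Hm x (fun y => (a y : H y)) →
      σ (a x) = (V.fiber x).prFbar (V.conn (fun y => (a y : H y)) x X) := by
  obtain ⟨n, e, he, hfr⟩ := V.holomorphic x
  let b := Module.Basis.mk hfr.self_of_nhds.1 hfr.self_of_nhds.2.ge
  refine ⟨b.constr ℂ (fun i => (V.fiber x).prFbar (V.conn (fun y => (e i y : H y)) x X)),
    fun a ha => ?_⟩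
  have hsum : ∀ t : Finset (Fin n),
      SmoothNear E Hm x (fun y => ((∑ i ∈ t, b.repr (a x) i • e i y : V.F y) : H y)) ∧
      (V.fiber x).prFbar (V.conn (fun y => ((∑ i ∈ t, b.repr (a x) i • e i y : V.F y) : H y)) x X) =
        ∑ i ∈ t, b.repr (a x) i •
          (V.fiber x).prFbar (V.conn (fun y => (e i y : H y)) x X) := by
    intro t
    induction t using Finset.induction_on with
    | empty =>
      have h0 : SmoothNear E Hm x (fun y => ((0 : V.F y) : H y)) := by
        have h := ha.smul (0 : ℂ)
        simpa using h
      simp only [Finset.sum_empty]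
      exact ⟨h0, V.prFbar_conn_eq_zero x X (fun y => 0) h0 rfl⟩
    | insert i t hi ih =>
      simp only [Finset.sum_insert hi, Submodule.coe_add, Submodule.coe_smul]
      refine ⟨((he i).1.smul _).add ih.1, ?_⟩
      rw [V.conn_add x _ _ X ((he i).1.smul _) ih.1, V.conn_smul x _ X _ (he i).1, map_add,
        map_smul, ih.2]
  obtain ⟨hs, hv⟩ := hsum Finset.univ
  have hd := V.prFbar_conn_eq_zero x X
    (fun y => a y + (-1 : ℂ) • ∑ i, b.repr (a x) i • e i y)
    (by simpa only [Submodule.coe_add, Submodule.coe_smul] using ha.add (hs.smul (-1)))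
    (by
      have h := b.sum_repr (a x)
      have hb : ∀ i, b i = e i x := fun i => by simp [b]
      simp only [hb] at h
      simp [h])
  simp only [Submodule.coe_add, Submodule.coe_smul] at hd
  rw [V.conn_add x _ _ X ha (hs.smul _), V.conn_smul x _ X _ hs, map_add, map_smul, hv] at hd
  rw [Module.Basis.constr_apply_fintype]
  simp only [Module.Basis.equivFun_apply]
  have h5 := add_eq_zero_iff_eq_neg.1 hd
  rw [h5]
  simp

/-- The second fundamental form `σ` of `F`. -/
def sigma (x : S) (X : TangentSpace 𝓘(ℝ, E) x) : V.F x →ₗ[ℂ] V.Fbar x :=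
  (V.exists_sigma x X).choose

theorem sigma_apply (x : S) (X : TangentSpace 𝓘(ℝ, E) x) (a : ∀ y, V.F y)
    (ha : SmoothNear E Hm x (fun y => (a y : H y))) :
    V.sigma x X (a x) = (V.fiber x).prFbar (V.conn (fun y => (a y : H y)) x X) :=
  (V.exists_sigma x X).choose_spec a ha

/-- The complex conjugate `σ̄` of `σ`. -/
def sigmaBar (x : S) (X : TangentSpace 𝓘(ℝ, E) x) : V.Fbar x →ₗ[ℂ] V.F x :=
  (V.fiber x).conjFbar.comp ((V.sigma x X).comp (V.fiber x).conjFbar)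

/-- The trace of the `End F`-valued two-form `σ̄ ∧ σ`. -/
def traceForm (x : S) (X Y : TangentSpace 𝓘(ℝ, E) x) : ℂ :=
  LinearMap.trace ℂ (V.F x)
    (V.sigmaBar x X ∘ₗ V.sigma x Y - V.sigmaBar x Y ∘ₗ V.sigma x X)

end Sigma

section Fock

/-- The fibre at `x` of the Fock bundle `𝔽(H, F)`. -/
abbrev FockFiber (x : S) : Type _ := (V.fiber x).Fock

/-- A section of the Fock bundle is smooth near `x` if the corresponding section of `Sym F̄` is. -/
def FockSmooth (x : S) (v : ∀ y, V.FockFiber y) : Prop :=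
  AlgSmoothNear E Hm V.Fbar (fun y => SymmetricAlgebra ℂ (V.Fbar y))
    (fun y => SymmetricAlgebra.ι ℂ (V.Fbar y)) x (fun y => (V.fiber y).symEquiv.symm (v y))

/-- The connection on `Sym F̄` extending `∇^F̄`. -/
def connSym (p : ∀ y, SymmetricAlgebra ℂ (V.Fbar y)) (x : S) (X : TangentSpace 𝓘(ℝ, E) x) :
    SymmetricAlgebra ℂ (V.Fbar x) :=
  inducedConn (Hm := Hm) V.Fbar V.connFbar (fun y => SymmetricAlgebra ℂ (V.Fbar y))
    (fun y => SymmetricAlgebra.ι ℂ (V.Fbar y)) p x X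

variable [FiniteDimensional ℂ Hm]
  [VectorBundle ℂ Hm H] [VectorBundle ℝ Hm H] [ContMDiffVectorBundle ∞ Hm H 𝓘(ℝ, E)]

/-- The value on `X` of the one-form `s` with values in `F ⊗ F ⊆ H ⊗ H`: the tensor with
`E (s X) = σ̄ (X) : F̄ → F`, where a map `F̄ → F` is regarded as an endomorphism of `H` that
vanishes on `F`. -/
def s (x : S) (X : TangentSpace 𝓘(ℝ, E) x) : H x ⊗[ℂ] H x :=
  haveI := finiteDimensional_fiber Hm H x
  (V.fiber x).tensorEnd.symm ((V.F x).subtype ∘ₗ V.sigmaBar x X ∘ₗ (V.fiber x).prFbar)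

/-- The value on `X` of the one-form `s̄` with values in `F̄ ⊗ F̄ ⊆ H ⊗ H`: the tensor with
`E (s̄ X) = σ (X) : F → F̄`, where a map `F → F̄` is regarded as an endomorphism of `H` that
vanishes on `F̄`. -/
def sBar (x : S) (X : TangentSpace 𝓘(ℝ, E) x) : H x ⊗[ℂ] H x :=
  haveI := finiteDimensional_fiber Hm H x
  (V.fiber x).tensorEnd.symm ((V.Fbar x).subtype ∘ₗ V.sigma x X ∘ₗ (V.fiber x).prF)

/-- The connection `∇^𝔽 = ∇^F̄ + ρ (s + s̄)` on the Fock bundle. -/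
def connFock (v : ∀ y, V.FockFiber y) (x : S) (X : TangentSpace 𝓘(ℝ, E) x) : V.FockFiber x :=
  (V.fiber x).symEquiv (V.connSym (fun y => (V.fiber y).symEquiv.symm (v y)) x X) +
    (V.fiber x).quad (V.s x X + V.sBar x X) • v x

end Fock

section Det

/-- The fibre at `x` of the determinant line bundle of `F`: the top exterior power of `F x`. -/
abbrev DetFiber (x : S) : Type _ := ⋀[ℂ]^(Module.finrank ℂ (V.F x)) (V.F x)

/-- A section of `det F` is smooth near `x` if it is smooth as a section of the exterior algebra
of `F`. -/
def DetSmooth (x : S) (v : ∀ y, V.DetFiber y) : Prop :=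
  AlgSmoothNear E Hm V.F (fun y => ExteriorAlgebra ℂ (V.F y))
    (fun _ => ExteriorAlgebra.ι ℂ) x (fun y => (v y : ExteriorAlgebra ℂ (V.F y)))

/-- The connection on the exterior algebra of `F` extending `∇^F`. -/
def connExt (p : ∀ y, ExteriorAlgebra ℂ (V.F y)) (x : S) (X : TangentSpace 𝓘(ℝ, E) x) :
    ExteriorAlgebra ℂ (V.F x) :=
  inducedConn (Hm := Hm) V.F V.connF (fun y => ExteriorAlgebra ℂ (V.F y))
    (fun _ => ExteriorAlgebra.ι ℂ) p x X

/-- The connection on `det F` induced by `∇^F`: the component in the top exterior power of the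
connection on the exterior algebra (which preserves degrees). -/
def connDet (v : ∀ y, V.DetFiber y) (x : S) (X : TangentSpace 𝓘(ℝ, E) x) : V.DetFiber x :=
  DirectSum.decompose (fun i : ℕ => ⋀[ℂ]^i (V.F x))
    (V.connExt (fun y => (v y : ExteriorAlgebra ℂ (V.F y))) x X) (Module.finrank ℂ (V.F x))

end Det

end PolarizedVHS

end VHS
end Geometry
end

open Bundle
open scoped Manifold ContDiff

/-! The heart of the matter is that `∇^𝔽` is compatible with `∇^H` under the action of `H`: `∇^𝔽 (h
p) = (∇^H h) p + h ∇^𝔽 p`. On `Sym F̄`, elements of `F̄` act by multiplication and elements of `F`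
by contraction. The derivation `∇^F̄` is therefore compatible with the block-diagonal connection
`∇^F ⊕ ∇^F̄` on `H`, which is `∇^H - σ - σ̄` (`connSym_act`). A tensor `t` for which `E t` lies in
the symplectic Lie algebra satisfies `[ρ t, h] = (E t) h` (`quadAct_act`). Isotropy of `F` makes `σ`
symmetric, so `E (s + s̄) = σ + σ̄` is of this kind, and adding `ρ (s + s̄)` restores exactly the
missing terms (`connSymFock_act`).

Curvature: since `∇^H` is flat, the curvature operator commutes with `H` (`curvatureOf_act`).
Commuting with `F̄`, it is determined by its value on `1`; commuting with `F`, which kills `1`, that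
value is annihilated by all contractions, hence is a scalar (`curvatureOf_one`). This is Schur's
lemma for the Fock representation, done by hand. The scalar is a constant term: `s̄ (Y)` creates a
quadratic element from `1` and only `s (X)` brings it back to degree zero, which gives `-½ tr (σ̄
(X) σ (Y))` (`aug_quadTerm_quadTerm`).

Unitarity: the adjoint of `h` is `√-1 h̄` (`innerSym_act`), and conjugation is flat, so the claim
for `z p` follows from that for `p`. It remains to treat `p = 1`, where the skew-adjointness of `ρ
(s + s̄)` decides; this holds because `E (s + s̄)` is real and symplectic (`innerSym_quadTerm`).

Determinant: by the Gauss equation `∇^F` has curvature `-σ̄ ∧ σ` (`curvatureOf_connF`). The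
curvature acts on the exterior algebra as a derivation, so on the top power by the trace.

All this presupposes that `∇^F̄` and `∇^F` extend to well-defined derivations of `Sym F̄` and of the
exterior algebra. Existence is read off from a presentation of the section by generators.
Independence of the presentation is the point: the differences of candidate values are stable under
contractions and have augmentation zero, hence vanish (`Contraction.eq_zero_of_stable`,
`InducedDeriv.unique`). -/

noncomputable section

/-! ### Symmetric and exterior algebras treated together through their contractions. -/

section ContractionAlgebra

/-- An algebra generated by a vector space `M` whose generators commute up to a sign, together
with contraction operators for the linear forms on `M` and an augmentation. Symmetric and exterior
algebras are examples. -/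
structure Contraction {M A : Type*} [AddCommGroup M] [Module ℂ M] [Ring A] [Algebra ℂ A]
    (gen : M →ₗ[ℂ] A) where
  /-- The sign in the commutation rule of the generators. -/
  sign : ℂ
  sign_mul_sign : sign * sign = 1
  gen_mul_gen : ∀ x y, gen x * gen y = sign • (gen y * gen x)
  adjoin_gen : Algebra.adjoin ℂ (Set.range gen) = ⊤
  /-- The automorphism that multiplies the generators by the sign. -/
  parity : A →ₐ[ℂ] A
  parity_gen : ∀ x, parity (gen x) = sign • gen x
  /-- The contraction with a linear form. -/
  contr : Module.Dual ℂ M → A →ₗ[ℂ] A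
  contr_gen : ∀ d x, contr d (gen x) = algebraMap ℂ A (d x)
  contr_mul : ∀ d p q, contr d (p * q) = contr d p * q + parity p * contr d q
  /-- The augmentation. -/
  aug : A →ₐ[ℂ] ℂ
  aug_gen : ∀ x, aug (gen x) = 0

namespace Contraction

variable {M A : Type*} [AddCommGroup M] [Module ℂ M] [Ring A] [Algebra ℂ A] {gen : M →ₗ[ℂ] A}
  (C : Contraction gen)

theorem contr_one (d : Module.Dual ℂ M) : C.contr d 1 = 0 := by
  have h := C.contr_mul d 1 1
  rw [mul_one, mul_one, map_one C.parity, one_mul] at h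
  exact left_eq_add.1 h

theorem contr_algebraMap (d : Module.Dual ℂ M) (c : ℂ) : C.contr d (algebraMap ℂ A c) = 0 := by
  rw [Algebra.algebraMap_eq_smul_one, map_smul, contr_one, smul_zero]

theorem contr_gen_mul (d : Module.Dual ℂ M) (x : M) (p : A) :
    C.contr d (gen x * p) = d x • p + C.sign • (gen x * C.contr d p) := by
  rw [contr_mul, contr_gen, parity_gen, smul_mul_assoc, ← Algebra.smul_def]

include C in
/-- Induction by multiplication with generators from the left. -/
theorem induction_gen_mul {motive : A → Prop} (one : motive 1)
    (gen_mul : ∀ x p, motive p → motive (gen x * p))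
    (add : ∀ p q, motive p → motive q → motive (p + q))
    (smul : ∀ (c : ℂ) p, motive p → motive (c • p)) (p : A) : motive p := by
  have h : ∀ p ∈ Algebra.adjoin ℂ (Set.range gen), ∀ q, motive q → motive (p * q) := by
    intro p hp
    induction hp using Algebra.adjoin_induction with
    | mem x hx => obtain ⟨y, rfl⟩ := hx; exact gen_mul y
    | algebraMap r =>
      intro q hq
      rw [← Algebra.smul_def]
      exact smul r q hq
    | add x y _ _ hx hy =>
      intro q hq
      rw [add_mul]
      exact add _ _ (hx q hq) (hy q hq)
    | mul x y _ _ hx hy =>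
      intro q hq
      rw [mul_assoc]
      exact hx _ (hy q hq)
  simpa using h p (by rw [C.adjoin_gen]; trivial) 1 one

variable {n : ℕ} (e : Fin n → M) (d : Fin n → Module.Dual ℂ M)

/-- The operator that multiplies products of `k` generators by `k`. -/
def euler : Module.End ℂ A := ∑ i, LinearMap.mulLeft ℂ (gen (e i)) ∘ₗ C.contr (d i)

theorem euler_apply (p : A) : C.euler e d p = ∑ i, gen (e i) * C.contr (d i) p := by
  simp [euler]

theorem euler_one : C.euler e d 1 = 0 := by
  simp [euler_apply, contr_one]

variable {e d}

/-- In the Leibniz rule the first terms add up to `gen x * p` because the `d i` are coordinates for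
the `e i`. In the others, moving `gen x` to the front produces a second sign that cancels the one
from `parity`. -/
theorem euler_gen_mul (h : ∀ x, ∑ i, d i x • e i = x) (x : M) (p : A) :
    C.euler e d (gen x * p) = gen x * p + gen x * C.euler e d p := by
  simp only [euler_apply, contr_gen_mul, mul_add, Finset.sum_add_distrib, mul_smul_comm,
    Finset.mul_sum]
  congr 1
  · conv_rhs => rw [← h x, map_sum, Finset.sum_mul]
    simp only [map_smul, smul_mul_assoc]
  · refine Finset.sum_congr rfl fun i _ => ?_
    rw [← mul_assoc, C.gen_mul_gen (e i) x, smul_mul_assoc, smul_smul, C.sign_mul_sign, one_smul,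
      mul_assoc]

/-- Multiplication by a generator raises the Euler eigenvalue by one, so whatever is not constant is
a sum of eigenvectors with eigenvalue at least one. The shift `k + 1` keeps the eigenvalue zero out.
-/
theorem exists_eigen_decomposition (h : ∀ x, ∑ i, d i x • e i = x) (p : A) :
    ∃ q ∈ ⨆ k : ℕ, (C.euler e d).eigenspace ((k : ℂ) + 1), p = algebraMap ℂ A (C.aug p) + q := by
  set W := ⨆ k : ℕ, (C.euler e d).eigenspace ((k : ℂ) + 1)
  have hgen : ∀ x, gen x ∈ W := by
    intro x
    refine Submodule.mem_iSup_of_mem 0 (Module.End.mem_eigenspace_iff.2 ?_)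
    have := C.euler_gen_mul h x 1
    rw [mul_one, euler_one, mul_zero, add_zero] at this
    rw [this]
    simp
  induction p using C.induction_gen_mul with
  | one => exact ⟨0, W.zero_mem, by simp⟩
  | gen_mul x p hp =>
    obtain ⟨q, hq, hpq⟩ := hp
    refine ⟨gen x * p, ?_, by simp [C.aug_gen]⟩
    rw [hpq, mul_add, ← Algebra.commutes, ← Algebra.smul_def]
    refine W.add_mem (W.smul_mem _ (hgen x)) ?_
    clear hpq
    induction hq using Submodule.iSup_induction' with
    | mem k y hy =>
      refine Submodule.mem_iSup_of_mem (k + 1) (Module.End.mem_eigenspace_iff.2 ?_)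
      rw [C.euler_gen_mul h, Module.End.mem_eigenspace_iff.1 hy, mul_smul_comm,
        add_comm (gen x * y)]
      push_cast
      simp only [add_smul, one_smul]
    | zero => rw [mul_zero]; exact W.zero_mem
    | add y z _ _ hy hz => rw [mul_add]; exact W.add_mem hy hz
  | add p q hp hq =>
    obtain ⟨p', hp', hp⟩ := hp
    obtain ⟨q', hq', hq⟩ := hq
    refine ⟨p' + q', W.add_mem hp' hq', ?_⟩
    conv_lhs => rw [hp, hq]
    rw [map_add, map_add]
    abel
  | smul c p hp =>
    obtain ⟨p', hp', hp⟩ := hp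
    refine ⟨c • p', W.smul_mem c hp', ?_⟩
    conv_lhs => rw [hp]
    rw [map_smul, smul_eq_mul, map_mul, smul_add, Algebra.smul_def]

/-- An element that is annihilated by all contractions is a constant. -/
theorem eq_algebraMap_of_contr_eq_zero (h : ∀ x, ∑ i, d i x • e i = x) {p : A}
    (hp : ∀ i, C.contr (d i) p = 0) : p = algebraMap ℂ A (C.aug p) := by
  obtain ⟨q, hq, hpq⟩ := C.exists_eigen_decomposition h p
  have h0 : C.euler e d p = 0 := by simp [euler_apply, hp]
  have hc : C.euler e d (algebraMap ℂ A (C.aug p)) = 0 := by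
    rw [Algebra.algebraMap_eq_smul_one, map_smul, euler_one, smul_zero]
  rw [hpq, map_add, hc, zero_add] at h0
  -- `q` is killed by the Euler operator and is also a sum of eigenvectors with nonzero eigenvalues.
  -- This is where characteristic zero matters.
  have hle : (⨆ k : ℕ, (C.euler e d).eigenspace ((k : ℂ) + 1)) ≤
      ⨆ μ, ⨆ _ : μ ≠ 0, (C.euler e d).eigenspace μ :=
    iSup_le fun k => le_iSup₂_of_le ((k : ℂ) + 1) (Nat.cast_add_one_ne_zero k) le_rfl
  have hq0 : q ∈ (C.euler e d).eigenspace 0 := by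
    rw [Module.End.mem_eigenspace_iff, h0, zero_smul]
  have := (Submodule.disjoint_def.1 ((Module.End.eigenspaces_iSupIndep (C.euler e d)) 0)) q hq0
    (hle hq)
  rw [this, add_zero] at hpq
  exact hpq

/-- All `k`-fold contractions with the linear forms `d i` vanish. -/
def ContrNil (d : Fin n → Module.Dual ℂ M) : ℕ → A → Prop
  | 0, p => p = 0
  | k + 1, p => ∀ i, ContrNil d k (C.contr (d i) p)

theorem ContrNil.add {k : ℕ} {p q : A} (hp : C.ContrNil d k p) (hq : C.ContrNil d k q) :
    C.ContrNil d k (p + q) := by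
  induction k generalizing p q with
  | zero => simp_all [ContrNil]
  | succ k ih => exact fun i => by rw [map_add]; exact ih (hp i) (hq i)

theorem ContrNil.smul {k : ℕ} {p : A} (c : ℂ) (hp : C.ContrNil d k p) :
    C.ContrNil d k (c • p) := by
  induction k generalizing p with
  | zero => simp_all [ContrNil]
  | succ k ih => exact fun i => by rw [map_smul]; exact ih (hp i)

theorem ContrNil.zero (k : ℕ) : C.ContrNil d k (0 : A) := by
  induction k with
  | zero => rfl
  | succ k ih => exact fun i => by rw [map_zero]; exact ih

theorem ContrNil.mono {k l : ℕ} (hkl : k ≤ l) {p : A} (hp : C.ContrNil d k p) :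
    C.ContrNil d l p := by
  induction k generalizing l p with
  | zero => rw [show p = 0 from hp]; exact ContrNil.zero C l
  | succ k ih =>
    obtain ⟨l, rfl⟩ : ∃ l', l = l' + 1 := ⟨l - 1, by omega⟩
    exact fun i => ih (by omega) (hp i)

theorem ContrNil.gen_mul {k : ℕ} {p : A} (x : M) (hp : C.ContrNil d k p) :
    C.ContrNil d (k + 1) (gen x * p) := by
  induction k generalizing p with
  | zero =>
    rw [show p = 0 from hp, mul_zero]
    exact ContrNil.zero C 1
  | succ k ih =>
    intro i
    rw [contr_gen_mul]
    exact (hp.smul C _).add C ((ih (hp i)).smul C _)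

-- Every element has a finite degree, measured by contractions; this replaces a grading in the
-- descent of `eq_zero_of_stable`.
variable (d) in
theorem exists_contrNil (p : A) : ∃ k, C.ContrNil d k p := by
  induction p using C.induction_gen_mul with
  | one => exact ⟨1, fun i => C.contr_one _⟩
  | gen_mul x p hp => exact ⟨_, hp.choose_spec.gen_mul C x⟩
  | add p q hp hq =>
    obtain ⟨k, hp⟩ := hp
    obtain ⟨l, hq⟩ := hq
    exact ⟨max k l, (hp.mono C (le_max_left k l)).add C (hq.mono C (le_max_right k l))⟩
  | smul c p hp => exact ⟨_, hp.choose_spec.smul C c⟩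

/-- A set of elements with zero augmentation that is stable under contractions contains at most
the zero element. -/
theorem eq_zero_of_stable (h : ∀ x, ∑ i, d i x • e i = x) (Z : A → Prop)
    (hZ : ∀ p, Z p → ∀ i, Z (C.contr (d i) p)) (haug : ∀ p, Z p → C.aug p = 0) {p : A}
    (hp : Z p) : p = 0 := by
  obtain ⟨k, hk⟩ := C.exists_contrNil d p
  induction k generalizing p with
  | zero => exact hk
  | succ k ih =>
    -- By induction the contractions of `p`, which again satisfy `Z`, are zero; so `p` is the
    -- constant given by its augmentation, which is zero too.
    rw [C.eq_algebraMap_of_contr_eq_zero h fun i => ih (hZ p hp i) (hk i), haug p hp, map_zero]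

end Contraction

/-- The contractions on the symmetric algebra. -/
def symContraction (M : Type*) [AddCommGroup M] [Module ℂ M] :
    Contraction (SymmetricAlgebra.ι ℂ M) where
  sign := 1
  sign_mul_sign := one_mul 1
  gen_mul_gen x y := by rw [one_smul, mul_comm]
  adjoin_gen := by
    rw [Algebra.eq_top_iff]
    intro p
    induction p using SymmetricAlgebra.induction with
    | algebraMap r => exact Subalgebra.algebraMap_mem _ r
    | ι x => exact Algebra.subset_adjoin ⟨x, rfl⟩
    | mul a b ha hb => exact Subalgebra.mul_mem _ ha hb
    | add a b ha hb => exact Subalgebra.add_mem _ ha hb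
  parity := AlgHom.id ℂ _
  parity_gen x := by simp
  contr d := symDer d
  contr_gen d x := symDer_ι d x
  contr_mul d p q := by rw [symDer_mul, add_comm]; rfl
  aug := SymmetricAlgebra.algebraMapInv
  aug_gen x := SymmetricAlgebra.algebraMapInv_ι x

/-- Built up from the rule for a single generator on the left; the signs picked up in passing the
factors of `p` are those recorded by `involute`. -/
theorem contractLeft_mul {M : Type*} [AddCommGroup M] [Module ℂ M] (d : Module.Dual ℂ M)
    (p q : ExteriorAlgebra ℂ M) :
    CliffordAlgebra.contractLeft d (p * q) = CliffordAlgebra.contractLeft d p * q +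
      CliffordAlgebra.involute p * CliffordAlgebra.contractLeft d q := by
  induction p using CliffordAlgebra.left_induction generalizing q with
  | algebraMap r =>
    rw [CliffordAlgebra.contractLeft_algebraMap_mul, CliffordAlgebra.contractLeft_algebraMap,
      zero_mul, zero_add, AlgHom.commutes]
  | add x y hx hy => rw [add_mul, map_add, hx, hy, map_add, map_add]; noncomm_ring
  | ι_mul x m hx =>
    rw [mul_assoc, CliffordAlgebra.contractLeft_ι_mul, hx, CliffordAlgebra.contractLeft_ι_mul,
      map_mul, CliffordAlgebra.involute_ι, sub_mul, smul_mul_assoc]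
    noncomm_ring

/-- The contractions on the exterior algebra. -/
def extContraction (M : Type*) [AddCommGroup M] [Module ℂ M] :
    Contraction (ExteriorAlgebra.ι ℂ (M := M)) where
  sign := -1
  sign_mul_sign := by norm_num
  gen_mul_gen x y := by
    rw [neg_smul, one_smul]
    exact eq_neg_of_add_eq_zero_left (ExteriorAlgebra.ι_add_mul_swap x y)
  adjoin_gen := CliffordAlgebra.adjoin_range_ι
  parity := CliffordAlgebra.involute
  parity_gen x := by rw [neg_smul, one_smul]; exact CliffordAlgebra.involute_ι x
  contr d := CliffordAlgebra.contractLeft d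
  contr_gen d x := CliffordAlgebra.contractLeft_ι (Q := 0) d x
  contr_mul := contractLeft_mul
  aug := ExteriorAlgebra.algebraMapInv
  aug_gen x := by simp [ExteriorAlgebra.algebraMapInv]

end ContractionAlgebra

/-! ### One Hodge structure: the actions of `H` and `H ⊗ H` on `Sym F̄` and their adjoints. -/

namespace PolarizedHodgeStructure

variable {H : Type*} [AddCommGroup H] [Module ℂ H] (P : PolarizedHodgeStructure H)

theorem prF_add_prFbar (u : H) : (P.prF u : H) + (P.prFbar u : H) = u :=
  Submodule.projection_add_projection_eq_self P.isCompl_Fbar u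

theorem prFbar_coe (u : P.Fbar) : P.prFbar (u : H) = u :=
  Submodule.projectionOnto_apply_left P.isCompl_Fbar.symm u

theorem prFbar_coe_F (u : P.F) : P.prFbar (u : H) = 0 :=
  (Submodule.projectionOnto_apply_eq_zero_iff P.isCompl_Fbar.symm).2 u.2

theorem prF_coe_Fbar (u : P.Fbar) : P.prF (u : H) = 0 :=
  (Submodule.projectionOnto_apply_eq_zero_iff P.isCompl_Fbar).2 u.2

theorem form_swap (a b : H) : P.form a b = -P.form b a := (P.form_alt.neg_eq b a).symm

/-- Since `F̄` is isotropic, pairing with an element of `F̄` only sees the component in `F`. This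
and its three variants remove projections from inside the form. -/
theorem form_prF_left (h : H) (u : P.Fbar) : P.form (P.prF h : H) u = P.form h u := by
  conv_rhs => rw [← P.prF_add_prFbar h, map_add, LinearMap.add_apply,
    P.isotropic_Fbar _ (Subtype.mem _) _ u.2, add_zero]

theorem form_prF_right (u : P.Fbar) (h : H) : P.form u (P.prF h : H) = P.form u h := by
  rw [P.form_swap, form_prF_left, ← P.form_swap]

theorem form_prFbar_left (h : H) (u : P.F) : P.form (P.prFbar h : H) u = P.form h u := by
  conv_rhs => rw [← P.prF_add_prFbar h, map_add, LinearMap.add_apply,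
    P.isotropic _ (Subtype.mem _) _ u.2, zero_add]

theorem form_prFbar_right (u : P.F) (h : H) : P.form u (P.prFbar h : H) = P.form u h := by
  rw [P.form_swap, form_prFbar_left, ← P.form_swap]

/-- The linear form `u ↦ (h, u)` on `F̄`. -/
def formFbar (h : H) : Module.Dual ℂ P.Fbar := P.form h ∘ₗ P.Fbar.subtype

/-- The linear form `u ↦ (h, u)` on `F`. -/
def formF (h : H) : Module.Dual ℂ P.F := P.form h ∘ₗ P.F.subtype

theorem formFbar_apply (h : H) (u : P.Fbar) : P.formFbar h u = P.form h u := rfl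

/-- The action of the enveloping algebra on `Sym F̄`. -/
def symRep : P.Env →ₐ[ℂ] Module.End ℂ (SymmetricAlgebra ℂ P.Fbar) :=
  FockSpace.symAction P.form_alt P.isCompl_Fbar P.isotropic P.isotropic_Fbar

theorem symEquiv_symRep (u : P.Env) (p : SymmetricAlgebra ℂ P.Fbar) :
    P.symEquiv (P.symRep u p) = u • P.symEquiv p :=
  (FockSpace.smul_ofSym P.isCompl_Fbar P.isotropic P.isotropic_Fbar u p).symm

/-- The action of `H` on `Sym F̄`. -/
def act : H →ₗ[ℂ] Module.End ℂ (SymmetricAlgebra ℂ P.Fbar) :=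
  P.symRep.toLinearMap ∘ₗ Heisenberg.envVector P.form_alt

/-- The action of `H ⊗ H` on `Sym F̄`. -/
def quadAct : H ⊗[ℂ] H →ₗ[ℂ] Module.End ℂ (SymmetricAlgebra ℂ P.Fbar) :=
  P.symRep.toLinearMap ∘ₗ P.quad

theorem quadAct_tmul (a b : H) (p : SymmetricAlgebra ℂ P.Fbar) :
    P.quadAct (a ⊗ₜ b) p = P.act a (P.act b p) := by
  simp only [quadAct, LinearMap.comp_apply, quad_tmul, AlgHom.toLinearMap_apply, map_mul,
    Module.End.mul_apply]
  rfl

/-- The contraction can be taken with all of `h`: its component in `F̄` pairs to zero with `F̄`. -/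
theorem act_apply (h : H) (p : SymmetricAlgebra ℂ P.Fbar) :
    P.act h p = symDer (P.formFbar h) p + SymmetricAlgebra.ι ℂ P.Fbar (P.prFbar h) * p := by
  have h1 : P.formFbar h = P.form (P.prF h : H) ∘ₗ P.Fbar.subtype := by
    ext u
    exact (P.form_prF_left h u).symm
  rw [h1]
  exact FockSpace.symAction_envVector P.isCompl_Fbar P.isotropic P.isotropic_Fbar h p

theorem formFbar_coe_Fbar (u : P.Fbar) : P.formFbar u = 0 := by
  ext w
  exact P.isotropic_Fbar _ u.2 _ w.2

theorem symDer_zero {M : Type*} [AddCommGroup M] [Module ℂ M] (p : SymmetricAlgebra ℂ M) :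
    symDer (0 : M →ₗ[ℂ] ℂ) p = 0 := by
  simpa using symDer_smul 0 (0 : M →ₗ[ℂ] ℂ) p

theorem act_F (a : P.F) (p : SymmetricAlgebra ℂ P.Fbar) :
    P.act a p = symDer (P.formFbar a) p := by
  rw [act_apply, prFbar_coe_F, map_zero, zero_mul, add_zero]

theorem act_Fbar (a : P.Fbar) (p : SymmetricAlgebra ℂ P.Fbar) :
    P.act a p = SymmetricAlgebra.ι ℂ P.Fbar a * p := by
  rw [act_apply, formFbar_coe_Fbar, symDer_zero, zero_add, prFbar_coe]

/-- The Heisenberg relation, with `ħ` acting as the identity. -/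
theorem act_comm (a b : H) (p : SymmetricAlgebra ℂ P.Fbar) :
    P.act a (P.act b p) = P.act b (P.act a p) + P.form a b • p := by
  have h := congrArg P.symRep (Heisenberg.envVector_mul (hω := P.form_alt) a b)
  have h2 : P.symRep (Heisenberg.envHbar P.form_alt) = 1 :=
    FockSpace.symAction_envHbar P.isCompl_Fbar P.isotropic P.isotropic_Fbar
  rw [map_add, map_mul, map_mul, map_smul, h2] at h
  exact congr($h p)

theorem aug_act (h : H) (p : SymmetricAlgebra ℂ P.Fbar) :
    SymmetricAlgebra.algebraMapInv (P.act h p) =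
      SymmetricAlgebra.algebraMapInv (symDer (P.formFbar h) p) := by
  rw [act_apply, map_add, map_mul, SymmetricAlgebra.algebraMapInv_ι, zero_mul, add_zero]

/-- The action of `h ∈ H` is adjoint to the action of `√-1 h̄`. -/
theorem innerSym_act (h : H) (p q : SymmetricAlgebra ℂ P.Fbar) :
    P.innerSym (P.act h p) q = P.innerSym p (Complex.I • P.act (P.conj h) q) := by
  -- On `F̄` this is the adjunction of multiplication and contraction: the inner product with `z` is
  -- the linear form `√-1 (z̄, ·)`.
  have hι : ∀ (z : P.Fbar) (p q), P.innerSym (SymmetricAlgebra.ι ℂ P.Fbar z * p) q =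
      P.innerSym p (Complex.I • P.act (P.conj z) q) := by
    intro z p q
    rw [innerSym_ι_mul, P.act_F ⟨P.conj z, P.conj_mem_F z.2⟩, ← symDer_smul]
    rfl
  -- For `a` in `F`, induct on `p` by moving `a` past one generator at a time. At `p = 1` both sides
  -- vanish: `a` kills `1`, and a multiple of `ā` has no constant term.
  have hF : ∀ (a : P.F) (q), P.innerSym (P.act a p) q =
      P.innerSym p (Complex.I • P.act (P.conj a) q) := by
    intro a
    induction p using (symContraction P.Fbar).induction_gen_mul with
    | one =>
      intro q
      rw [act_F, symDer_one, map_zero, LinearMap.zero_apply, innerSym_one, map_smul,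
        P.act_Fbar ⟨P.conj a, P.conj_mem_Fbar a.2⟩, map_mul, SymmetricAlgebra.algebraMapInv_ι]
      simp
    | gen_mul w p hp =>
      intro q
      rw [← P.act_Fbar w p, act_comm, act_Fbar, map_add, LinearMap.add_apply, hι, hp,
        map_smul P.innerSym, LinearMap.smul_apply, act_Fbar, hι, map_smul (P.act (P.conj w)), P.act_comm (P.conj w),
        P.form_conj, P.form_swap a w]
      simp only [smul_add, map_add, LinearMap.map_smulₛₗ, map_smul, smul_eq_mul,
        Complex.conj_I, Complex.conj_conj]
      -- What remains are the two commutator scalars, `(a, w)` on the left and `(w̄, ā)` carrying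
      -- the factor from two adjunctions on the right; they agree since `i² = -1`.
      linear_combination -(P.form w a * P.innerSym p q) * Complex.I_mul_I
    | add p p' hp hp' => intro q; simp only [map_add, LinearMap.add_apply, hp, hp']
    | smul c p hp => intro q; simp only [map_smul, LinearMap.smul_apply, hp]
  have hh := P.prF_add_prFbar h
  calc P.innerSym (P.act h p) q = P.innerSym (P.act (P.prF h : H) p) q +
        P.innerSym (P.act (P.prFbar h : H) p) q := by
        conv_lhs => rw [← hh]
        simp only [map_add, LinearMap.add_apply]
    _ = _ := by
        rw [hF, act_Fbar, hι, ← map_add, ← smul_add, ← LinearMap.add_apply, ← map_add P.act,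
          ← map_add P.conj, hh]

section

variable [FiniteDimensional ℂ H]

/-- The commutator of the actions of `H ⊗ H` and `H`. -/
theorem quadAct_act_aux (t : H ⊗[ℂ] H) (h : H) :
    ∃ h' : H, (∀ y, P.form h' y = P.form (P.tensorEnd t y) h) ∧
      ∀ p, P.quadAct t (P.act h p) =
        P.act h (P.quadAct t p) + P.act ((1 / 2 : ℂ) • (P.tensorEnd t h + h')) p := by
  induction t using TensorProduct.induction_on with
  | zero => exact ⟨0, by simp, by simp⟩
  | tmul a b =>
    -- The commutator of `ab` with `h` is `(b, h) a + (a, h) b`. The first summand is half of `E (a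
    -- ⊗ b) h`; the second is half of this witness, which up to sign is the symplectic adjoint of `E
    -- (a ⊗ b)` applied to `h`.
    refine ⟨(2 * P.form a h) • b, fun y => ?_, fun p => ?_⟩
    · rw [tensorEnd_tmul]
      simp only [map_smul, LinearMap.smul_apply, smul_eq_mul]
      ring
    · rw [quadAct_tmul, quadAct_tmul, P.act_comm b h, map_add, P.act_comm a h, tensorEnd_tmul]
      simp only [map_add, map_smul, LinearMap.add_apply, LinearMap.smul_apply, smul_add, smul_smul]
      rw [add_assoc, add_comm (P.form a h • _)]
      congr 3 <;> ring
  | add t u ht hu =>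
    obtain ⟨h1, ht, ht'⟩ := ht
    obtain ⟨h2, hu, hu'⟩ := hu
    refine ⟨h1 + h2, fun y => ?_, fun p => ?_⟩
    · simp only [map_add, LinearMap.add_apply, ht, hu]
    · simp only [map_add, LinearMap.add_apply, ht', hu', smul_add]
      abel

/-- The hypothesis says that `E t` belongs to the symplectic Lie algebra. Then the two halves in
`quadAct_act_aux` coincide and add up to `E t`, which is why `E` is normalised with the factor `2`.
-/
theorem quadAct_act {t : H ⊗[ℂ] H}
    (ht : ∀ x y, P.form (P.tensorEnd t x) y = P.form (P.tensorEnd t y) x) (h : H)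
    (p : SymmetricAlgebra ℂ P.Fbar) :
    P.quadAct t (P.act h p) = P.act h (P.quadAct t p) + P.act (P.tensorEnd t h) p := by
  obtain ⟨h', hh', hp⟩ := P.quadAct_act_aux t h
  have : h' = P.tensorEnd t h := by
    refine sub_eq_zero.1 (P.form_nondeg.1 _ fun y => ?_)
    rw [map_sub, LinearMap.sub_apply, hh', ht, sub_self]
  rw [hp, this, ← two_smul ℂ, smul_smul]
  norm_num

theorem innerSym_quadAct_aux (t : H ⊗[ℂ] H) : ∃ t' : H ⊗[ℂ] H,
    (∀ x y, P.form (P.tensorEnd t' x) y =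
      starRingEnd ℂ (P.form (P.tensorEnd t (P.conj y)) (P.conj x))) ∧
    ∀ p q, P.innerSym (P.quadAct t p) q = -P.innerSym p (P.quadAct t' q) := by
  induction t using TensorProduct.induction_on with
  | zero => exact ⟨0, by simp, by simp⟩
  | tmul a b =>
    -- Adjoints reverse the order, and each contributes a factor `√-1`: the adjoint of `ab` is `-b̄
    -- ā`.
    refine ⟨P.conj b ⊗ₜ P.conj a, fun x y => ?_, fun p q => ?_⟩
    · rw [tensorEnd_tmul, tensorEnd_tmul]
      simp only [map_smul, LinearMap.smul_apply, smul_eq_mul, map_mul, ← P.form_conj, P.conj_conj,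
        map_ofNat]
      ring
    · rw [quadAct_tmul, quadAct_tmul, innerSym_act, innerSym_act,
        map_smul (P.act (P.conj b)), smul_smul, Complex.I_mul_I, neg_smul, one_smul, map_neg]
  | add t u ht hu =>
    obtain ⟨t', ht, ht'⟩ := ht
    obtain ⟨u', hu, hu'⟩ := hu
    refine ⟨t' + u', fun x y => ?_, fun p q => ?_⟩
    · simp only [map_add, LinearMap.add_apply, ht, hu]
    · simp only [map_add, LinearMap.add_apply, ht', hu']
      ring

/-- For `E t` symplectic and commuting with conjugation, the tensor `t'` of `innerSym_quadAct_aux`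
has the same endomorphism as `t`, and `E` is injective. -/
theorem innerSym_quadAct {t : H ⊗[ℂ] H}
    (ht : ∀ x y, P.form (P.tensorEnd t x) y = P.form (P.tensorEnd t y) x)
    (ht' : ∀ x, P.conj (P.tensorEnd t (P.conj x)) = P.tensorEnd t x)
    (p q : SymmetricAlgebra ℂ P.Fbar) :
    P.innerSym (P.quadAct t p) q = -P.innerSym p (P.quadAct t q) := by
  obtain ⟨t', h1, h2⟩ := P.innerSym_quadAct_aux t
  have : t' = t := by
    apply P.tensorEnd.injective
    ext x
    refine sub_eq_zero.1 (P.form_nondeg.1 _ fun y => ?_)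
    rw [map_sub, LinearMap.sub_apply, h1, ht, ← P.form_conj, ht', P.conj_conj, sub_self]
  rw [h2, this]

/-- Only the contraction parts of both factors of `t` reach degree zero from degree two, and they
can be paired with `u` and `w` in two ways. The factor `1 / 2` undoes the `2` in `E`. -/
theorem aug_quadAct (t : H ⊗[ℂ] H) (u w : P.Fbar) :
    SymmetricAlgebra.algebraMapInv (P.quadAct t
      (SymmetricAlgebra.ι ℂ P.Fbar u * SymmetricAlgebra.ι ℂ P.Fbar w)) =
      1 / 2 * (P.form (P.tensorEnd t w) u + P.form (P.tensorEnd t u) w) := by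
  induction t using TensorProduct.induction_on with
  | zero => simp
  | tmul a b =>
    rw [quadAct_tmul, aug_act, act_apply, tensorEnd_tmul, tensorEnd_tmul]
    simp only [symDer_mul, map_add, symDer_ι, map_mul, SymmetricAlgebra.algebraMapInv_ι,
      symDer_algebraMap, AlgHom.commutes, Algebra.algebraMap_self, RingHom.id_apply, map_zero,
      formFbar_apply, map_smul, LinearMap.smul_apply, smul_eq_mul]
    ring
  | add t t' ht ht' =>
    simp only [map_add, LinearMap.add_apply, ht, ht']
    ring

end

end PolarizedHodgeStructure

end

noncomputable section

open Filter
open scoped Topology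

/-! ### Smooth complex-valued functions and their directional derivatives. -/

section Functions

variable {E S : Type*} [NormedAddCommGroup E] [NormedSpace ℂ E] [TopologicalSpace S]
  [ChartedSpace E S] {x : S} {f g : S → ℂ}

theorem SmoothFunNear.mdifferentiableAt (hf : SmoothFunNear E x f) :
    MDifferentiableAt 𝓘(ℝ, E) 𝓘(ℝ, ℂ) f x :=
  hf.self_of_nhds.mdifferentiableAt (by simp)

theorem SmoothFunNear.eventually (hf : SmoothFunNear E x f) :
    ∀ᶠ y in 𝓝 x, SmoothFunNear E y f :=
  eventually_eventually_nhds.2 hf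

theorem SmoothFunNear.congr (hf : SmoothFunNear E x f) (h : f =ᶠ[𝓝 x] g) :
    SmoothFunNear E x g := by
  filter_upwards [hf, eventually_eventually_nhds.2 h] with y hy hy'
  exact hy.congr_of_eventuallyEq (EventuallyEq.symm hy')

theorem SmoothFunNear.const (c : ℂ) : SmoothFunNear E x fun _ => c :=
  Eventually.of_forall fun _ => contMDiffAt_const

theorem SmoothFunNear.add (hf : SmoothFunNear E x f) (hg : SmoothFunNear E x g) :
    SmoothFunNear E x fun y => f y + g y := by
  filter_upwards [hf, hg] with y hy hy'
  exact ContMDiffAt.add hy hy'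

theorem SmoothFunNear.mul (hf : SmoothFunNear E x f) (hg : SmoothFunNear E x g) :
    SmoothFunNear E x fun y => f y * g y := by
  filter_upwards [hf, hg] with y hy hy'
  exact ((contDiff_mul (𝕜 := ℝ) (𝔸 := ℂ)).contDiffAt.comp_contMDiffAt
    (hy.prodMk_space hy'))

theorem SmoothFunNear.clm (L : ℂ →L[ℝ] ℂ) (hf : SmoothFunNear E x f) :
    SmoothFunNear E x fun y => L (f y) := by
  filter_upwards [hf] with y hy
  exact L.contDiff.contDiffAt.comp_contMDiffAt hy

theorem SmoothFunNear.conj (hf : SmoothFunNear E x f) :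
    SmoothFunNear E x fun y => starRingEnd ℂ (f y) :=
  hf.clm Complex.conjCLE.toContinuousLinearMap

theorem SmoothFunNear.inv (hf : SmoothFunNear E x f) (h : f x ≠ 0) :
    SmoothFunNear E x fun y => (f y)⁻¹ := by
  filter_upwards [hf, hf.self_of_nhds.continuousAt.eventually_ne h] with y hy hy'
  exact (contDiffAt_inv ℝ hy').comp_contMDiffAt hy

theorem SmoothFunNear.sum {ι : Type*} (t : Finset ι) {f : ι → S → ℂ}
    (hf : ∀ i ∈ t, SmoothFunNear E x (f i)) : SmoothFunNear E x fun y => ∑ i ∈ t, f i y := by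
  classical
  induction t using Finset.induction_on with
  | empty => simpa using SmoothFunNear.const 0
  | insert i t hi ih =>
    simp only [Finset.sum_insert hi]
    exact (hf i (by simp)).add (ih fun j hj => hf j (by simp [hj]))

theorem SmoothFunNear.prod {ι : Type*} (t : Finset ι) {f : ι → S → ℂ}
    (hf : ∀ i ∈ t, SmoothFunNear E x (f i)) : SmoothFunNear E x fun y => ∏ i ∈ t, f i y := by
  classical
  induction t using Finset.induction_on with
  | empty => simpa using SmoothFunNear.const 1
  | insert i t hi ih =>
    simp only [Finset.prod_insert hi]
    exact (hf i (by simp)).mul (ih fun j hj => hf j (by simp [hj]))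

theorem SmoothFunNear.det {n : ℕ} {A : S → Matrix (Fin n) (Fin n) ℂ}
    (hA : ∀ i j, SmoothFunNear E x fun y => A y i j) : SmoothFunNear E x fun y => (A y).det := by
  simp only [Matrix.det_apply']
  exact .sum _ fun τ _ => (SmoothFunNear.const _).mul (.prod _ fun i _ => hA _ _)

/-- Cramer's rule: the entries are polynomials in smooth functions divided by a determinant that
does not vanish near `x`. -/
theorem SmoothFunNear.matrix_inv {n : ℕ} {A : S → Matrix (Fin n) (Fin n) ℂ}
    (hA : ∀ i j, SmoothFunNear E x fun y => A y i j) (h : (A x).det ≠ 0) (i j : Fin n) :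
    SmoothFunNear E x fun y => (A y)⁻¹ i j := by
  simp only [Matrix.inv_def, Matrix.smul_apply, Matrix.adjugate_apply, Ring.inverse_eq_inv',
    smul_eq_mul]
  refine ((SmoothFunNear.det hA).inv h).mul (.det fun k l => ?_)
  by_cases hk : k = j
  · subst hk
    simpa using SmoothFunNear.const _
  · simpa [Matrix.updateRow_apply, hk] using hA k l

theorem dirDeriv_congr (h : f =ᶠ[𝓝 x] g) (X : TangentSpace 𝓘(ℝ, E) x) :
    dirDeriv f x X = dirDeriv g x X := by
  have h1 : f x = g x := h.self_of_nhds
  have h2 : mfderiv 𝓘(ℝ, E) 𝓘(ℝ, ℂ) f x X = mfderiv 𝓘(ℝ, E) 𝓘(ℝ, ℂ) g x X :=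
    congr($(h.mfderiv_eq) X)
  exact h2

theorem dirDeriv_const (c : ℂ) (X : TangentSpace 𝓘(ℝ, E) x) :
    dirDeriv (fun _ => c) x X = 0 := by
  rw [dirDeriv, mvfderiv_const]
  rfl

theorem dirDeriv_add (hf : SmoothFunNear E x f) (hg : SmoothFunNear E x g)
    (X : TangentSpace 𝓘(ℝ, E) x) :
    dirDeriv (fun y => f y + g y) x X = dirDeriv f x X + dirDeriv g x X :=
  congr($(mvfderiv_add hf.mdifferentiableAt hg.mdifferentiableAt) X)

theorem dirDeriv_clm (L : ℂ →L[ℝ] ℂ) (hf : SmoothFunNear E x f)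
    (X : TangentSpace 𝓘(ℝ, E) x) : dirDeriv (fun y => L (f y)) x X = L (dirDeriv f x X) := by
  have h := mfderiv_comp_apply (I := 𝓘(ℝ, E)) (I' := 𝓘(ℝ, ℂ)) (I'' := 𝓘(ℝ, ℂ)) (g := L) (f := f) x
    L.differentiableAt.mdifferentiableAt hf.mdifferentiableAt X
  refine h.trans ?_
  have h2 : mfderiv 𝓘(ℝ, ℂ) 𝓘(ℝ, ℂ) L (f x) = L := by
    rw [mfderiv_eq_fderiv]
    exact L.fderiv
  exact congr($h2 (mfderiv 𝓘(ℝ, E) 𝓘(ℝ, ℂ) f x X))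

theorem dirDeriv_conj (hf : SmoothFunNear E x f) (X : TangentSpace 𝓘(ℝ, E) x) :
    dirDeriv (fun y => starRingEnd ℂ (f y)) x X = starRingEnd ℂ (dirDeriv f x X) :=
  dirDeriv_clm Complex.conjCLE.toContinuousLinearMap hf X

theorem dirDeriv_mul (hf : SmoothFunNear E x f) (hg : SmoothFunNear E x g)
    (X : TangentSpace 𝓘(ℝ, E) x) :
    dirDeriv (fun y => f y * g y) x X = dirDeriv f x X * g x + f x * dirDeriv g x X := by
  have h := (hf.mdifferentiableAt.hasMFDerivAt.mul hg.mdifferentiableAt.hasMFDerivAt).mfderiv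
  refine congr($h X).trans ?_
  change f x * dirDeriv g x X + g x * dirDeriv f x X = _
  ring

theorem dirDeriv_add_tangent (X Y : TangentSpace 𝓘(ℝ, E) x) :
    dirDeriv f x (X + Y) = dirDeriv f x X + dirDeriv f x Y :=
  map_add (mvfderiv 𝓘(ℝ, E) f x) X Y

theorem dirDeriv_smul_tangent (r : ℝ) (X : TangentSpace 𝓘(ℝ, E) x) :
    dirDeriv f x (r • X) = (r : ℂ) * dirDeriv f x X :=
  (map_smul (mvfderiv 𝓘(ℝ, E) f x) r X).trans (Complex.real_smul)

/-! ### Derivatives along vector fields and their Lie bracket, computed in a chart. -/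

section Chart

theorem contDiffAt_comp_chart (hf : SmoothFunNear E x f) :
    ContDiffAt ℝ ∞ (f ∘ (extChartAt 𝓘(ℝ, E) x).symm) (extChartAt 𝓘(ℝ, E) x x) := by
  have h := hf.self_of_nhds
  rw [contMDiffAt_iff] at h
  have h2 := h.2
  simp only [mfld_simps, contDiffWithinAt_univ] at h2 ⊢
  exact h2

variable [IsManifold 𝓘(ℂ, E) ω S]

/-- A vector field in the chart at `x`. -/
def chartField (x : S) (X : ∀ y : S, TangentSpace 𝓘(ℝ, E) y) (z : E) : E :=
  VectorField.mpullbackWithin 𝓘(ℝ, E) 𝓘(ℝ, E) (extChartAt 𝓘(ℝ, E) x).symm X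
    (Set.range 𝓘(ℝ, E)) z

/-- The chain rule: the field in the chart is obtained by inverting the derivative of the inverse
chart, so that derivative cancels. -/
theorem fderiv_chartField (f : S → ℂ) (X : ∀ y : S, TangentSpace 𝓘(ℝ, E) y) {z : E}
    (hz : z ∈ (extChartAt 𝓘(ℝ, E) x).target)
    (hf : MDifferentiableAt 𝓘(ℝ, E) 𝓘(ℝ, ℂ) f ((extChartAt 𝓘(ℝ, E) x).symm z)) :
    fderiv ℝ (f ∘ (extChartAt 𝓘(ℝ, E) x).symm) z (chartField x X z) =
      dirDeriv f ((extChartAt 𝓘(ℝ, E) x).symm z) (X ((extChartAt 𝓘(ℝ, E) x).symm z)) := by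
  have hinv := isInvertible_mfderivWithin_extChartAt_symm (I := 𝓘(ℝ, E)) hz
  have hd : MDifferentiableWithinAt 𝓘(ℝ, E) 𝓘(ℝ, E) (extChartAt 𝓘(ℝ, E) x).symm
      (Set.range 𝓘(ℝ, E)) z := mdifferentiableWithinAt_extChartAt_symm hz
  have h := mfderiv_comp_mfderivWithin z hf hd
    (by simpa using uniqueMDiffWithinAt_univ 𝓘(ℝ, E))
  have hr : Set.range 𝓘(ℝ, E) = Set.univ := by simp
  have h2 : ∀ v : E, fderiv ℝ (f ∘ (extChartAt 𝓘(ℝ, E) x).symm) z v =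
      mfderiv 𝓘(ℝ, E) 𝓘(ℝ, ℂ) f ((extChartAt 𝓘(ℝ, E) x).symm z)
        (mfderivWithin 𝓘(ℝ, E) 𝓘(ℝ, E) (extChartAt 𝓘(ℝ, E) x).symm (Set.range 𝓘(ℝ, E)) z v) := by
    intro v
    rw [← mfderiv_eq_fderiv, ← mfderivWithin_univ, ← hr]
    exact congr($h v)
  rw [h2]
  exact congrArg (mfderiv 𝓘(ℝ, E) 𝓘(ℝ, ℂ) f ((extChartAt 𝓘(ℝ, E) x).symm z))
    (hinv.self_apply_inverse _)

theorem dirDeriv_comp_chart (hf : SmoothFunNear E x f) (X : ∀ y : S, TangentSpace 𝓘(ℝ, E) y) :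
    (fun y => dirDeriv f y (X y)) ∘ (extChartAt 𝓘(ℝ, E) x).symm =ᶠ[𝓝 (extChartAt 𝓘(ℝ, E) x x)]
      fun z => fderiv ℝ (f ∘ (extChartAt 𝓘(ℝ, E) x).symm) z (chartField x X z) := by
  have h1 : ∀ᶠ z in 𝓝 (extChartAt 𝓘(ℝ, E) x x),
      MDifferentiableAt 𝓘(ℝ, E) 𝓘(ℝ, ℂ) f ((extChartAt 𝓘(ℝ, E) x).symm z) := by
    have h2 := continuousAt_extChartAt_symm (I := 𝓘(ℝ, E)) x
    rw [ContinuousAt, extChartAt_to_inv] at h2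
    exact h2.eventually (hf.mono fun y hy => hy.mdifferentiableAt (by simp))
  filter_upwards [h1, extChartAt_target_mem_nhds (I := 𝓘(ℝ, E)) x] with z hz hz'
  exact (fderiv_chartField f X hz' hz).symm

variable [FiniteDimensional ℂ E]

theorem contDiffAt_chartField {X : ∀ y : S, TangentSpace 𝓘(ℝ, E) y}
    (hX : SmoothFieldNear x X) :
    ContDiffAt ℝ ∞ (chartField x X) (extChartAt 𝓘(ℝ, E) x x) := by
  have : CompleteSpace E := FiniteDimensional.complete ℂ E
  have h := VectorField.contMDiffWithinAt_mpullbackWithin_extChartAt_symm (I := 𝓘(ℝ, E))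
    (n := ∞) (m := ∞) (s := Set.univ) hX.self_of_nhds.contMDiffWithinAt uniqueMDiffOn_univ
    (Set.mem_univ x) (by simp)
  rw [Set.preimage_univ, Set.inter_univ] at h
  exact (contMDiffAt_vectorSpace_iff_contDiffAt (V := chartField x X)).1
    (h.contMDiffAt (extChartAt_target_mem_nhds (I := 𝓘(ℝ, E)) x))

theorem SmoothFunNear.dirDeriv (hf : SmoothFunNear E x f) {X : ∀ y : S, TangentSpace 𝓘(ℝ, E) y}
    (hX : SmoothFieldNear x X) : SmoothFunNear E x fun y => dirDeriv f y (X y) := by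
  filter_upwards [hf.eventually, eventually_eventually_nhds.2 hX] with y hy hy'
  have h1 : ContDiffAt ℝ ∞ (fun z => fderiv ℝ (f ∘ (extChartAt 𝓘(ℝ, E) y).symm) z
      (chartField y X z)) (extChartAt 𝓘(ℝ, E) y y) :=
    ((contDiffAt_comp_chart hy).fderiv_right (m := ∞) (by simp)).clm_apply
      (contDiffAt_chartField hy')
  have h2 := h1.comp_contMDiffAt (contMDiffAt_extChartAt (I := 𝓘(ℝ, E)) (n := ∞) (x := y))
  refine h2.congr_of_eventuallyEq ?_
  have h3 := (continuousAt_extChartAt (I := 𝓘(ℝ, E)) y).eventually (dirDeriv_comp_chart hy X)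
  filter_upwards [h3, extChartAt_source_mem_nhds (I := 𝓘(ℝ, E)) y] with z hz hzs
  refine Eq.trans ?_ hz
  simp only [Function.comp_apply]
  rw [(extChartAt 𝓘(ℝ, E) y).left_inv hzs]

/-- The derivative along the Lie bracket is the commutator of the derivatives. -/
theorem dirDeriv_mlieBracket (hf : SmoothFunNear E x f) {X Y : ∀ y : S, TangentSpace 𝓘(ℝ, E) y}
    (hX : SmoothFieldNear x X) (hY : SmoothFieldNear x Y) :
    dirDeriv f x (VectorField.mlieBracket 𝓘(ℝ, E) X Y x) =
      dirDeriv (fun y => dirDeriv f y (Y y)) x (X x) -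
        dirDeriv (fun y => dirDeriv f y (X y)) x (Y x) := by
  have hsnd : ∀ {X Y : ∀ y : S, TangentSpace 𝓘(ℝ, E) y}, SmoothFieldNear x X →
      SmoothFieldNear x Y → dirDeriv (fun y => dirDeriv f y (Y y)) x (X x) =
      fderiv ℝ (fun z => fderiv ℝ (f ∘ (extChartAt 𝓘(ℝ, E) x).symm) z (chartField x Y z))
        (extChartAt 𝓘(ℝ, E) x x) (chartField x X (extChartAt 𝓘(ℝ, E) x x)) := by
    intro X Y hX hY
    have h := fderiv_chartField (x := x) (fun y => dirDeriv f y (Y y)) X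
      (mem_extChartAt_target (I := 𝓘(ℝ, E)) x)
      (by rw [extChartAt_to_inv]; exact (hf.dirDeriv hY).mdifferentiableAt)
    rw [extChartAt_to_inv] at h
    rw [← h, (dirDeriv_comp_chart hf Y).fderiv_eq]
  rw [hsnd hX hY, hsnd hY hX]
  -- The vector space case, which rests on the symmetry of the second derivative; class `C^2`
  -- suffices.
  have hl := VectorField.fderiv_apply_lieBracket (n := ∞) (contDiffAt_comp_chart hf)
    (by rw [minSmoothness_of_isRCLikeNormedField]; exact WithTop.coe_le_coe.2 le_top)
    ((contDiffAt_chartField hY).differentiableAt (by simp))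
    ((contDiffAt_chartField hX).differentiableAt (by simp))
  rw [← hl]
  have hb : dirDeriv f x (VectorField.mlieBracket 𝓘(ℝ, E) X Y x) =
      fderiv ℝ (f ∘ (extChartAt 𝓘(ℝ, E) x).symm) (extChartAt 𝓘(ℝ, E) x x)
        (mfderiv 𝓘(ℝ, E) 𝓘(ℝ, E) (extChartAt 𝓘(ℝ, E) x) x
          (VectorField.mlieBracket 𝓘(ℝ, E) X Y x)) := by
    have he : f =ᶠ[𝓝 x] (f ∘ (extChartAt 𝓘(ℝ, E) x).symm) ∘ extChartAt 𝓘(ℝ, E) x := by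
      filter_upwards [extChartAt_source_mem_nhds (I := 𝓘(ℝ, E)) x] with y hy
      simp only [Function.comp_apply]
      rw [(extChartAt 𝓘(ℝ, E) x).left_inv hy]
    rw [dirDeriv_congr he, ← mfderiv_eq_fderiv]
    exact mfderiv_comp_apply x
      ((contDiffAt_comp_chart hf).differentiableAt (by simp)).mdifferentiableAt
      (mdifferentiableAt_extChartAt (mem_chart_source E x)) _
  -- The bracket on the manifold is the pullback of the bracket in the chart, and the derivative of
  -- the chart undoes this pullback.
  rw [hb, ← VectorField.mlieBracketWithin_univ, VectorField.mlieBracketWithin_apply]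
  refine congrArg (fderiv ℝ (f ∘ (extChartAt 𝓘(ℝ, E) x).symm) (extChartAt 𝓘(ℝ, E) x x))
    (((isInvertible_mfderiv_extChartAt
      (mem_extChartAt_source (I := 𝓘(ℝ, E)) x)).self_apply_inverse _).trans ?_)
  have hr : (extChartAt 𝓘(ℝ, E) x).symm ⁻¹' Set.univ ∩ Set.range 𝓘(ℝ, E) = Set.univ := by simp
  rw [hr]
  exact congrFun (VectorField.lieBracketWithin_univ (𝕜 := ℝ) (V := chartField x X)
    (W := chartField x Y)) _

end Chart

end Functions

end

noncomputable section

open Filter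
open scoped Topology

/-! ### Smooth sections of the bundle `H`. -/

section Sections

variable {E S Hm : Type*} [NormedAddCommGroup E] [NormedSpace ℂ E]
  [TopologicalSpace S] [ChartedSpace E S]
  [NormedAddCommGroup Hm] [NormedSpace ℂ Hm]
  {H : S → Type*} [∀ x, AddCommGroup (H x)] [∀ x, Module ℂ (H x)]
  [TopologicalSpace (TotalSpace Hm H)] [∀ x, TopologicalSpace (H x)] [FiberBundle Hm H]
  {x : S} {a b : ∀ y, H y} {f : S → ℂ}

theorem SmoothNear.eventually (ha : SmoothNear E Hm x a) :
    ∀ᶠ y in 𝓝 x, SmoothNear E Hm y a :=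
  eventually_eventually_nhds.2 ha

theorem SmoothNear.congr (ha : SmoothNear E Hm x a) (h : ∀ᶠ y in 𝓝 x, a y = b y) :
    SmoothNear E Hm x b := by
  filter_upwards [ha, eventually_eventually_nhds.2 h] with y hy hy'
  refine hy.congr_of_eventuallyEq ?_
  filter_upwards [hy'] with z hz
  rw [hz]

theorem SmoothNear.fun_smul [VectorBundle ℂ Hm H] (hf : SmoothFunNear E x f)
    (ha : SmoothNear E Hm x a) :
    SmoothNear E Hm x fun y => f y • a y := by
  filter_upwards [hf, ha] with y hfy hy
  rw [contMDiffAt_section] at hy ⊢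
  have h2 : ContMDiffAt 𝓘(ℝ, E) 𝓘(ℝ, Hm) ∞
      (fun z => f z • (trivializationAt Hm H y ⟨z, a z⟩).2) y :=
    (contDiff_smul (𝕜 := ℝ) (𝕜' := ℂ) (F := Hm)).contDiffAt.comp_contMDiffAt
      (hfy.prodMk_space hy)
  refine h2.congr_of_eventuallyEq ?_
  filter_upwards [(trivializationAt Hm H y).open_baseSet.mem_nhds
    (mem_baseSet_trivializationAt Hm H y)] with z hz
  exact ((trivializationAt Hm H y).linear ℂ hz).map_smul (f z) (a z)

variable [VectorBundle ℝ Hm H]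

theorem SmoothNear.zero : SmoothNear E Hm x fun y => (0 : H y) :=
  Eventually.of_forall fun y => Bundle.contMDiff_zeroSection ℝ H y

theorem SmoothNear.sum {ι : Type*} (t : Finset ι) {a : ι → ∀ y, H y}
    (ha : ∀ i ∈ t, SmoothNear E Hm x (a i)) : SmoothNear E Hm x fun y => ∑ i ∈ t, a i y := by
  classical
  induction t using Finset.induction_on with
  | empty => simpa using SmoothNear.zero
  | insert i t hi ih =>
    simp only [Finset.sum_insert hi]
    exact (ha i (by simp)).add (ih fun j hj => ha j (by simp [hj]))

end Sections

/-! ### Dual frames of `F` and `F̄` in one Hodge structure. -/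

namespace PolarizedHodgeStructure

variable {H : Type*} [AddCommGroup H] [Module ℂ H] (P : PolarizedHodgeStructure H)

theorem conj_prFbar_conj (u : H) : P.conj (P.prFbar (P.conj u)) = P.prF u := by
  have h1 : P.conj u = P.conj (P.prF u) + P.conj (P.prFbar u) := by
    rw [← map_add, prF_add_prFbar]
  have h2 : P.prFbar (P.conj (P.prF u)) = ⟨P.conj (P.prF u), P.conj_mem_Fbar (P.prF u).2⟩ :=
    P.prFbar_coe ⟨_, P.conj_mem_Fbar (P.prF u).2⟩
  have h3 : P.prFbar (P.conj (P.prFbar u)) = 0 := P.prFbar_coe_F ⟨_, P.conj_mem_F (P.prFbar u).2⟩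
  rw [h1, map_add, h2, h3, add_zero, P.conj_conj]

/-- The Gram matrix of a basis of `F` is invertible. -/
theorem gram_det_ne_zero {n : ℕ} {e : Fin n → P.F} (he : LinearIndependent ℂ e) :
    (Matrix.of fun k i => P.form (P.conj (e k)) (e i)).det ≠ 0 := by
  intro h
  obtain ⟨c, hc, hc'⟩ := Matrix.exists_mulVec_eq_zero_iff.2 h
  -- A kernel vector of the Gram matrix yields `u` in `F` with `(ū, u) = 0`, and positivity of the
  -- polarization forces `u = 0`.
  set u : P.F := ∑ i, c i • e i
  have h1 : ∀ k, P.form (P.conj (e k)) u = 0 := by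
    intro k
    have := congrFun hc' k
    simp only [Matrix.mulVec, dotProduct, Matrix.of_apply, Pi.zero_apply] at this
    rw [← this]
    simp [u, mul_comm]
  have h2 : P.form (P.conj u) u = 0 := by
    have : P.conj u = ∑ i, starRingEnd ℂ (c i) • P.conj (e i) := by simp [u]
    rw [this]
    simp [h1]
  have hu : u = 0 := by
    by_contra hne
    have := P.pos u u.2 (by simpa using hne)
    rw [P.form_swap, h2] at this
    simp at this
  exact hc (funext fun i => Fintype.linearIndependent_iff.1 he c hu i)

/-- Families `e` in `F` and `f` in `F̄` that are bases dual to each other with respect to the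
symplectic form. -/
structure IsDualFrame {n : ℕ} (e : Fin n → P.F) (f : Fin n → P.Fbar) : Prop where
  form_eq : ∀ i j, P.form (f i) (e j) = if i = j then 1 else 0
  sum_F : ∀ u : P.F, ∑ i, P.form (f i) u • e i = u
  sum_Fbar : ∀ u : P.Fbar, ∑ i, P.form u (e i) • f i = u

/-- The inverse Gram matrix turns the conjugate frame into the dual one. The explicit formula
matters, as it shows smooth dependence on the point. That the dual family spans `F̄` follows by
pairing with arbitrary `w`, of which only the component in `F` counts. -/
theorem isDualFrame_gram {n : ℕ} {e : Fin n → P.F} (he : LinearIndependent ℂ e)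
    (hs : Submodule.span ℂ (Set.range e) = ⊤) :
    P.IsDualFrame e fun i => ∑ k,
      (Matrix.of fun k i => P.form (P.conj (e k)) (e i))⁻¹ i k • P.conjF (e k) := by
  set G := Matrix.of fun k i => P.form (P.conj (e k)) (e i)
  set f : Fin n → P.Fbar := fun i => ∑ k, G⁻¹ i k • P.conjF (e k)
  have h1 : ∀ i j, P.form (f i) (e j) = if i = j then 1 else 0 := by
    intro i j
    have := congrFun (congrFun (G.nonsing_inv_mul (IsUnit.mk0 _ (P.gram_det_ne_zero he))) i) j
    rw [Matrix.one_apply, Matrix.mul_apply] at this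
    rw [← this]
    simp [f, G, conjF]
  have h2 : ∀ u : P.F, ∑ i, P.form (f i) u • e i = u := by
    intro u
    have hu : u ∈ Submodule.span ℂ (Set.range e) := by rw [hs]; trivial
    obtain ⟨c, rfl⟩ := (Submodule.mem_span_range_iff_exists_fun ℂ).1 hu
    simp [h1]
  refine ⟨h1, h2, fun u => sub_eq_zero.1 (Subtype.ext (P.form_nondeg.1 _ fun w => ?_))⟩
  rw [← P.prF_add_prFbar w, map_add, P.isotropic_Fbar _ (Subtype.mem _) _ (Subtype.mem _),
    add_zero, ← h2 (P.prF w)]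
  simp [h1]

namespace IsDualFrame

variable {P} {n : ℕ} {e : Fin n → P.F} {f : Fin n → P.Fbar}

theorem prF_eq (h : P.IsDualFrame e f) (u : H) : P.prF u = ∑ i, P.form (f i) u • e i := by
  rw [← h.sum_F (P.prF u)]
  simp only [form_prF_right]

theorem prFbar_eq (h : P.IsDualFrame e f) (u : H) :
    P.prFbar u = ∑ i, P.form u (e i) • f i := by
  rw [← h.sum_Fbar (P.prFbar u)]
  simp only [form_prFbar_left]

/-- The frame `e` as a basis. -/
def basis (h : P.IsDualFrame e f) : Module.Basis (Fin n) ℂ P.F :=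
  Module.Basis.mk (v := e)
    (by
      refine Fintype.linearIndependent_iff.2 fun c hc i => ?_
      have := congrArg (fun u : P.F => P.form (f i) u) hc
      simpa [h.form_eq] using this)
    fun u _ => by
      rw [← h.sum_F u]
      exact Submodule.sum_mem _ fun i _ => Submodule.smul_mem _ _ (Submodule.subset_span ⟨i, rfl⟩)

theorem basis_apply (h : P.IsDualFrame e f) (i : Fin n) : h.basis i = e i := by
  simp [basis]

theorem basis_repr (h : P.IsDualFrame e f) (u : P.F) (i : Fin n) :
    h.basis.repr u i = P.form (f i) u := by
  conv_rhs => rw [← h.basis.sum_repr u]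
  simp [basis_apply, h.form_eq]

theorem trace_eq (h : P.IsDualFrame e f) (T : P.F →ₗ[ℂ] P.F) :
    LinearMap.trace ℂ P.F T = ∑ i, P.form (f i) (T (e i)) := by
  rw [LinearMap.trace_eq_matrix_trace ℂ h.basis, Matrix.trace]
  simp [LinearMap.toMatrix_apply, basis_repr, basis_apply]

theorem finrank_eq (h : P.IsDualFrame e f) : Module.finrank ℂ P.F = n := by
  rw [Module.finrank_eq_card_basis h.basis, Fintype.card_fin]

end IsDualFrame

end PolarizedHodgeStructure

/-! ### Smooth dual frames, smoothness of the projections, and symmetry of the second fundamental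
form. -/

namespace PolarizedVHS

variable {E S Hm : Type*} [NormedAddCommGroup E] [NormedSpace ℂ E]
  [TopologicalSpace S] [ChartedSpace E S]
  [NormedAddCommGroup Hm] [NormedSpace ℂ Hm]
  {H : S → Type*} [∀ x, AddCommGroup (H x)] [∀ x, Module ℂ (H x)]
  [TopologicalSpace (TotalSpace Hm H)] [∀ x, TopologicalSpace (H x)]
  [IsManifold 𝓘(ℂ, E) ω S]
  [∀ x, IsTopologicalAddGroup (H x)] [∀ x, ContinuousSMul ℝ (H x)] [FiberBundle Hm H]
  (V : PolarizedVHS E Hm H) {x : S}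

/-- The derivative of the pairing of `F̄` and `F`. -/
theorem dirDeriv_form_Fbar_F {z : ∀ y, V.Fbar y} {a : ∀ y, V.F y}
    (hz : SmoothNear E Hm x fun y => (z y : H y)) (ha : SmoothNear E Hm x fun y => (a y : H y))
    (X : TangentSpace 𝓘(ℝ, E) x) :
    dirDeriv (fun y => (V.fiber y).form (z y : H y) (a y : H y)) x X =
      (V.fiber x).form (V.connFbar z x X) (a x) + (V.fiber x).form (z x) (V.connF a x X) := by
  rw [V.form_flat x _ _ X hz ha, connFbar, connF, PolarizedHodgeStructure.form_prFbar_left,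
    PolarizedHodgeStructure.form_prF_right]

theorem dirDeriv_form_F_Fbar {a : ∀ y, V.F y} {z : ∀ y, V.Fbar y}
    (ha : SmoothNear E Hm x fun y => (a y : H y)) (hz : SmoothNear E Hm x fun y => (z y : H y))
    (X : TangentSpace 𝓘(ℝ, E) x) :
    dirDeriv (fun y => (V.fiber y).form (a y : H y) (z y : H y)) x X =
      (V.fiber x).form (V.connF a x X) (z x) + (V.fiber x).form (a x) (V.connFbar z x X) := by
  rw [V.form_flat x _ _ X ha hz, connFbar, connF, PolarizedHodgeStructure.form_prFbar_right,
    PolarizedHodgeStructure.form_prF_left]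

variable [VectorBundle ℂ Hm H] [VectorBundle ℝ Hm H] [ContMDiffVectorBundle ∞ Hm H 𝓘(ℝ, E)]

/-- Dual smooth frames of `F` and `F̄` near `x`. -/
structure DualFrame (x : S) where
  /-- The rank of `F`. -/
  n : ℕ
  /-- The frame of `F`. -/
  e : Fin n → ∀ y, V.F y
  /-- The frame of `F̄`. -/
  f : Fin n → ∀ y, V.Fbar y
  smooth_e : ∀ i, SmoothNear E Hm x fun y => (e i y : H y)
  smooth_f : ∀ i, SmoothNear E Hm x fun y => (f i y : H y)
  dual : ∀ᶠ y in 𝓝 x, (V.fiber y).IsDualFrame (fun i => e i y) (fun i => f i y)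

-- The holomorphic frame of `F` together with its conjugate, corrected by the inverse Gram matrix.
-- The latter is smooth by Cramer's rule, and the conjugation is smooth by assumption.
omit [ContMDiffVectorBundle ∞ Hm H 𝓘(ℝ, E)] in
theorem nonempty_dualFrame (x : S) : Nonempty (V.DualFrame x) := by
  obtain ⟨n, e, he, hfr⟩ := V.holomorphic x
  have hconj : ∀ i, SmoothNear E Hm x fun y => (V.fiber y).conj (e i y : H y) :=
    fun i => V.conj_smooth x _ (he i).1
  refine ⟨⟨n, e, fun i y => ∑ k, (Matrix.of fun k i =>
    (V.fiber y).form ((V.fiber y).conj (e k y)) (e i y))⁻¹ i k • (V.fiber y).conjF (e k y),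
    fun i => (he i).1, fun i => ?_, ?_⟩⟩
  · simp only [AddSubmonoidClass.coe_finsetSum, Submodule.coe_smul]
    refine SmoothNear.sum _ fun k _ => SmoothNear.fun_smul (SmoothFunNear.matrix_inv
      (fun k i => V.form_smooth x _ _ (hconj k) (he i).1)
      ((V.fiber x).gram_det_ne_zero hfr.self_of_nhds.1) i k) (hconj k)
  · filter_upwards [hfr] with y hy
    exact (V.fiber y).isDualFrame_gram hy.1 hy.2

omit [ContMDiffVectorBundle ∞ Hm H 𝓘(ℝ, E)] in
theorem prF_smooth {a : ∀ y, H y} (ha : SmoothNear E Hm x a) :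
    SmoothNear E Hm x fun y => ((V.fiber y).prF (a y) : H y) := by
  obtain ⟨B⟩ := V.nonempty_dualFrame x
  refine (SmoothNear.sum Finset.univ fun i _ => SmoothNear.fun_smul
    (V.form_smooth x _ _ (B.smooth_f i) ha) (B.smooth_e i)).congr ?_
  filter_upwards [B.dual] with y hy
  rw [hy.prF_eq]
  simp

omit [ContMDiffVectorBundle ∞ Hm H 𝓘(ℝ, E)] in
theorem prFbar_smooth {a : ∀ y, H y} (ha : SmoothNear E Hm x a) :
    SmoothNear E Hm x fun y => ((V.fiber y).prFbar (a y) : H y) := by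
  obtain ⟨B⟩ := V.nonempty_dualFrame x
  refine (SmoothNear.sum Finset.univ fun i _ => SmoothNear.fun_smul
    (V.form_smooth x _ _ ha (B.smooth_e i)) (B.smooth_f i)).congr ?_
  filter_upwards [B.dual] with y hy
  rw [hy.prFbar_eq]
  simp

/-- Take constant coefficients in a frame. Identities for `σ` on vectors can then be proved on
sections. -/
theorem exists_section_F (u : V.F x) :
    ∃ a : ∀ y, V.F y, SmoothNear E Hm x (fun y => (a y : H y)) ∧ a x = u := by
  obtain ⟨B⟩ := V.nonempty_dualFrame x
  refine ⟨fun y => ∑ i, (V.fiber x).form (B.f i x) u • B.e i y, ?_, B.dual.self_of_nhds.sum_F u⟩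
  simp only [AddSubmonoidClass.coe_finsetSum, Submodule.coe_smul]
  exact SmoothNear.sum _ fun i _ => (B.smooth_e i).smul _

/-- Conjugation is flat and exchanges the two projections, so conjugating the formula for `σ` on the
section `z̄` gives this one. -/
theorem sigmaBar_apply (X : TangentSpace 𝓘(ℝ, E) x) (z : ∀ y, V.Fbar y)
    (hz : SmoothNear E Hm x fun y => (z y : H y)) :
    V.sigmaBar x X (z x) = (V.fiber x).prF (V.conn (fun y => (z y : H y)) x X) := by
  have h := V.sigma_apply x X (fun y => (V.fiber y).conjFbar (z y)) (V.conj_smooth x _ hz)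
  apply Subtype.ext
  rw [← PolarizedHodgeStructure.conj_prFbar_conj, ← V.conj_flat x _ X hz]
  exact congrArg (fun u : V.Fbar x => (V.fiber x).conj u) h

/-- The second fundamental form is symmetric. -/
theorem form_sigma (X : TangentSpace 𝓘(ℝ, E) x) (u w : V.F x) :
    (V.fiber x).form (V.sigma x X u) w = (V.fiber x).form (V.sigma x X w) u := by
  obtain ⟨a, ha, rfl⟩ := V.exists_section_F u
  obtain ⟨b, hb, rfl⟩ := V.exists_section_F w
  have h := V.form_flat x _ _ X ha hb
  -- Symmetry comes from differentiating the constant function `(a, b) = 0`, which expresses that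
  -- `F` is isotropic.
  have h0 : (fun y => (V.fiber y).form (a y : H y) (b y : H y)) = fun _ => 0 :=
    funext fun y => (V.fiber y).isotropic _ (Subtype.mem _) _ (Subtype.mem _)
  rw [h0, dirDeriv_const] at h
  rw [V.sigma_apply x X a ha, V.sigma_apply x X b hb, PolarizedHodgeStructure.form_prFbar_left,
    PolarizedHodgeStructure.form_prFbar_left, (V.fiber x).form_swap _ (a x : H x)]
  exact eq_neg_of_add_eq_zero_left h.symm

theorem form_sigmaBar (X : TangentSpace 𝓘(ℝ, E) x) (u w : V.Fbar x) :
    (V.fiber x).form (V.sigmaBar x X u) w = (V.fiber x).form (V.sigmaBar x X w) u := by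
  have h := congrArg (starRingEnd ℂ)
    (V.form_sigma X ((V.fiber x).conjFbar u) ((V.fiber x).conjFbar w))
  rw [← PolarizedHodgeStructure.form_conj, ← PolarizedHodgeStructure.form_conj] at h
  have hu : (V.fiber x).conj ((V.fiber x).conjFbar u : H x) = u := (V.fiber x).conj_conj u
  have hw : (V.fiber x).conj ((V.fiber x).conjFbar w : H x) = w := (V.fiber x).conj_conj w
  rw [hu, hw] at h
  exact h

theorem sigma_add_tangent (X Y : TangentSpace 𝓘(ℝ, E) x) :
    V.sigma x (X + Y) = V.sigma x X + V.sigma x Y := by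
  ext1 u
  obtain ⟨a, ha, rfl⟩ := V.exists_section_F u
  rw [LinearMap.add_apply, V.sigma_apply x _ a ha, V.sigma_apply x _ a ha, V.sigma_apply x _ a ha,
    map_add, map_add]

theorem sigma_smul_tangent (r : ℝ) (X : TangentSpace 𝓘(ℝ, E) x) :
    V.sigma x (r • X) = (r : ℂ) • V.sigma x X := by
  ext1 u
  obtain ⟨a, ha, rfl⟩ := V.exists_section_F u
  rw [LinearMap.smul_apply, V.sigma_apply x _ a ha, V.sigma_apply x _ a ha,
    ← map_smul]
  exact congrArg _ (map_smul (V.conn (fun y => (a y : H y)) x) r X)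

theorem sigmaBar_add_tangent (X Y : TangentSpace 𝓘(ℝ, E) x) :
    V.sigmaBar x (X + Y) = V.sigmaBar x X + V.sigmaBar x Y := by
  ext1 u
  simp [sigmaBar, sigma_add_tangent]

theorem sigmaBar_smul_tangent (r : ℝ) (X : TangentSpace 𝓘(ℝ, E) x) :
    V.sigmaBar x (r • X) = (r : ℂ) • V.sigmaBar x X := by
  ext1 u
  have h : V.sigmaBar x (r • X) u =
      (V.fiber x).conjFbar (V.sigma x (r • X) ((V.fiber x).conjFbar u)) := rfl
  rw [h, sigma_smul_tangent, LinearMap.smul_apply, LinearMap.map_smulₛₗ, Complex.conj_ofReal]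
  rfl

omit [ContMDiffVectorBundle ∞ Hm H 𝓘(ℝ, E)] in
theorem connF_smooth {a : ∀ y, V.F y} (ha : SmoothNear E Hm x fun y => (a y : H y))
    {X : ∀ y : S, TangentSpace 𝓘(ℝ, E) y} (hX : SmoothFieldNear x X) :
    SmoothNear E Hm x fun y => (V.connF a y (X y) : H y) :=
  V.prF_smooth (V.conn_smooth x X _ hX ha)

omit [ContMDiffVectorBundle ∞ Hm H 𝓘(ℝ, E)] in
theorem connFbar_smooth {z : ∀ y, V.Fbar y} (hz : SmoothNear E Hm x fun y => (z y : H y))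
    {X : ∀ y : S, TangentSpace 𝓘(ℝ, E) y} (hX : SmoothFieldNear x X) :
    SmoothNear E Hm x fun y => (V.connFbar z y (X y) : H y) :=
  V.prFbar_smooth (V.conn_smooth x X _ hX hz)

end PolarizedVHS

end

noncomputable section

open Filter
open scoped Topology

/-! ### Extension of a connection to a derivation of a bundle of algebras: existence and uniqueness.
-/

section Induced

variable {E S Hm : Type*} [NormedAddCommGroup E] [NormedSpace ℂ E]
  [TopologicalSpace S] [ChartedSpace E S]
  [NormedAddCommGroup Hm] [NormedSpace ℂ Hm]
  {H : S → Type*} [∀ x, AddCommGroup (H x)] [∀ x, Module ℂ (H x)]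
  [TopologicalSpace (TotalSpace Hm H)] [∀ x, TopologicalSpace (H x)] [FiberBundle Hm H]
  {G : ∀ x, Submodule ℂ (H x)}
  {D : (∀ y, G y) → ∀ x : S, TangentSpace 𝓘(ℝ, E) x → G x}
  {A : S → Type*} [∀ x, Ring (A x)] [∀ x, Algebra ℂ (A x)] {gen : ∀ x, G x →ₗ[ℂ] A x}
  {x : S} {v w : ∀ y, A y}

namespace AlgSmoothNear

theorem function {f : S → ℂ} (hf : SmoothFunNear E x f) :
    AlgSmoothNear E Hm G A gen x fun y => algebraMap ℂ (A y) (f y) :=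
  ⟨_, Algebra.subset_adjoin (Or.inl ⟨f, hf, rfl⟩), Eventually.of_forall fun _ => rfl⟩

theorem generator {a : ∀ y, G y} (ha : SmoothNear E Hm x fun y => (a y : H y)) :
    AlgSmoothNear E Hm G A gen x fun y => gen y (a y) :=
  ⟨_, Algebra.subset_adjoin (Or.inr ⟨a, ha, rfl⟩), Eventually.of_forall fun _ => rfl⟩

theorem add (hv : AlgSmoothNear E Hm G A gen x v) (hw : AlgSmoothNear E Hm G A gen x w) :
    AlgSmoothNear E Hm G A gen x fun y => v y + w y := by
  obtain ⟨v', hv', hv⟩ := hv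
  obtain ⟨w', hw', hw⟩ := hw
  refine ⟨v' + w', add_mem hv' hw', ?_⟩
  filter_upwards [hv, hw] with y h1 h2
  rw [h1, h2, Pi.add_apply]

theorem mul (hv : AlgSmoothNear E Hm G A gen x v) (hw : AlgSmoothNear E Hm G A gen x w) :
    AlgSmoothNear E Hm G A gen x fun y => v y * w y := by
  obtain ⟨v', hv', hv⟩ := hv
  obtain ⟨w', hw', hw⟩ := hw
  refine ⟨v' * w', mul_mem hv' hw', ?_⟩
  filter_upwards [hv, hw] with y h1 h2
  rw [h1, h2, Pi.mul_apply]

theorem congr (hv : AlgSmoothNear E Hm G A gen x v) (h : ∀ᶠ y in 𝓝 x, v y = w y) :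
    AlgSmoothNear E Hm G A gen x w := by
  obtain ⟨v', hv', hv⟩ := hv
  refine ⟨v', hv', ?_⟩
  filter_upwards [hv, h] with y h1 h2
  rw [← h2, h1]

theorem const (c : ℂ) : AlgSmoothNear E Hm G A gen x fun y => algebraMap ℂ (A y) c :=
  function (.const c)

theorem fun_smul {f : S → ℂ} (hf : SmoothFunNear E x f) (hv : AlgSmoothNear E Hm G A gen x v) :
    AlgSmoothNear E Hm G A gen x fun y => f y • v y := by
  simp only [Algebra.smul_def]
  exact (function hf).mul hv

theorem sum {ι : Type*} (t : Finset ι) {v : ι → ∀ y, A y}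
    (hv : ∀ i ∈ t, AlgSmoothNear E Hm G A gen x (v i)) :
    AlgSmoothNear E Hm G A gen x fun y => ∑ i ∈ t, v i y := by
  classical
  induction t using Finset.induction_on with
  | empty =>
    have h := const (gen := gen) (E := E) (Hm := Hm) (x := x) 0
    simpa using h
  | insert i t hi ih =>
    simp only [Finset.sum_insert hi]
    exact (hv i (by simp)).add (ih fun j hj => hv j (by simp [hj]))

@[elab_as_elim]
theorem induction {motive : ∀ v : ∀ y, A y, AlgSmoothNear E Hm G A gen x v → Prop}
    (function : ∀ (f : S → ℂ) (hf : SmoothFunNear E x f), motive _ (.function hf))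
    (generator : ∀ (a : ∀ y, G y) (ha : SmoothNear E Hm x fun y => (a y : H y)),
      motive _ (.generator ha))
    (add : ∀ v w hv hw, motive v hv → motive w hw → motive _ (hv.add hw))
    (mul : ∀ v w hv hw, motive v hv → motive w hw → motive _ (hv.mul hw))
    (congr : ∀ v w hv (h : ∀ᶠ y in 𝓝 x, v y = w y), motive v hv → motive w (hv.congr h))
    (hv : AlgSmoothNear E Hm G A gen x v) : motive v hv := by
  obtain ⟨v', hv', hv⟩ := hv
  have hs : ∀ v', v' ∈ Algebra.adjoin ℂ
      ({w : ∀ y, A y | ∃ f : S → ℂ, SmoothFunNear E x f ∧ w = fun y => algebraMap ℂ (A y) (f y)} ∪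
        {w : ∀ y, A y | ∃ a : ∀ y, G y, SmoothNear E Hm x (fun y => (a y : H y)) ∧
          w = fun y => gen y (a y)}) → AlgSmoothNear E Hm G A gen x v' :=
    fun v' h => ⟨v', h, Eventually.of_forall fun _ => rfl⟩
  refine congr v' v (hs v' hv') (hv.mono fun _ h => h.symm) ?_
  clear hv
  induction hv' using Algebra.adjoin_induction with
  | mem y hy =>
    rcases hy with ⟨f, hf, rfl⟩ | ⟨a, ha, rfl⟩
    · exact function f hf
    · exact generator a ha
  | algebraMap r => exact function (fun _ => r) (.const r)
  | add p q hp hq ihp ihq => exact add p q (hs p hp) (hs q hq) ihp ihq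
  | mul p q hp hq ihp ihq => exact mul p q (hs p hp) (hs q hq) ihp ihq

theorem eventually (hv : AlgSmoothNear E Hm G A gen x v) :
    ∀ᶠ y in 𝓝 x, AlgSmoothNear E Hm G A gen y v := by
  induction hv using AlgSmoothNear.induction with
  | function f hf => exact hf.eventually.mono fun y h => function h
  | generator a ha => exact ha.eventually.mono fun y h => generator h
  | add v w _ _ hv hw => filter_upwards [hv, hw] with y h1 h2 using h1.add h2
  | mul v w _ _ hv hw => filter_upwards [hv, hw] with y h1 h2 using h1.mul h2
  | congr v w _ h hv =>
    filter_upwards [hv, eventually_eventually_nhds.2 h] with y h1 h2 using h1.congr h2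

theorem exists_inducedDeriv (D : (∀ y, G y) → ∀ x : S, TangentSpace 𝓘(ℝ, E) x → G x)
    (hv : AlgSmoothNear E Hm G A gen x v) : ∃ L, InducedDeriv (Hm := Hm) G D A gen x v L := by
  induction hv using AlgSmoothNear.induction with
  | function f hf => exact ⟨_, .function f hf⟩
  | generator a ha => exact ⟨_, .generator a ha⟩
  | add v w _ _ hv hw => exact ⟨_, hv.choose_spec.add hw.choose_spec⟩
  | mul v w _ _ hv hw => exact ⟨_, hv.choose_spec.mul hw.choose_spec⟩
  | congr v w _ h hv => exact ⟨_, hv.choose_spec.congr h⟩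

end AlgSmoothNear

namespace InducedDeriv

variable {L M : TangentSpace 𝓘(ℝ, E) x → A x}

theorem of_eq {L M : TangentSpace 𝓘(ℝ, E) x → A x} (hv : InducedDeriv (Hm := Hm) G D A gen x v L)
    (h : ∀ y, v y = w y) (hL : ∀ X, L X = M X) : InducedDeriv (Hm := Hm) G D A gen x w M := by
  obtain rfl : v = w := funext h
  obtain rfl : L = M := funext hL
  exact hv

theorem algSmoothNear (hv : InducedDeriv (Hm := Hm) G D A gen x v L) :
    AlgSmoothNear E Hm G A gen x v := by
  induction hv with
  | function f hf => exact .function hf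
  | generator a ha => exact .generator ha
  | add _ _ hv hw => exact hv.add hw
  | mul _ _ hv hw => exact hv.mul hw
  | congr _ h hv => exact hv.congr h

/-- The augmentation is an algebra map that kills the generators, so it intertwines any induced
derivation with `d`. Thus the constant term of the derivative does not depend on the presentation.
-/
theorem aug (C : ∀ y, Contraction (gen y)) (hv : InducedDeriv (Hm := Hm) G D A gen x v L) :
    SmoothFunNear E x (fun y => (C y).aug (v y)) ∧
      ∀ X, (C x).aug (L X) = dirDeriv (fun y => (C y).aug (v y)) x X := by
  induction hv with
  | function f hf => simpa using hf
  | generator a ha => simpa [(C _).aug_gen, dirDeriv_const] using SmoothFunNear.const 0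
  | add _ _ hv hw =>
    simp only [map_add]
    refine ⟨hv.1.add hw.1, fun X => ?_⟩
    rw [hv.2, hw.2, dirDeriv_add hv.1 hw.1]
  | mul _ _ hv hw =>
    simp only [map_mul, map_add]
    refine ⟨hv.1.mul hw.1, fun X => ?_⟩
    rw [hv.2, hw.2, dirDeriv_mul hv.1 hw.1]
  | congr _ h hv =>
    have h' : (fun y => (C y).aug (_ : A y)) =ᶠ[𝓝 x] fun y => (C y).aug (_ : A y) :=
      h.mono fun y hy => congrArg (C y).aug hy
    refine ⟨hv.1.congr h', fun X => ?_⟩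
    rw [hv.2, dirDeriv_congr h']

/-- With a locally constant sign, the parity automorphism is parallel. This is needed for products
in `contr`. -/
theorem parity {C : ∀ y, Contraction (gen y)} (hs : ∀ y, (C y).sign = (C x).sign)
    (hv : InducedDeriv (Hm := Hm) G D A gen x v L) :
    InducedDeriv (Hm := Hm) G D A gen x (fun y => (C y).parity (v y))
      (fun X => (C x).parity (L X)) := by
  induction hv with
  | function f hf => exact (InducedDeriv.function f hf).of_eq (by simp) (by simp)
  | generator a ha =>
    refine ((InducedDeriv.function (fun _ => (C x).sign) (.const _)).mul (.generator a ha)).of_eq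
      (fun y => ?_) fun X => ?_
    · rw [(C y).parity_gen, hs y, Algebra.smul_def]
    · rw [(C x).parity_gen, dirDeriv_const, map_zero, zero_mul, zero_add, Algebra.smul_def]
  | add _ _ hv hw => exact (hv.add hw).of_eq (by simp) (by simp)
  | mul _ _ hv hw => exact (hv.mul hw).of_eq (by simp) (by simp)
  | congr _ h hv => exact hv.congr (h.mono fun y hy => congrArg (C y).parity hy)

/-- Here `d'` plays the role of the covariant derivative of the linear form `d`. Both contraction
and derivative obey a product rule, so it is enough that the formula holds on functions and
generators. -/
theorem contr {C : ∀ y, Contraction (gen y)} (hs : ∀ y, (C y).sign = (C x).sign)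
    {d : ∀ y, Module.Dual ℂ (G y)} {d' : TangentSpace 𝓘(ℝ, E) x → Module.Dual ℂ (G x)}
    (hd : ∀ a : ∀ y, G y, SmoothNear E Hm x (fun y => (a y : H y)) →
      SmoothFunNear E x (fun y => d y (a y)) ∧
        ∀ X, dirDeriv (fun y => d y (a y)) x X = d' X (a x) + d x (D a x X))
    (hv : InducedDeriv (Hm := Hm) G D A gen x v L) :
    InducedDeriv (Hm := Hm) G D A gen x (fun y => (C y).contr (d y) (v y))
      (fun X => (C x).contr (d' X) (v x) + (C x).contr (d x) (L X)) := by
  induction hv with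
  | function f hf =>
    refine (InducedDeriv.function (fun _ => 0) (.const 0)).of_eq ?_ ?_ <;>
    simp [Contraction.contr_algebraMap, dirDeriv_const]
  | generator a ha =>
    refine (InducedDeriv.function _ (hd a ha).1).of_eq (fun y => ?_) fun X => ?_
    · rw [(C y).contr_gen]
    · rw [(C x).contr_gen, (C x).contr_gen, (hd a ha).2, map_add]
  | add _ _ hv hw =>
    refine (hv.add hw).of_eq (by simp) fun X => ?_
    simp only [map_add]
    abel
  | mul hv' hw' hv hw =>
    refine ((hv.mul hw').add ((hv'.parity hs).mul hw)).of_eq (fun y => ?_) fun X => ?_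
    · rw [(C y).contr_mul]
    · simp only [map_add, (C x).contr_mul]
      noncomm_ring
  | congr h' h hv =>
    rw [← h.self_of_nhds]
    exact hv.congr (h.mono fun y hy => congrArg _ hy)

end InducedDeriv

/-- Linear forms `d i` on `G` near `x` with derivatives `d' i` along `D` that are coordinates for a
frame of the fibre at `x`. -/
structure DualSystem (Hm : Type*) {E S : Type*} [NormedAddCommGroup E] [NormedSpace ℂ E]
    [TopologicalSpace S] [ChartedSpace E S] [NormedAddCommGroup Hm] [NormedSpace ℂ Hm]
    {H : S → Type*} [∀ x, AddCommGroup (H x)] [∀ x, Module ℂ (H x)]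
    [TopologicalSpace (TotalSpace Hm H)] [∀ x, TopologicalSpace (H x)] [FiberBundle Hm H]
    (G : ∀ x, Submodule ℂ (H x))
    (D : (∀ y, G y) → ∀ x : S, TangentSpace 𝓘(ℝ, E) x → G x) (x : S) where
  /-- The number of linear forms. -/
  n : ℕ
  /-- The frame of the fibre at `x`. -/
  e : Fin n → G x
  /-- The linear forms. -/
  d : Fin n → ∀ y, Module.Dual ℂ (G y)
  /-- The covariant derivatives of the linear forms. -/
  d' : Fin n → TangentSpace 𝓘(ℝ, E) x → Module.Dual ℂ (G x)
  sum_eq : ∀ u, ∑ i, d i x u • e i = u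
  deriv : ∀ i (a : ∀ y, G y), SmoothNear E Hm x (fun y => (a y : H y)) →
      SmoothFunNear E x (fun y => d i y (a y)) ∧
        ∀ X, dirDeriv (fun y => d i y (a y)) x X = d' i X (a x) + d i x (D a x X)

/-- Consider all differences `L X - M X` of two candidates for the same section, for all sections at
once. Contracting such a difference gives another one, because the term with `d'` depends on the
section alone and cancels. The augmentations agree with one and the same derivative, so
`eq_zero_of_stable` applies. -/
theorem InducedDeriv.unique {C : ∀ y, Contraction (gen y)} (hs : ∀ y, (C y).sign = (C x).sign)
    (B : DualSystem Hm G D x) {L M : TangentSpace 𝓘(ℝ, E) x → A x}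
    (hL : InducedDeriv (Hm := Hm) G D A gen x v L) (hM : InducedDeriv (Hm := Hm) G D A gen x v M) :
    L = M := by
  funext X
  refine sub_eq_zero.1 ((C x).eq_zero_of_stable B.sum_eq (fun r => ∃ v L M,
    InducedDeriv (Hm := Hm) G D A gen x v L ∧ InducedDeriv (Hm := Hm) G D A gen x v M ∧
      r = L X - M X) ?_ ?_ ⟨v, L, M, hL, hM, rfl⟩)
  · rintro _ ⟨v, L, M, hL, hM, rfl⟩ i
    refine ⟨_, _, _, hL.contr hs (B.deriv i), hM.contr hs (B.deriv i), ?_⟩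
    rw [map_sub]
    abel
  · rintro _ ⟨v, L, M, hL, hM, rfl⟩
    rw [map_sub, (hL.aug C).2, (hM.aug C).2, sub_self]

theorem extendsUniquely_of_dualSystem {C : ∀ y, Contraction (gen y)}
    (hs : ∀ x y, (C y).sign = (C x).sign) (B : ∀ x, Nonempty (DualSystem Hm G D x)) :
    ExtendsUniquely (Hm := Hm) G D A gen := fun x v hv => by
  obtain ⟨L, hL⟩ := hv.exists_inducedDeriv D
  exact ⟨L, hL, fun M hM => hM.unique (hs x) (B x).some hL⟩

namespace ExtendsUniquely

variable (hU : ExtendsUniquely (Hm := Hm) G D A gen)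
include hU

theorem inducedConn_eq {L : TangentSpace 𝓘(ℝ, E) x → A x}
    (hv : InducedDeriv (Hm := Hm) G D A gen x v L) :
    inducedConn (Hm := Hm) G D A gen v x = L := by
  have h : ∃ L, InducedDeriv (Hm := Hm) G D A gen x v L := ⟨L, hv⟩
  have h2 := (hU x v hv.algSmoothNear).unique h.choose_spec hv
  funext X
  rw [inducedConn, dif_pos h, h2]

theorem inducedDeriv (hv : AlgSmoothNear E Hm G A gen x v) :
    InducedDeriv (Hm := Hm) G D A gen x v (inducedConn (Hm := Hm) G D A gen v x) := by
  obtain ⟨L, hL⟩ := hv.exists_inducedDeriv D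
  rwa [hU.inducedConn_eq hL]

theorem inducedConn_congr (hv : AlgSmoothNear E Hm G A gen x v) (h : ∀ᶠ y in 𝓝 x, v y = w y) :
    inducedConn (Hm := Hm) G D A gen v x = inducedConn (Hm := Hm) G D A gen w x :=
  (hU.inducedConn_eq ((hU.inducedDeriv hv).congr h)).symm

theorem inducedConn_function {f : S → ℂ} (hf : SmoothFunNear E x f)
    (X : TangentSpace 𝓘(ℝ, E) x) :
    inducedConn (Hm := Hm) G D A gen (fun y => algebraMap ℂ (A y) (f y)) x X =
      algebraMap ℂ (A x) (dirDeriv f x X) :=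
  congrFun (hU.inducedConn_eq (.function f hf)) X

theorem inducedConn_generator {a : ∀ y, G y} (ha : SmoothNear E Hm x fun y => (a y : H y))
    (X : TangentSpace 𝓘(ℝ, E) x) :
    inducedConn (Hm := Hm) G D A gen (fun y => gen y (a y)) x X = gen x (D a x X) :=
  congrFun (hU.inducedConn_eq (.generator a ha)) X

theorem inducedConn_add (hv : AlgSmoothNear E Hm G A gen x v)
    (hw : AlgSmoothNear E Hm G A gen x w) (X : TangentSpace 𝓘(ℝ, E) x) :
    inducedConn (Hm := Hm) G D A gen (fun y => v y + w y) x X =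
      inducedConn (Hm := Hm) G D A gen v x X + inducedConn (Hm := Hm) G D A gen w x X :=
  congrFun (hU.inducedConn_eq ((hU.inducedDeriv hv).add (hU.inducedDeriv hw))) X

theorem inducedConn_mul (hv : AlgSmoothNear E Hm G A gen x v)
    (hw : AlgSmoothNear E Hm G A gen x w) (X : TangentSpace 𝓘(ℝ, E) x) :
    inducedConn (Hm := Hm) G D A gen (fun y => v y * w y) x X =
      inducedConn (Hm := Hm) G D A gen v x X * w x +
        v x * inducedConn (Hm := Hm) G D A gen w x X :=
  congrFun (hU.inducedConn_eq ((hU.inducedDeriv hv).mul (hU.inducedDeriv hw))) X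

theorem inducedConn_fun_smul {f : S → ℂ} (hf : SmoothFunNear E x f)
    (hv : AlgSmoothNear E Hm G A gen x v) (X : TangentSpace 𝓘(ℝ, E) x) :
    inducedConn (Hm := Hm) G D A gen (fun y => f y • v y) x X =
      dirDeriv f x X • v x + f x • inducedConn (Hm := Hm) G D A gen v x X := by
  simp only [Algebra.smul_def]
  rw [hU.inducedConn_mul (.function hf) hv, hU.inducedConn_function hf]

theorem inducedConn_add_tangent (hv : AlgSmoothNear E Hm G A gen x v)
    (hD : ∀ (a : ∀ y, G y) (X Y : TangentSpace 𝓘(ℝ, E) x), D a x (X + Y) = D a x X + D a x Y)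
    (X Y : TangentSpace 𝓘(ℝ, E) x) :
    inducedConn (Hm := Hm) G D A gen v x (X + Y) =
      inducedConn (Hm := Hm) G D A gen v x X + inducedConn (Hm := Hm) G D A gen v x Y := by
  have h := hU.inducedDeriv hv
  clear hv
  generalize inducedConn (Hm := Hm) G D A gen v x = L at h
  induction h with
  | function f hf => simp only [dirDeriv_add_tangent, map_add]
  | generator a ha => simp only [hD, map_add]
  | add hv hw ihv ihw =>
    simp only [ihv, ihw]
    abel
  | mul hv hw ihv ihw =>
    simp only [ihv, ihw]
    noncomm_ring
  | congr hv h ih => exact ih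

theorem inducedConn_smul_tangent (hv : AlgSmoothNear E Hm G A gen x v)
    (hD : ∀ (a : ∀ y, G y) (r : ℝ) (X : TangentSpace 𝓘(ℝ, E) x),
      D a x (r • X) = (r : ℂ) • D a x X) (r : ℝ) (X : TangentSpace 𝓘(ℝ, E) x) :
    inducedConn (Hm := Hm) G D A gen v x (r • X) =
      (r : ℂ) • inducedConn (Hm := Hm) G D A gen v x X := by
  have h := hU.inducedDeriv hv
  clear hv
  generalize inducedConn (Hm := Hm) G D A gen v x = L at h
  induction h with
  | function f hf => simp only [dirDeriv_smul_tangent, map_mul, Algebra.smul_def]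
  | generator a ha => simp only [hD, map_smul]
  | add hv hw ihv ihw => simp only [ihv, ihw, smul_add]
  | mul hv hw ihv ihw => simp only [ihv, ihw, smul_add, smul_mul_assoc, mul_smul_comm]
  | congr hv h ih => exact ih

theorem inducedConn_smooth [IsManifold 𝓘(ℂ, E) ω S] [FiniteDimensional ℂ E]
    (hv : AlgSmoothNear E Hm G A gen x v)
    {X : ∀ y : S, TangentSpace 𝓘(ℝ, E) y} (hX : SmoothFieldNear x X)
    (hD : ∀ a : ∀ y, G y, SmoothNear E Hm x (fun y => (a y : H y)) →
      SmoothNear E Hm x fun y => (D a y (X y) : H y)) :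
    AlgSmoothNear E Hm G A gen x fun y => inducedConn (Hm := Hm) G D A gen v y (X y) := by
  induction hv using AlgSmoothNear.induction with
  | function f hf =>
    exact (AlgSmoothNear.function (hf.dirDeriv hX)).congr
      (hf.eventually.mono fun y hy => (hU.inducedConn_function hy (X y)).symm)
  | generator a ha =>
    exact (AlgSmoothNear.generator (hD a ha)).congr
      (ha.eventually.mono fun y hy => (hU.inducedConn_generator hy (X y)).symm)
  | add v w hv hw ihv ihw =>
    refine (ihv.add ihw).congr ?_
    filter_upwards [hv.eventually, hw.eventually] with y hvy hwy
    exact (hU.inducedConn_add hvy hwy (X y)).symm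
  | mul v w hv hw ihv ihw =>
    refine ((ihv.mul hw).add (hv.mul ihw)).congr ?_
    filter_upwards [hv.eventually, hw.eventually] with y hvy hwy
    exact (hU.inducedConn_mul hvy hwy (X y)).symm
  | congr v w hv h ih =>
    refine ih.congr ?_
    filter_upwards [hv.eventually, eventually_eventually_nhds.2 h] with y hvy hy
    exact congrFun (hU.inducedConn_congr hvy hy) (X y)

/-- The derivative of a contraction. -/
theorem inducedConn_contr {C : ∀ y, Contraction (gen y)} (hs : ∀ y, (C y).sign = (C x).sign)
    {d : ∀ y, Module.Dual ℂ (G y)} {d' : TangentSpace 𝓘(ℝ, E) x → Module.Dual ℂ (G x)}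
    (hd : ∀ a : ∀ y, G y, SmoothNear E Hm x (fun y => (a y : H y)) →
      SmoothFunNear E x (fun y => d y (a y)) ∧
        ∀ X, dirDeriv (fun y => d y (a y)) x X = d' X (a x) + d x (D a x X))
    (hv : AlgSmoothNear E Hm G A gen x v) :
    AlgSmoothNear E Hm G A gen x (fun y => (C y).contr (d y) (v y)) ∧
      ∀ X, inducedConn (Hm := Hm) G D A gen (fun y => (C y).contr (d y) (v y)) x X =
        (C x).contr (d' X) (v x) + (C x).contr (d x) (inducedConn (Hm := Hm) G D A gen v x X) := by
  have h := (hU.inducedDeriv hv).contr hs hd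
  exact ⟨h.algSmoothNear, fun X => congrFun (hU.inducedConn_eq h) X⟩

theorem aug_inducedConn (C : ∀ y, Contraction (gen y)) (hv : AlgSmoothNear E Hm G A gen x v) :
    SmoothFunNear E x (fun y => (C y).aug (v y)) ∧
      ∀ X, (C x).aug (inducedConn (Hm := Hm) G D A gen v x X) =
        dirDeriv (fun y => (C y).aug (v y)) x X :=
  (hU.inducedDeriv hv).aug C

end ExtendsUniquely

end Induced

/-! ### The extensions of `∇^F̄` to `Sym F̄` and of `∇^F` to the exterior algebra. -/

namespace PolarizedVHS

variable {E S Hm : Type*} [NormedAddCommGroup E] [NormedSpace ℂ E]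
  [TopologicalSpace S] [ChartedSpace E S]
  [NormedAddCommGroup Hm] [NormedSpace ℂ Hm]
  {H : S → Type*} [∀ x, AddCommGroup (H x)] [∀ x, Module ℂ (H x)]
  [TopologicalSpace (TotalSpace Hm H)] [∀ x, TopologicalSpace (H x)]
  [IsManifold 𝓘(ℂ, E) ω S]
  [∀ x, IsTopologicalAddGroup (H x)] [∀ x, ContinuousSMul ℝ (H x)] [FiberBundle Hm H]
  (V : PolarizedVHS E Hm H) {x : S}

theorem deriv_formFbar {a : ∀ y, V.F y} (ha : SmoothNear E Hm x fun y => (a y : H y))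
    (z : ∀ y, V.Fbar y) (hz : SmoothNear E Hm x fun y => (z y : H y)) :
    SmoothFunNear E x (fun y => (V.fiber y).formFbar (a y) (z y)) ∧
      ∀ X, dirDeriv (fun y => (V.fiber y).formFbar (a y) (z y)) x X =
        (V.fiber x).formFbar (V.connF a x X) (z x) +
          (V.fiber x).formFbar (a x) (V.connFbar z x X) :=
  ⟨V.form_smooth x _ _ ha hz, V.dirDeriv_form_F_Fbar ha hz⟩

theorem deriv_formF {z : ∀ y, V.Fbar y} (hz : SmoothNear E Hm x fun y => (z y : H y))
    (a : ∀ y, V.F y) (ha : SmoothNear E Hm x fun y => (a y : H y)) :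
    SmoothFunNear E x (fun y => (V.fiber y).formF (z y) (a y)) ∧
      ∀ X, dirDeriv (fun y => (V.fiber y).formF (z y) (a y)) x X =
        (V.fiber x).formF (V.connFbar z x X) (a x) +
          (V.fiber x).formF (z x) (V.connF a x X) :=
  ⟨V.form_smooth x _ _ hz ha, V.dirDeriv_form_Fbar_F hz ha⟩

variable [VectorBundle ℂ Hm H] [VectorBundle ℝ Hm H]

/-- `∇^F̄` extends uniquely to `Sym F̄`. -/
theorem extendsUniquely_sym :
    ExtendsUniquely (Hm := Hm) V.Fbar V.connFbar (fun y => SymmetricAlgebra ℂ (V.Fbar y))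
      (fun y => SymmetricAlgebra.ι ℂ (V.Fbar y)) := by
  refine extendsUniquely_of_dualSystem (C := fun y => symContraction (V.Fbar y))
    (fun _ _ => rfl) fun x => ?_
  obtain ⟨B⟩ := V.nonempty_dualFrame x
  exact ⟨{
    n := B.n
    -- The frames are normalised by `(f_i, e_j) = δ_ij`, whereas the linear forms on `F̄` are `(e_i,
    -- ·)`; hence the sign.
    e := fun i => -B.f i x
    d := fun i y => (V.fiber y).formFbar (B.e i y)
    d' := fun i X => (V.fiber x).formFbar (V.connF (B.e i) x X)
    sum_eq := fun u => by
      conv_rhs => rw [← B.dual.self_of_nhds.sum_Fbar u]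
      refine Finset.sum_congr rfl fun i _ => ?_
      rw [smul_neg, ← neg_smul, PolarizedHodgeStructure.formFbar_apply,
        ← PolarizedHodgeStructure.form_swap]
    deriv := fun i => V.deriv_formFbar (B.smooth_e i) }⟩

/-- `∇^F` extends uniquely to the exterior algebra of `F`. -/
theorem extendsUniquely_ext :
    ExtendsUniquely (Hm := Hm) V.F V.connF (fun y => ExteriorAlgebra ℂ (V.F y))
      (fun _ => ExteriorAlgebra.ι ℂ) := by
  refine extendsUniquely_of_dualSystem (C := fun y => extContraction (V.F y))
    (fun _ _ => rfl) fun x => ?_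
  obtain ⟨B⟩ := V.nonempty_dualFrame x
  exact ⟨{
    n := B.n
    e := fun i => B.e i x
    d := fun i y => (V.fiber y).formF (B.f i y)
    d' := fun i X => (V.fiber x).formF (V.connFbar (B.f i) x X)
    sum_eq := B.dual.self_of_nhds.sum_F
    deriv := fun i => V.deriv_formF (B.smooth_f i) }⟩

end PolarizedVHS

end

noncomputable section

open Filter
open scoped Topology

/-! ### Tensoriality of the curvature of an abstract connection. -/

section Curvature

variable {E S : Type*} [NormedAddCommGroup E] [NormedSpace ℂ E] [TopologicalSpace S]
  [ChartedSpace E S] [IsManifold 𝓘(ℂ, E) ω S]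
  {W : S → Type*} [∀ x, AddCommGroup (W x)] [∀ x, Module ℂ (W x)]

/-- The sections that are smooth in the sense of `Sm` form a sheaf of modules over the smooth
functions. -/
structure IsSectionSheaf (E : Type*) {S : Type*} [NormedAddCommGroup E] [NormedSpace ℂ E]
    [TopologicalSpace S] [ChartedSpace E S] {W : S → Type*} [∀ x, AddCommGroup (W x)]
    [∀ x, Module ℂ (W x)] (Sm : S → (∀ y, W y) → Prop) : Prop where
  eventually : ∀ x v, Sm x v → ∀ᶠ y in 𝓝 x, Sm y v
  add : ∀ x v w, Sm x v → Sm x w → Sm x fun y => v y + w y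
  fun_smul : ∀ x (f : S → ℂ) v, SmoothFunNear E x f → Sm x v → Sm x fun y => f y • v y

namespace IsConnection

variable {Sm : S → (∀ y, W y) → Prop}
  {N : (∀ y, W y) → ∀ x : S, TangentSpace 𝓘(ℝ, E) x → W x} (hN : IsConnection W Sm N)
  (hSm : IsSectionSheaf E Sm) {x : S} {v w : ∀ y, W y} {X Y : ∀ y : S, TangentSpace 𝓘(ℝ, E) y}

include hN hSm

theorem curvatureOf_congr (hv : Sm x v) (hX : SmoothFieldNear x X) (hY : SmoothFieldNear x Y)
    (h : ∀ᶠ y in 𝓝 x, v y = w y) : curvatureOf N X Y v x = curvatureOf N X Y w x := by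
  have h2 : ∀ᶠ y in 𝓝 x, N v y = N w y := by
    filter_upwards [hSm.eventually x v hv, eventually_eventually_nhds.2 h] with y h1 h2
    exact hN.congr y v w h1 h2
  rw [curvatureOf, curvatureOf, hN.congr x v w hv h,
    hN.congr x _ _ (hN.smooth x v Y hv hY) (h2.mono fun y hy => congrFun hy (Y y)),
    hN.congr x _ _ (hN.smooth x v X hv hX) (h2.mono fun y hy => congrFun hy (X y))]

theorem curvatureOf_add (hv : Sm x v) (hw : Sm x w) (hX : SmoothFieldNear x X)
    (hY : SmoothFieldNear x Y) :
    curvatureOf N X Y (fun y => v y + w y) x = curvatureOf N X Y v x + curvatureOf N X Y w x := by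
  have h2 : ∀ Z : ∀ y : S, TangentSpace 𝓘(ℝ, E) y, SmoothFieldNear x Z → ∀ u,
      N (fun y => N (fun z => v z + w z) y (Z y)) x u =
        N (fun y => N v y (Z y)) x u + N (fun y => N w y (Z y)) x u := by
    intro Z hZ u
    rw [← hN.add x _ _ u (hN.smooth x v Z hv hZ) (hN.smooth x w Z hw hZ)]
    refine congrFun (hN.congr x _ _ (hN.smooth x _ Z (hSm.add x v w hv hw) hZ) ?_) u
    filter_upwards [hSm.eventually x v hv, hSm.eventually x w hw] with y h1 h2
    exact hN.add y v w (Z y) h1 h2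
  rw [curvatureOf, curvatureOf, curvatureOf, h2 Y hY, h2 X hX, hN.add x v w _ hv hw]
  abel

/-- The mixed terms are symmetric in `X` and `Y` and cancel. The second derivatives of `f` cancel
against the bracket term by `dirDeriv_mlieBracket`. -/
theorem curvatureOf_fun_smul [FiniteDimensional ℂ E] {f : S → ℂ} (hf : SmoothFunNear E x f)
    (hv : Sm x v) (hX : SmoothFieldNear x X) (hY : SmoothFieldNear x Y) :
    curvatureOf N X Y (fun y => f y • v y) x = f x • curvatureOf N X Y v x := by
  have h2 : ∀ Z : ∀ y : S, TangentSpace 𝓘(ℝ, E) y, SmoothFieldNear x Z → ∀ u,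
      N (fun y => N (fun z => f z • v z) y (Z y)) x u =
        dirDeriv (fun y => dirDeriv f y (Z y)) x u • v x + dirDeriv f x (Z x) • N v x u +
          (dirDeriv f x u • N v x (Z x) + f x • N (fun y => N v y (Z y)) x u) := by
    intro Z hZ u
    have h3 := hN.smooth x v Z hv hZ
    have h4 := hf.dirDeriv hZ
    rw [← hN.leibniz x _ v u h4 hv, ← hN.leibniz x f _ u hf h3,
      ← hN.add x _ _ u (hSm.fun_smul x _ v h4 hv) (hSm.fun_smul x _ _ hf h3)]
    refine congrFun (hN.congr x _ _ (hN.smooth x _ Z (hSm.fun_smul x f v hf hv) hZ) ?_) u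
    filter_upwards [hSm.eventually x v hv, hf.eventually] with y h1 h2
    exact hN.leibniz y f v (Z y) h2 h1
  rw [curvatureOf, curvatureOf, h2 Y hY, h2 X hX, hN.leibniz x f v _ hf hv,
    dirDeriv_mlieBracket hf hX hY]
  simp only [sub_smul, smul_sub]
  abel

end IsConnection

end Curvature

/-! ### The Fock connection on `Sym F̄` and its compatibility with the action of `H`. -/

namespace PolarizedVHS

variable {E S Hm : Type*} [NormedAddCommGroup E] [NormedSpace ℂ E]
  [TopologicalSpace S] [ChartedSpace E S]
  [NormedAddCommGroup Hm] [NormedSpace ℂ Hm]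
  {H : S → Type*} [∀ x, AddCommGroup (H x)] [∀ x, Module ℂ (H x)]
  [TopologicalSpace (TotalSpace Hm H)] [∀ x, TopologicalSpace (H x)]
  [IsManifold 𝓘(ℂ, E) ω S]
  [∀ x, IsTopologicalAddGroup (H x)] [∀ x, ContinuousSMul ℝ (H x)] [FiberBundle Hm H]
  (V : PolarizedVHS E Hm H) {x : S}

/-- A section of `Sym F̄` is smooth near `x`. -/
abbrev SymSmooth (x : S) (p : ∀ y, SymmetricAlgebra ℂ (V.Fbar y)) : Prop :=
  AlgSmoothNear E Hm V.Fbar (fun y => SymmetricAlgebra ℂ (V.Fbar y))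
    (fun y => SymmetricAlgebra.ι ℂ (V.Fbar y)) x p

theorem isSectionSheaf_symSmooth : IsSectionSheaf E V.SymSmooth where
  eventually _ _ h := h.eventually
  add _ _ _ hv hw := hv.add hw
  fun_smul _ _ _ hf hv := hv.fun_smul hf

theorem symSmooth_one : V.SymSmooth x fun _ => 1 := by
  have h : V.SymSmooth x fun y => algebraMap ℂ _ 1 := AlgSmoothNear.const 1
  simpa using h

variable [VectorBundle ℂ Hm H] [VectorBundle ℝ Hm H]

section ConnSym

variable {p q : ∀ y, SymmetricAlgebra ℂ (V.Fbar y)}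

theorem connSym_congr (hp : V.SymSmooth x p) (h : ∀ᶠ y in 𝓝 x, p y = q y) :
    V.connSym p x = V.connSym q x :=
  V.extendsUniquely_sym.inducedConn_congr hp h

theorem connSym_algebraMap {f : S → ℂ} (hf : SmoothFunNear E x f)
    (X : TangentSpace 𝓘(ℝ, E) x) :
    V.connSym (fun y => algebraMap ℂ _ (f y)) x X = algebraMap ℂ _ (dirDeriv f x X) :=
  V.extendsUniquely_sym.inducedConn_function hf X

theorem connSym_one (X : TangentSpace 𝓘(ℝ, E) x) : V.connSym (fun _ => 1) x X = 0 := by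
  have h := V.connSym_algebraMap (x := x) (.const 1) X
  simpa [dirDeriv_const] using h

theorem connSym_ι {z : ∀ y, V.Fbar y} (hz : SmoothNear E Hm x fun y => (z y : H y))
    (X : TangentSpace 𝓘(ℝ, E) x) :
    V.connSym (fun y => SymmetricAlgebra.ι ℂ _ (z y)) x X =
      SymmetricAlgebra.ι ℂ _ (V.connFbar z x X) :=
  V.extendsUniquely_sym.inducedConn_generator hz X

theorem connSym_add (hp : V.SymSmooth x p) (hq : V.SymSmooth x q)
    (X : TangentSpace 𝓘(ℝ, E) x) :
    V.connSym (fun y => p y + q y) x X = V.connSym p x X + V.connSym q x X :=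
  V.extendsUniquely_sym.inducedConn_add hp hq X

theorem connSym_mul (hp : V.SymSmooth x p) (hq : V.SymSmooth x q)
    (X : TangentSpace 𝓘(ℝ, E) x) :
    V.connSym (fun y => p y * q y) x X = V.connSym p x X * q x + p x * V.connSym q x X :=
  V.extendsUniquely_sym.inducedConn_mul hp hq X

theorem connSym_fun_smul {f : S → ℂ} (hf : SmoothFunNear E x f) (hp : V.SymSmooth x p)
    (X : TangentSpace 𝓘(ℝ, E) x) :
    V.connSym (fun y => f y • p y) x X = dirDeriv f x X • p x + f x • V.connSym p x X :=
  V.extendsUniquely_sym.inducedConn_fun_smul hf hp X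

theorem connSym_symDer {a : ∀ y, V.F y} (ha : SmoothNear E Hm x fun y => (a y : H y))
    (hp : V.SymSmooth x p) :
    V.SymSmooth x (fun y => symDer ((V.fiber y).formFbar (a y)) (p y)) ∧
      ∀ X, V.connSym (fun y => symDer ((V.fiber y).formFbar (a y)) (p y)) x X =
        symDer ((V.fiber x).formFbar (V.connF a x X)) (p x) +
          symDer ((V.fiber x).formFbar (a x)) (V.connSym p x X) :=
  V.extendsUniquely_sym.inducedConn_contr (C := fun y => symContraction (V.Fbar y))
    (fun _ => rfl) (V.deriv_formFbar ha) hp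

theorem aug_connSym (hp : V.SymSmooth x p) :
    SmoothFunNear E x (fun y => SymmetricAlgebra.algebraMapInv (p y)) ∧
      ∀ X, SymmetricAlgebra.algebraMapInv (V.connSym p x X) =
        dirDeriv (fun y => SymmetricAlgebra.algebraMapInv (p y)) x X :=
  V.extendsUniquely_sym.aug_inducedConn (fun y => symContraction (V.Fbar y)) hp

theorem symSmooth_act {h : ∀ y, H y} (hh : SmoothNear E Hm x h) (hp : V.SymSmooth x p) :
    V.SymSmooth x fun y => (V.fiber y).act (h y) (p y) := by
  refine ((V.connSym_symDer (V.prF_smooth hh) hp).1.add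
    ((AlgSmoothNear.generator (V.prFbar_smooth hh)).mul hp)).congr
      (Eventually.of_forall fun y => ?_)
  rw [← PolarizedHodgeStructure.act_F, ← PolarizedHodgeStructure.act_Fbar, ← LinearMap.add_apply,
    ← map_add, PolarizedHodgeStructure.prF_add_prFbar]

variable [ContMDiffVectorBundle ∞ Hm H 𝓘(ℝ, E)]

/-- The derivation `∇^F̄` treats multiplication by `F̄` and contraction with `F` separately, so it
is compatible with `∇^F ⊕ ∇^F̄`; the subtracted terms express this connection through `∇^H`. -/
theorem connSym_act {h : ∀ y, H y} (hh : SmoothNear E Hm x h) (hp : V.SymSmooth x p)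
    (X : TangentSpace 𝓘(ℝ, E) x) :
    V.connSym (fun y => (V.fiber y).act (h y) (p y)) x X =
      (V.fiber x).act (V.conn h x X - V.sigma x X ((V.fiber x).prF (h x)) -
        V.sigmaBar x X ((V.fiber x).prFbar (h x))) (p x) +
      (V.fiber x).act (h x) (V.connSym p x X) := by
  have h1 := V.prF_smooth hh
  have h2 := V.prFbar_smooth hh
  have hs : (fun y => (V.fiber y).act (h y) (p y)) = fun y =>
      symDer ((V.fiber y).formFbar ((V.fiber y).prF (h y))) (p y) +
        SymmetricAlgebra.ι ℂ _ ((V.fiber y).prFbar (h y)) * p y := by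
    funext y
    rw [← PolarizedHodgeStructure.act_F, ← PolarizedHodgeStructure.act_Fbar,
      ← LinearMap.add_apply, ← map_add, PolarizedHodgeStructure.prF_add_prFbar]
  have hc : V.conn h x X - V.sigma x X ((V.fiber x).prF (h x)) -
      V.sigmaBar x X ((V.fiber x).prFbar (h x)) =
      V.connF (fun y => (V.fiber y).prF (h y)) x X +
        V.connFbar (fun y => (V.fiber y).prFbar (h y)) x X := by
    rw [V.sigma_apply x X _ h1, V.sigmaBar_apply X _ h2, connF, connFbar]
    have h3 := V.conn_add x _ _ X h1 h2
    simp only [PolarizedHodgeStructure.prF_add_prFbar] at h3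
    have h4 : ∀ a b : H x, a + b - (V.fiber x).prFbar a - (V.fiber x).prF b =
        (V.fiber x).prF a + (V.fiber x).prFbar b := by
      intro a b
      rw [sub_sub, sub_eq_iff_eq_add]
      conv_lhs => rw [← (V.fiber x).prF_add_prFbar a, ← (V.fiber x).prF_add_prFbar b]
      abel
    rw [h3, h4]
  rw [hs, V.connSym_add (V.connSym_symDer h1 hp).1 ((AlgSmoothNear.generator h2).mul hp),
    (V.connSym_symDer h1 hp).2, V.connSym_mul (.generator h2) hp, V.connSym_ι h2, hc]
  simp only [← PolarizedHodgeStructure.act_F, ← PolarizedHodgeStructure.act_Fbar]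
  conv_rhs => rw [← (V.fiber x).prF_add_prFbar (h x)]
  simp only [map_add, LinearMap.add_apply]
  abel

end ConnSym

variable [ContMDiffVectorBundle ∞ Hm H 𝓘(ℝ, E)] [FiniteDimensional ℂ Hm]

/-- The operator `ρ (s + s̄)` on `Sym F̄`. -/
def quadTerm (x : S) (X : TangentSpace 𝓘(ℝ, E) x) :
    Module.End ℂ (SymmetricAlgebra ℂ (V.Fbar x)) :=
  (V.fiber x).quadAct (V.s x X + V.sBar x X)

/-- The connection on `Sym F̄` that corresponds to `∇^𝔽`. -/
def connSymFock (p : ∀ y, SymmetricAlgebra ℂ (V.Fbar y)) (x : S) (X : TangentSpace 𝓘(ℝ, E) x) :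
    SymmetricAlgebra ℂ (V.Fbar x) :=
  V.connSym p x X + V.quadTerm x X (p x)

/-- Transfers questions about the Fock bundle to `Sym F̄`, by the intertwining property of the
vacuum map. -/
theorem symm_connFock (v : ∀ y, V.FockFiber y) (X : TangentSpace 𝓘(ℝ, E) x) :
    (V.fiber x).symEquiv.symm (V.connFock v x X) =
      V.connSymFock (fun y => (V.fiber y).symEquiv.symm (v y)) x X := by
  rw [LinearEquiv.symm_apply_eq, connFock, connSymFock, map_add (V.fiber x).symEquiv]
  congr 1
  have h := (V.fiber x).symEquiv_symRep ((V.fiber x).quad (V.s x X + V.sBar x X))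
    ((V.fiber x).symEquiv.symm (v x))
  rw [LinearEquiv.apply_symm_apply] at h
  exact h.symm

theorem tensorEnd_s_add_sBar [∀ y, FiniteDimensional ℂ (H y)] (X : TangentSpace 𝓘(ℝ, E) x)
    (h : H x) :
    (V.fiber x).tensorEnd (V.s x X + V.sBar x X) h =
      (V.sigmaBar x X ((V.fiber x).prFbar h) : H x) + V.sigma x X ((V.fiber x).prF h) := by
  simp [s, sBar]

/-- Membership of `σ + σ̄` in the symplectic Lie algebra: the symmetry of `σ` and `σ̄`, put in the
form that `quadAct_act` requires. -/
theorem form_tensorEnd [∀ y, FiniteDimensional ℂ (H y)] (X : TangentSpace 𝓘(ℝ, E) x) (a b : H x) :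
    (V.fiber x).form ((V.fiber x).tensorEnd (V.s x X + V.sBar x X) a) b =
      (V.fiber x).form ((V.fiber x).tensorEnd (V.s x X + V.sBar x X) b) a := by
  rw [tensorEnd_s_add_sBar, tensorEnd_s_add_sBar, map_add, map_add, LinearMap.add_apply,
    LinearMap.add_apply]
  rw [← (V.fiber x).form_prFbar_right _ a, ← (V.fiber x).form_prFbar_right _ b,
    ← (V.fiber x).form_prF_right _ a, ← (V.fiber x).form_prF_right _ b, V.form_sigma,
    V.form_sigmaBar]

/-- The endomorphism `σ + σ̄` is real, since conjugation interchanges its two summands. -/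
theorem conj_tensorEnd [∀ y, FiniteDimensional ℂ (H y)] (X : TangentSpace 𝓘(ℝ, E) x) (a : H x) :
    (V.fiber x).conj ((V.fiber x).tensorEnd (V.s x X + V.sBar x X) ((V.fiber x).conj a)) =
      (V.fiber x).tensorEnd (V.s x X + V.sBar x X) a := by
  have h1 : ∀ b : H x, (V.fiber x).conj (V.sigmaBar x X ((V.fiber x).prFbar ((V.fiber x).conj b))) =
      V.sigma x X ((V.fiber x).prF b) := by
    intro b
    have h2 : (V.fiber x).conjFbar ((V.fiber x).prFbar ((V.fiber x).conj b)) =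
        (V.fiber x).prF b := Subtype.ext ((V.fiber x).conj_prFbar_conj b)
    rw [← h2]
    exact (V.fiber x).conj_conj _
  rw [tensorEnd_s_add_sBar, tensorEnd_s_add_sBar, map_add, h1, ← h1 ((V.fiber x).conj a),
    (V.fiber x).conj_conj, (V.fiber x).conj_conj, add_comm]

theorem quadTerm_act (X : TangentSpace 𝓘(ℝ, E) x) (h : H x) (p : SymmetricAlgebra ℂ (V.Fbar x)) :
    V.quadTerm x X ((V.fiber x).act h p) = (V.fiber x).act h (V.quadTerm x X p) +
      (V.fiber x).act ((V.sigmaBar x X ((V.fiber x).prFbar h) : H x) +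
        V.sigma x X ((V.fiber x).prF h)) p := by
  have := finiteDimensional_fiber Hm H
  rw [quadTerm, PolarizedHodgeStructure.quadAct_act _ (V.form_tensorEnd X), tensorEnd_s_add_sBar]

theorem innerSym_quadTerm (X : TangentSpace 𝓘(ℝ, E) x) (p q : SymmetricAlgebra ℂ (V.Fbar x)) :
    (V.fiber x).innerSym (V.quadTerm x X p) q = -(V.fiber x).innerSym p (V.quadTerm x X q) :=
  haveI := finiteDimensional_fiber Hm H
  PolarizedHodgeStructure.innerSym_quadAct _ (V.form_tensorEnd X) (V.conj_tensorEnd X) p q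

/-- By symmetry both pairings in `aug_quadAct` are equal, and on `F̄` only `σ̄` acts. -/
theorem aug_quadTerm (X : TangentSpace 𝓘(ℝ, E) x) (u w : V.Fbar x) :
    SymmetricAlgebra.algebraMapInv (V.quadTerm x X
      (SymmetricAlgebra.ι ℂ _ u * SymmetricAlgebra.ι ℂ _ w)) =
      (V.fiber x).form (V.sigmaBar x X u) w := by
  have := finiteDimensional_fiber Hm H
  rw [quadTerm, PolarizedHodgeStructure.aug_quadAct, V.form_tensorEnd X w, tensorEnd_s_add_sBar,
    PolarizedHodgeStructure.prF_coe_Fbar, map_zero, PolarizedHodgeStructure.prFbar_coe]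
  simp only [ZeroMemClass.coe_zero, add_zero]
  ring

/-- In dual frames, `s̄` raises the degree by two and `s` lowers it by two. The opposite signs
reflect that the component in `F` has coordinates `(f_j, ·)`, while that in `F̄` has coordinates
`-(e_j, ·)`. -/
theorem quadTerm_apply {n : ℕ} {e : Fin n → V.F x} {f : Fin n → V.Fbar x}
    (hef : (V.fiber x).IsDualFrame e f) (X : TangentSpace 𝓘(ℝ, E) x)
    (p : SymmetricAlgebra ℂ (V.Fbar x)) :
    V.quadTerm x X p =
      (1 / 2 : ℂ) • ∑ j, SymmetricAlgebra.ι ℂ _ (V.sigma x X (e j)) *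
        (SymmetricAlgebra.ι ℂ _ (f j) * p) +
      (-(1 / 2) : ℂ) • ∑ j, symDer ((V.fiber x).formFbar (V.sigmaBar x X (f j)))
        (symDer ((V.fiber x).formFbar (e j)) p) := by
  have := finiteDimensional_fiber Hm H
  have h : V.s x X + V.sBar x X =
      (1 / 2 : ℂ) • ∑ j, (V.sigma x X (e j) : H x) ⊗ₜ[ℂ] (f j : H x) +
        (-(1 / 2) : ℂ) • ∑ j, (V.sigmaBar x X (f j) : H x) ⊗ₜ[ℂ] (e j : H x) := by
    apply (V.fiber x).tensorEnd.injective
    ext1 h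
    rw [tensorEnd_s_add_sBar, hef.prF_eq, hef.prFbar_eq, add_comm]
    simp only [map_add, map_smul, map_sum, LinearMap.add_apply, LinearMap.smul_apply,
      LinearMap.sum_apply, PolarizedHodgeStructure.tensorEnd_tmul, AddSubmonoidClass.coe_finsetSum,
      Submodule.coe_smul, Finset.smul_sum, smul_smul]
    congr 1
    · refine Finset.sum_congr rfl fun j _ => ?_
      congr 1
      ring
    · refine Finset.sum_congr rfl fun j _ => ?_
      rw [(V.fiber x).form_swap]
      congr 1
      ring
  rw [quadTerm, h]
  simp only [map_add, map_smul, map_sum, LinearMap.add_apply, LinearMap.smul_apply,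
    LinearMap.sum_apply, PolarizedHodgeStructure.quadAct_tmul, PolarizedHodgeStructure.act_F,
    PolarizedHodgeStructure.act_Fbar]

variable {p q : ∀ y, SymmetricAlgebra ℂ (V.Fbar y)}

theorem quadTerm_smooth (hp : V.SymSmooth x p) {X : ∀ y : S, TangentSpace 𝓘(ℝ, E) y}
    (hX : SmoothFieldNear x X) : V.SymSmooth x fun y => V.quadTerm y (X y) (p y) := by
  obtain ⟨B⟩ := V.nonempty_dualFrame x
  have h1 : ∀ j, SmoothNear E Hm x fun y => (V.sigma y (X y) (B.e j y) : H y) := fun j =>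
    (V.prFbar_smooth (V.conn_smooth x X _ hX (B.smooth_e j))).congr
      ((B.smooth_e j).eventually.mono fun y hy => by rw [V.sigma_apply y _ _ hy])
  have h2 : ∀ j, SmoothNear E Hm x fun y => (V.sigmaBar y (X y) (B.f j y) : H y) := fun j =>
    (V.prF_smooth (V.conn_smooth x X _ hX (B.smooth_f j))).congr
      ((B.smooth_f j).eventually.mono fun y hy => by rw [V.sigmaBar_apply _ _ hy])
  refine (((AlgSmoothNear.sum Finset.univ fun j _ => (AlgSmoothNear.generator (h1 j)).mul
    ((AlgSmoothNear.generator (B.smooth_f j)).mul hp)).fun_smul (.const (1 / 2))).add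
    ((AlgSmoothNear.sum Finset.univ fun j _ => (V.connSym_symDer (h2 j)
      (V.connSym_symDer (B.smooth_e j) hp).1).1).fun_smul (.const (-(1 / 2))))).congr ?_
  filter_upwards [B.dual] with y hy
  exact (V.quadTerm_apply hy (X y) (p y)).symm

theorem quadTerm_add_tangent (X Y : TangentSpace 𝓘(ℝ, E) x) :
    V.quadTerm x (X + Y) = V.quadTerm x X + V.quadTerm x Y := by
  have := finiteDimensional_fiber Hm H
  rw [quadTerm, quadTerm, quadTerm, ← map_add]
  congr 1
  apply (V.fiber x).tensorEnd.injective
  ext1 h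
  rw [map_add _ (V.s x X + V.sBar x X), LinearMap.add_apply]
  simp only [tensorEnd_s_add_sBar, sigma_add_tangent, sigmaBar_add_tangent, LinearMap.add_apply,
    Submodule.coe_add]
  abel

theorem quadTerm_smul_tangent (r : ℝ) (X : TangentSpace 𝓘(ℝ, E) x) :
    V.quadTerm x (r • X) = (r : ℂ) • V.quadTerm x X := by
  have := finiteDimensional_fiber Hm H
  rw [quadTerm, quadTerm, ← map_smul]
  congr 1
  apply (V.fiber x).tensorEnd.injective
  ext1 h
  rw [map_smul, LinearMap.smul_apply]
  simp only [tensorEnd_s_add_sBar, sigma_smul_tangent, sigmaBar_smul_tangent, LinearMap.smul_apply,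
    Submodule.coe_smul, smul_add]

/-- The connections of `Sym F̄` and `H` are compatible with the action of `H`. -/
theorem connSymFock_act {h : ∀ y, H y} (hh : SmoothNear E Hm x h) (hp : V.SymSmooth x p)
    (X : TangentSpace 𝓘(ℝ, E) x) :
    V.connSymFock (fun y => (V.fiber y).act (h y) (p y)) x X =
      (V.fiber x).act (V.conn h x X) (p x) + (V.fiber x).act (h x) (V.connSymFock p x X) := by
  -- The terms `σ` and `σ̄` subtracted in `connSym_act` are the ones that the commutator with `ρ (s
  -- + s̄)` contributes.
  rw [connSymFock, connSymFock, V.connSym_act hh hp, quadTerm_act]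
  simp only [map_add, map_sub, LinearMap.add_apply, LinearMap.sub_apply]
  abel

variable [FiniteDimensional ℂ E]

theorem isConnection_connSymFock :
    IsConnection (fun y => SymmetricAlgebra ℂ (V.Fbar y)) V.SymSmooth V.connSymFock where
  congr x v w hv h := by
    funext X
    rw [connSymFock, connSymFock, V.connSym_congr hv h, h.self_of_nhds]
  smooth x v X hv hX := (V.extendsUniquely_sym.inducedConn_smooth hv hX
    fun a ha => V.connFbar_smooth ha hX).add (V.quadTerm_smooth hv hX)
  add x v w X hv hw := by
    rw [connSymFock, connSymFock, connSymFock, V.connSym_add hv hw, map_add]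
    abel
  leibniz x f v X hf hv := by
    rw [connSymFock, connSymFock, V.connSym_fun_smul hf hv, map_smul, smul_add, add_assoc]
  add_tangent x v X Y hv := by
    have h : V.connSym v x (X + Y) = V.connSym v x X + V.connSym v x Y :=
      V.extendsUniquely_sym.inducedConn_add_tangent hv
        (fun a X Y => by rw [connFbar, map_add, map_add]; rfl) X Y
    rw [connSymFock, connSymFock, connSymFock, h, quadTerm_add_tangent, LinearMap.add_apply]
    abel
  smul_tangent x v r X hv := by
    have h : V.connSym v x (r • X) = (r : ℂ) • V.connSym v x X :=
      V.extendsUniquely_sym.inducedConn_smul_tangent hv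
        (fun a r X => by
          rw [connFbar, connFbar, ← map_smul]
          exact congrArg _ (map_smul (V.conn (fun y => (a y : H y)) x) r X)) r X
    rw [connSymFock, connSymFock, h, quadTerm_smul_tangent, LinearMap.smul_apply, smul_add]

end PolarizedVHS

end

noncomputable section

open Filter
open scoped Topology

namespace PolarizedVHS

variable {E S Hm : Type*} [NormedAddCommGroup E] [NormedSpace ℂ E] [FiniteDimensional ℂ E]
  [TopologicalSpace S] [ChartedSpace E S] [IsManifold 𝓘(ℂ, E) ω S]
  [NormedAddCommGroup Hm] [NormedSpace ℂ Hm] [FiniteDimensional ℂ Hm]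
  {H : S → Type*} [∀ x, AddCommGroup (H x)] [∀ x, Module ℂ (H x)]
  [TopologicalSpace (TotalSpace Hm H)] [∀ x, TopologicalSpace (H x)]
  [∀ x, IsTopologicalAddGroup (H x)] [∀ x, ContinuousSMul ℝ (H x)] [FiberBundle Hm H]
  [VectorBundle ℂ Hm H] [VectorBundle ℝ Hm H] [ContMDiffVectorBundle ∞ Hm H 𝓘(ℝ, E)]
  (V : PolarizedVHS E Hm H) {x : S} {p q : ∀ y, SymmetricAlgebra ℂ (V.Fbar y)}
  {X Y : ∀ y : S, TangentSpace 𝓘(ℝ, E) y}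

/-! ### The curvature of the Fock connection is scalar. -/

section Curvature

/-- Expanding by compatibility with `∇^H`, the cross terms are symmetric in `X` and `Y`, and the
terms in which only `h` is differentiated form the curvature of `∇^H`, which is zero. -/
theorem curvatureOf_act {h : ∀ y, H y} (hh : SmoothNear E Hm x h) (hp : V.SymSmooth x p)
    (hX : SmoothFieldNear x X) (hY : SmoothFieldNear x Y) :
    curvatureOf V.connSymFock X Y (fun y => (V.fiber y).act (h y) (p y)) x =
      (V.fiber x).act (h x) (curvatureOf V.connSymFock X Y p x) := by
  have hN := V.isConnection_connSymFock
  have h2 : ∀ Z : ∀ y : S, TangentSpace 𝓘(ℝ, E) y, SmoothFieldNear x Z → ∀ u,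
      V.connSymFock (fun y => V.connSymFock (fun z => (V.fiber z).act (h z) (p z)) y (Z y)) x u =
        (V.fiber x).act (V.conn (fun y => V.conn h y (Z y)) x u) (p x) +
          (V.fiber x).act (V.conn h x (Z x)) (V.connSymFock p x u) +
        ((V.fiber x).act (V.conn h x u) (V.connSymFock p x (Z x)) +
          (V.fiber x).act (h x) (V.connSymFock (fun y => V.connSymFock p y (Z y)) x u)) := by
    intro Z hZ u
    have h3 := V.conn_smooth x Z h hZ hh
    have h4 := hN.smooth x p Z hp hZ
    rw [← V.connSymFock_act h3 hp, ← V.connSymFock_act hh h4,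
      ← hN.add x _ _ u (V.symSmooth_act h3 hp) (V.symSmooth_act hh h4)]
    refine congrFun (hN.congr x _ _ (hN.smooth x _ Z (V.symSmooth_act hh hp) hZ) ?_) u
    filter_upwards [hp.eventually, hh.eventually] with y h1 h2
    exact V.connSymFock_act h2 h1 (Z y)
  have hflat := V.flat x X Y h hX hY hh
  rw [curvatureOf, sub_sub, sub_eq_zero] at hflat
  rw [curvatureOf, curvatureOf, h2 Y hY, h2 X hX, V.connSymFock_act hh hp, hflat]
  simp only [map_add, map_sub, LinearMap.add_apply]
  abel

/-- The curvature is linear over the sections of `Sym F̄`. -/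
theorem curvatureOf_mul (hp : V.SymSmooth x p) (hX : SmoothFieldNear x X)
    (hY : SmoothFieldNear x Y) (hq : V.SymSmooth x q) :
    curvatureOf V.connSymFock X Y (fun y => p y * q y) x =
      p x * curvatureOf V.connSymFock X Y q x := by
  have hN := V.isConnection_connSymFock
  have hS := V.isSectionSheaf_symSmooth
  induction hp using AlgSmoothNear.induction generalizing q with
  | function f hf =>
    simp only [← Algebra.smul_def]
    exact hN.curvatureOf_fun_smul hS hf hq hX hY
  -- Multiplication by a section of `F̄` is part of the action of `H`, with which the curvature
  -- commutes.
  | generator a ha =>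
    simp only [← PolarizedHodgeStructure.act_Fbar]
    exact V.curvatureOf_act ha hq hX hY
  | add v w hv hw ihv ihw =>
    simp only [add_mul]
    rw [hN.curvatureOf_add hS (hv.mul hq) (hw.mul hq) hX hY, ihv hq, ihw hq]
  | mul v w hv hw ihv ihw =>
    simp only [mul_assoc]
    rw [ihv (hw.mul hq), ihw hq]
  | congr v w hv h ih =>
    rw [← h.self_of_nhds, ← ih hq]
    exact (hN.curvatureOf_congr hS (hv.mul hq) hX hY (h.mono fun y hy => by rw [hy])).symm

omit [FiniteDimensional ℂ E] in
theorem connSymFock_one (x : S) (X : TangentSpace 𝓘(ℝ, E) x) :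
    V.connSymFock (fun _ => 1) x X = V.quadTerm x X 1 := by
  rw [connSymFock, connSym_one, zero_add]

omit [FiniteDimensional ℂ E] in
theorem quadTerm_one {n : ℕ} {e : Fin n → V.F x} {f : Fin n → V.Fbar x}
    (hef : (V.fiber x).IsDualFrame e f) (X : TangentSpace 𝓘(ℝ, E) x) :
    V.quadTerm x X 1 = (1 / 2 : ℂ) • ∑ j, SymmetricAlgebra.ι ℂ _ (V.sigma x X (e j)) *
        SymmetricAlgebra.ι ℂ _ (f j) := by
  rw [V.quadTerm_apply hef]
  simp [symDer_one]

omit [FiniteDimensional ℂ E] in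
theorem aug_quadTerm_one (X : TangentSpace 𝓘(ℝ, E) x) :
    SymmetricAlgebra.algebraMapInv (V.quadTerm x X 1) = 0 := by
  obtain ⟨B⟩ := V.nonempty_dualFrame x
  rw [V.quadTerm_one B.dual.self_of_nhds]
  simp [SymmetricAlgebra.algebraMapInv_ι]

-- `Y` creates `½ ∑ σ (Y) e_j · f_j` from `1`, and the constant term after applying `X` is `½ ∑ (σ̄
-- (X) σ (Y) e_j, f_j)`. The trace is the same sum with the arguments of the form exchanged, hence
-- the sign.
omit [FiniteDimensional ℂ E] in
theorem aug_quadTerm_quadTerm (X Y : TangentSpace 𝓘(ℝ, E) x) :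
    SymmetricAlgebra.algebraMapInv (V.quadTerm x X (V.quadTerm x Y 1)) =
      -(1 / 2) * LinearMap.trace ℂ (V.F x) (V.sigmaBar x X ∘ₗ V.sigma x Y) := by
  obtain ⟨B⟩ := V.nonempty_dualFrame x
  have hB := B.dual.self_of_nhds
  rw [V.quadTerm_one hB, hB.trace_eq]
  simp only [map_smul, map_sum, aug_quadTerm, smul_eq_mul, neg_mul, LinearMap.comp_apply]
  rw [← mul_neg, ← Finset.sum_neg_distrib]
  congr 1
  exact Finset.sum_congr rfl fun j _ => (V.fiber x).form_swap _ _

-- Since `∇^𝔽 1` has no constant term, neither differentiating it by `∇^F̄` nor the bracket term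
-- contributes; only the composite of two quadratic operators does.
omit [FiniteDimensional ℂ E] in
theorem aug_curvatureOf_one (hX : SmoothFieldNear x X) (hY : SmoothFieldNear x Y) :
    SymmetricAlgebra.algebraMapInv (curvatureOf V.connSymFock X Y (fun _ => 1) x) =
      -(1 / 2) * V.traceForm x (X x) (Y x) := by
  have h : ∀ Z : ∀ y : S, TangentSpace 𝓘(ℝ, E) y, SmoothFieldNear x Z → ∀ u,
      SymmetricAlgebra.algebraMapInv
        (V.connSymFock (fun y => V.connSymFock (fun _ => 1) y (Z y)) x u) =
      -(1 / 2) * LinearMap.trace ℂ (V.F x) (V.sigmaBar x u ∘ₗ V.sigma x (Z x)) := by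
    intro Z hZ u
    simp only [connSymFock_one]
    rw [connSymFock, map_add, (V.aug_connSym (V.quadTerm_smooth V.symSmooth_one hZ)).2,
      aug_quadTerm_quadTerm]
    simp only [aug_quadTerm_one]
    rw [dirDeriv_const, zero_add]
  rw [curvatureOf, map_sub, map_sub, h Y hY, h X hX, connSymFock_one, aug_quadTerm_one, traceForm,
    map_sub]
  ring

/-- The curvature commutes with the contractions by `F`, and these kill `1`. So its value on `1` is
annihilated by all contractions and equals its constant term. -/
theorem curvatureOf_one (hX : SmoothFieldNear x X) (hY : SmoothFieldNear x Y) :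
    curvatureOf V.connSymFock X Y (fun _ => 1) x =
      algebraMap ℂ _ (-(1 / 2) * V.traceForm x (X x) (Y x)) := by
  obtain ⟨B⟩ := V.nonempty_dualFrame x
  rw [← V.aug_curvatureOf_one hX hY]
  refine (symContraction (V.Fbar x)).eq_algebraMap_of_contr_eq_zero
    (e := fun i => -B.f i x) (d := fun i => (V.fiber x).formFbar (B.e i x)) (fun u => ?_)
    fun i => ?_
  · conv_rhs => rw [← B.dual.self_of_nhds.sum_Fbar u]
    refine Finset.sum_congr rfl fun i _ => ?_
    rw [smul_neg, ← neg_smul, PolarizedHodgeStructure.formFbar_apply,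
      ← PolarizedHodgeStructure.form_swap]
  · have h1 := V.curvatureOf_act (B.smooth_e i) V.symSmooth_one hX hY
    -- The case `0 · 1`: the curvature of the zero section is zero.
    have h2 := V.curvatureOf_mul (AlgSmoothNear.const 0) hX hY V.symSmooth_one
    simp only [PolarizedHodgeStructure.act_F, symDer_one] at h1
    simp only [map_zero, zero_mul] at h2
    rw [h2] at h1
    exact h1.symm

theorem curvatureOf_connSymFock (hp : V.SymSmooth x p) (hX : SmoothFieldNear x X)
    (hY : SmoothFieldNear x Y) :
    curvatureOf V.connSymFock X Y p x = (-(1 / 2) * V.traceForm x (X x) (Y x)) • p x := by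
  have h := V.curvatureOf_mul hp hX hY V.symSmooth_one
  simp only [mul_one] at h
  rw [h, V.curvatureOf_one hX hY, mul_comm, Algebra.smul_def]

end Curvature

/-! ### Unitarity. -/

section Unitary

/-- The first argument is reduced to `1` by moving its factors to the second one as adjoints. The
compatibility of both derivatives with `H` makes the product rule survive each move. -/
theorem innerSym_deriv (hp : V.SymSmooth x p) (hq : V.SymSmooth x q) :
    SmoothFunNear E x (fun y => (V.fiber y).innerSym (p y) (q y)) ∧
      ∀ X, dirDeriv (fun y => (V.fiber y).innerSym (p y) (q y)) x X =
        (V.fiber x).innerSym (V.connSymFock p x X) (q x) +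
          (V.fiber x).innerSym (p x) (V.connSymFock q x X) := by
  have hN := V.isConnection_connSymFock
  have hone : ∀ q, V.SymSmooth x q →
      SmoothFunNear E x (fun y => (V.fiber y).innerSym 1 (q y)) ∧
      ∀ X, dirDeriv (fun y => (V.fiber y).innerSym 1 (q y)) x X =
        (V.fiber x).innerSym (V.connSymFock (fun _ => 1) x X) (q x) +
          (V.fiber x).innerSym 1 (V.connSymFock q x X) := by
    intro q hq
    have h := V.aug_connSym hq
    simp only [PolarizedHodgeStructure.innerSym_one]
    refine ⟨h.1.conj, fun X => ?_⟩
    -- Pairing with `1` takes the conjugate constant term. The two contributions of `ρ (s + s̄)`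
    -- cancel by skew-adjointness, and `∇^F̄` commutes with the augmentation.
    rw [dirDeriv_conj h.1, ← h.2, connSymFock_one, innerSym_quadTerm, connSymFock,
      PolarizedHodgeStructure.innerSym_one, map_add, map_add]
    ring
  -- The induction is on the multiplier `p`: if the claim holds for `p'` against every `q`, it holds
  -- for `p p'`. All `q` are needed because a generator `z` replaces `q` by `√-1 z̄ q`.
  have hmul : ∀ p' : ∀ y, SymmetricAlgebra ℂ (V.Fbar y), V.SymSmooth x p' →
      (∀ q, V.SymSmooth x q → SmoothFunNear E x (fun y => (V.fiber y).innerSym (p' y) (q y)) ∧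
        ∀ X, dirDeriv (fun y => (V.fiber y).innerSym (p' y) (q y)) x X =
          (V.fiber x).innerSym (V.connSymFock p' x X) (q x) +
            (V.fiber x).innerSym (p' x) (V.connSymFock q x X)) →
      ∀ q, V.SymSmooth x q →
        SmoothFunNear E x (fun y => (V.fiber y).innerSym (p y * p' y) (q y)) ∧
        ∀ X, dirDeriv (fun y => (V.fiber y).innerSym (p y * p' y) (q y)) x X =
          (V.fiber x).innerSym (V.connSymFock (fun y => p y * p' y) x X) (q x) +
            (V.fiber x).innerSym (p x * p' x) (V.connSymFock q x X) := by
    clear hq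
    induction hp using AlgSmoothNear.induction with
    | function f hf =>
      intro p' hp' ih q hq
      simp only [← Algebra.smul_def, map_smul, LinearMap.smul_apply, smul_eq_mul]
      refine ⟨hf.mul (ih q hq).1, fun X => ?_⟩
      rw [dirDeriv_mul hf (ih q hq).1, (ih q hq).2, hN.leibniz x f p' X hf hp']
      simp only [map_add, map_smul, LinearMap.add_apply, LinearMap.smul_apply, smul_eq_mul]
      ring
    | generator z hz =>
      intro p' hp' ih q hq
      have hz' := V.conj_smooth x _ hz
      have hq' := V.symSmooth_act hz' hq
      have h := ih _ (hq'.fun_smul (.const Complex.I))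
      simp only [← PolarizedHodgeStructure.act_Fbar, PolarizedHodgeStructure.innerSym_act]
      refine ⟨h.1, fun X => ?_⟩
      rw [h.2, hN.leibniz x (fun _ => Complex.I) _ X (.const _) hq', dirDeriv_const, zero_smul,
        zero_add, V.connSymFock_act hz' hq, V.conj_flat x _ X hz, V.connSymFock_act hz hp',
        map_add, LinearMap.add_apply, PolarizedHodgeStructure.innerSym_act,
        PolarizedHodgeStructure.innerSym_act, smul_add, map_add]
      ring
    | add v w hv hw ihv ihw =>
      intro p' hp' ih q hq
      have h1 := ihv p' hp' ih q hq
      have h2 := ihw p' hp' ih q hq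
      simp only [add_mul, map_add, LinearMap.add_apply]
      refine ⟨h1.1.add h2.1, fun X => ?_⟩
      rw [dirDeriv_add h1.1 h2.1, h1.2, h2.2, hN.add x _ _ X (hv.mul hp') (hw.mul hp'), map_add,
        LinearMap.add_apply]
      ring
    | mul v w hv hw ihv ihw =>
      intro p' hp' ih q hq
      simp only [mul_assoc]
      exact ihv _ (hw.mul hp') (ihw p' hp' ih) q hq
    | congr v w hv h ihv =>
      intro p' hp' ih q hq
      have h1 := ihv p' hp' ih q hq
      have h2 : ∀ᶠ y in 𝓝 x, v y * p' y = w y * p' y := h.mono fun y hy => by rw [hy]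
      have h3 : (fun y => (V.fiber y).innerSym (v y * p' y) (q y)) =ᶠ[𝓝 x]
          fun y => (V.fiber y).innerSym (w y * p' y) (q y) :=
        h2.mono fun y hy => congrArg (fun u => (V.fiber y).innerSym u (q y)) hy
      refine ⟨h1.1.congr h3, fun X => ?_⟩
      rw [← dirDeriv_congr h3, h1.2, hN.congr x _ _ (hv.mul hp') h2, h.self_of_nhds]
  simpa only [mul_one] using hmul _ V.symSmooth_one hone q hq

end Unitary

/-! ### Transport from `Sym F̄` to the Fock bundle. -/

section Fock

theorem isConnection_connFock : IsConnection V.FockFiber V.FockSmooth V.connFock := by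
  have hN := V.isConnection_connSymFock
  have hs : ∀ (v : ∀ y, V.FockFiber y) (x : S) X, V.connFock v x X =
      (V.fiber x).symEquiv (V.connSymFock (fun y => (V.fiber y).symEquiv.symm (v y)) x X) := by
    intro v x X
    rw [← symm_connFock, LinearEquiv.apply_symm_apply]
  constructor
  · intro x v w hv h
    funext X
    rw [hs, hs, hN.congr x _ _ hv (h.mono fun y hy => by rw [hy])]
  · intro x v X hv hX
    have h := hN.smooth x _ X hv hX
    simp only [← symm_connFock] at h
    exact h
  · intro x v w X hv hw
    rw [hs, hs, hs, ← map_add, ← hN.add x _ _ X hv hw]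
    simp only [map_add]
  · intro x f v X hf hv
    have h := hN.leibniz x f _ X hf hv
    rw [hs, hs]
    simp only [map_smul]
    rw [h, map_add, map_smul, map_smul, LinearEquiv.apply_symm_apply]
  · intro x v X Y hv
    rw [hs, hs, hs, ← map_add, ← hN.add_tangent x _ X Y hv]
  · intro x v r X hv
    rw [hs, hs, ← map_smul, ← hN.smul_tangent x _ r X hv]

theorem isUnitaryConnection_connFock :
    IsUnitaryConnection V.FockFiber V.FockSmooth (fun x => (V.fiber x).innerFock) V.connFock := by
  intro x v w hv hw
  simp only [PolarizedHodgeStructure.innerFock, symm_connFock]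
  exact V.innerSym_deriv hv hw

theorem hasScalarCurvature_connFock :
    HasScalarCurvature V.FockFiber V.FockSmooth V.connFock
      (fun x X Y => -(1 / 2) * V.traceForm x X Y) := by
  intro x X Y v hX hY hv
  have h := V.curvatureOf_connSymFock hv hX hY
  apply (V.fiber x).symEquiv.symm.injective
  rw [map_smul, ← h, curvatureOf, curvatureOf, map_sub, map_sub, symm_connFock, symm_connFock,
    symm_connFock]
  simp only [symm_connFock]

end Fock

end PolarizedVHS

end

noncomputable section

open Filter
open scoped Topology

/-! ### The top exterior power: coordinates by iterated contraction, and the trace. -/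

section Contraction

variable {M A : Type*} [AddCommGroup M] [Module ℂ M] [Ring A] [Algebra ℂ A] {gen : M →ₗ[ℂ] A}

/-- The augmentation of the iterated contraction with a family of linear forms. -/
def Contraction.coeff (C : Contraction gen) : ∀ {n : ℕ}, (Fin n → Module.Dual ℂ M) → A →ₗ[ℂ] ℂ
  | 0, _ => C.aug.toLinearMap
  | _ + 1, d => C.coeff (fun i => d i.succ) ∘ₗ C.contr (d 0)

theorem contr_ιMulti_eq_zero {n : ℕ} (d : Module.Dual ℂ M) (e : Fin n → M) (h : ∀ i, d (e i) = 0) :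
    (extContraction M).contr d (ExteriorAlgebra.ιMulti ℂ n e) = 0 := by
  induction n with
  | zero => rw [ExteriorAlgebra.ιMulti_zero_apply, Contraction.contr_one]
  | succ n ih =>
    rw [ExteriorAlgebra.ιMulti_succ_apply, Contraction.contr_gen_mul, h,
      ih (Matrix.vecTail e) fun i => h i.succ, mul_zero, zero_smul, smul_zero, add_zero]

theorem coeff_ιMulti {n : ℕ} (d : Fin n → Module.Dual ℂ M) (e : Fin n → M)
    (h : ∀ i j, d i (e j) = if i = j then 1 else 0) :
    (extContraction M).coeff d (ExteriorAlgebra.ιMulti ℂ n e) = 1 := by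
  induction n with
  | zero =>
    rw [ExteriorAlgebra.ιMulti_zero_apply]
    exact map_one (extContraction M).aug
  | succ n ih =>
    have h0 : (extContraction M).contr (d 0) (ExteriorAlgebra.ιMulti ℂ n (Matrix.vecTail e)) = 0 :=
      contr_ιMulti_eq_zero _ _ fun i => by
        rw [Matrix.vecTail, Function.comp_apply, h, if_neg (Fin.succ_ne_zero i).symm]
    rw [ExteriorAlgebra.ιMulti_succ_apply, Contraction.coeff, LinearMap.comp_apply,
      Contraction.contr_gen_mul, h0, mul_zero, smul_zero, add_zero, h, if_pos rfl, one_smul]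
    exact ih _ _ fun i j => by simp [Matrix.vecTail, h]

/-- The top power is a line, and contracting with the dual basis sends the wedge of the basis to
`1`. Writing the coefficient as a contraction makes its smoothness visible in families. -/
theorem exists_eq_smul_ιMulti {n : ℕ} {d : Fin n → Module.Dual ℂ M} {e : Fin n → M}
    (h : ∀ i j, d i (e j) = if i = j then 1 else 0) (b : Module.Basis (Fin n) ℂ M)
    {v : ExteriorAlgebra ℂ M} (hv : v ∈ ⋀[ℂ]^n M) :
    v = (extContraction M).coeff d v • ExteriorAlgebra.ιMulti ℂ n e := by
  have := Module.Finite.of_basis b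
  have hU : ExteriorAlgebra.ιMulti ℂ n e ∈ ⋀[ℂ]^n M :=
    ExteriorAlgebra.ιMulti_range ℂ n ⟨e, rfl⟩
  have h1 : Module.finrank ℂ (⋀[ℂ]^n M) = 1 := by
    rw [exteriorPower.finrank_eq, Module.finrank_eq_card_basis b, Fintype.card_fin,
      Nat.choose_self]
  have hne : (⟨_, hU⟩ : ⋀[ℂ]^n M) ≠ 0 := by
    intro h0
    have h2 := coeff_ιMulti d e h
    have h3 : ExteriorAlgebra.ιMulti ℂ n e = 0 := congrArg Subtype.val h0
    rw [h3, map_zero] at h2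
    exact zero_ne_one h2
  obtain ⟨c, hc⟩ := (finrank_eq_one_iff_of_nonzero' _ hne).1 h1 ⟨v, hv⟩
  have hc' : c • ExteriorAlgebra.ιMulti ℂ n e = v := congrArg Subtype.val hc
  rw [← hc', map_smul, coeff_ιMulti d e h, smul_eq_mul, mul_one]

/-- The trace of an endomorphism as the factor by which it acts on the top exterior power. -/
theorem sum_ιMulti_update {n : ℕ} {d : Fin n → Module.Dual ℂ M} {e : Fin n → M}
    (h : ∀ u, ∑ i, d i u • e i = u) (T : M →ₗ[ℂ] M) :
    ∑ i, ExteriorAlgebra.ιMulti ℂ n (Function.update e i (T (e i))) =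
      (∑ i, d i (T (e i))) • ExteriorAlgebra.ιMulti ℂ n e := by
  rw [Finset.sum_smul]
  refine Finset.sum_congr rfl fun i _ => ?_
  conv_lhs => rw [← h (T (e i)), AlternatingMap.map_update_sum]
  -- After expanding `T (e i)`, every term with `j ≠ i` repeats the vector `e j`, so only the
  -- diagonal entry survives.
  rw [Finset.sum_eq_single i]
  · rw [AlternatingMap.map_update_smul, Function.update_eq_self]
  · intro j _ hj
    rw [AlternatingMap.map_update_smul, AlternatingMap.map_update_self _ _ hj.symm, smul_zero]
  · simp

end Contraction

/-! ### The connection on `det F` and its curvature. -/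

namespace PolarizedVHS

variable {E S Hm : Type*} [NormedAddCommGroup E] [NormedSpace ℂ E]
  [TopologicalSpace S] [ChartedSpace E S] [IsManifold 𝓘(ℂ, E) ω S]
  [NormedAddCommGroup Hm] [NormedSpace ℂ Hm]
  {H : S → Type*} [∀ x, AddCommGroup (H x)] [∀ x, Module ℂ (H x)]
  [TopologicalSpace (TotalSpace Hm H)] [∀ x, TopologicalSpace (H x)]
  [∀ x, IsTopologicalAddGroup (H x)] [∀ x, ContinuousSMul ℝ (H x)] [FiberBundle Hm H]
  (V : PolarizedVHS E Hm H) {x : S} {p q : ∀ y, ExteriorAlgebra ℂ (V.F y)}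

/-- A section of the exterior algebra of `F` is smooth near `x`. -/
abbrev ExtSmooth (x : S) (p : ∀ y, ExteriorAlgebra ℂ (V.F y)) : Prop :=
  AlgSmoothNear E Hm V.F (fun y => ExteriorAlgebra ℂ (V.F y)) (fun _ => ExteriorAlgebra.ι ℂ) x p

theorem isSectionSheaf_extSmooth : IsSectionSheaf E V.ExtSmooth where
  eventually _ _ h := h.eventually
  add _ _ _ hv hw := hv.add hw
  fun_smul _ _ _ hf hv := hv.fun_smul hf

theorem extSmooth_one : V.ExtSmooth x fun _ => 1 := by
  have h : V.ExtSmooth x fun y => algebraMap ℂ _ 1 := AlgSmoothNear.const 1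
  simpa using h

theorem extSmooth_ιMulti {n : ℕ} {e : Fin n → ∀ y, V.F y}
    (he : ∀ i, SmoothNear E Hm x fun y => (e i y : H y)) :
    V.ExtSmooth x fun y => ExteriorAlgebra.ιMulti ℂ n fun i => e i y := by
  induction n with
  | zero =>
    simp only [ExteriorAlgebra.ιMulti_zero_apply]
    exact V.extSmooth_one
  | succ n ih =>
    simp only [ExteriorAlgebra.ιMulti_succ_apply]
    exact (AlgSmoothNear.generator (he 0)).mul (ih fun i => he i.succ)

/-- Smooth sections of `det F` are multiples of the exterior product of a frame. -/
theorem eventually_eq_smul_ιMulti (B : V.DualFrame x) (v : ∀ y, V.DetFiber y) :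
    ∀ᶠ y in 𝓝 x, (v y : ExteriorAlgebra ℂ (V.F y)) =
      (extContraction (V.F y)).coeff (fun i => (V.fiber y).formF (B.f i y))
        (v y : ExteriorAlgebra ℂ (V.F y)) • ExteriorAlgebra.ιMulti ℂ B.n fun i => B.e i y := by
  filter_upwards [B.dual] with y hy
  refine exists_eq_smul_ιMulti (d := fun i => (V.fiber y).formF (B.f i y))
    (e := fun i => B.e i y) hy.form_eq hy.basis ?_
  -- The degree in `DetFiber` is the rank of the fibre, equal to the size of the frame only
  -- propositionally; generalising the degree avoids a cast.
  have h : ∀ m, Module.finrank ℂ (V.F y) = m →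
      (v y : ExteriorAlgebra ℂ (V.F y)) ∈ ⋀[ℂ]^m (V.F y) := by
    rintro _ rfl
    exact (v y).2
  exact h _ hy.finrank_eq

variable [VectorBundle ℂ Hm H] [VectorBundle ℝ Hm H]

theorem connExt_ι {a : ∀ y, V.F y} (ha : SmoothNear E Hm x fun y => (a y : H y))
    (X : TangentSpace 𝓘(ℝ, E) x) :
    V.connExt (fun y => ExteriorAlgebra.ι ℂ (a y)) x X = ExteriorAlgebra.ι ℂ (V.connF a x X) :=
  V.extendsUniquely_ext.inducedConn_generator ha X

theorem connExt_one (X : TangentSpace 𝓘(ℝ, E) x) : V.connExt (fun _ => 1) x X = 0 := by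
  have h := V.extendsUniquely_ext.inducedConn_function (x := x) (.const 1) X
  simp only [map_one, dirDeriv_const, map_zero] at h
  exact h

theorem connExt_mul (hp : V.ExtSmooth x p) (hq : V.ExtSmooth x q)
    (X : TangentSpace 𝓘(ℝ, E) x) :
    V.connExt (fun y => p y * q y) x X = V.connExt p x X * q x + p x * V.connExt q x X :=
  V.extendsUniquely_ext.inducedConn_mul hp hq X

/-- The derivation replaces one factor of degree one by another, so the degree is preserved. -/
theorem connExt_ιMulti_mem {n : ℕ} {e : Fin n → ∀ y, V.F y}
    (he : ∀ i, SmoothNear E Hm x fun y => (e i y : H y)) (X : TangentSpace 𝓘(ℝ, E) x) :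
    V.connExt (fun y => ExteriorAlgebra.ιMulti ℂ n fun i => e i y) x X ∈ ⋀[ℂ]^n (V.F x) := by
  induction n with
  | zero =>
    simp only [ExteriorAlgebra.ιMulti_zero_apply, connExt_one]
    exact zero_mem _
  | succ n ih =>
    simp only [ExteriorAlgebra.ιMulti_succ_apply]
    have h := V.connExt_mul (.generator (he 0))
      (V.extSmooth_ιMulti (e := fun i => e i.succ) fun i => he i.succ) X
    rw [V.connExt_ι (he 0)] at h
    refine h ▸ ?_
    change _ ∈ LinearMap.range (ExteriorAlgebra.ι ℂ : V.F x →ₗ[ℂ] _) ^ (n + 1)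
    rw [pow_succ']
    exact add_mem (Submodule.mul_mem_mul ⟨_, rfl⟩ (ExteriorAlgebra.ιMulti_range ℂ n ⟨_, rfl⟩))
      (Submodule.mul_mem_mul ⟨_, rfl⟩ (ih fun i => he i.succ))

theorem coeff_smooth {n : ℕ} {f : Fin n → ∀ y, V.Fbar y}
    (hf : ∀ i, SmoothNear E Hm x fun y => (f i y : H y)) (hp : V.ExtSmooth x p) :
    SmoothFunNear E x fun y =>
      (extContraction (V.F y)).coeff (fun i => (V.fiber y).formF (f i y)) (p y) := by
  induction n generalizing p with
  | zero => exact (V.extendsUniquely_ext.aug_inducedConn (fun y => extContraction (V.F y)) hp).1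
  | succ n ih =>
    exact ih (fun i => hf i.succ) (V.extendsUniquely_ext.inducedConn_contr
      (C := fun y => extContraction (V.F y)) (fun _ => rfl) (V.deriv_formF (hf 0)) hp).1

variable [FiniteDimensional ℂ E]

theorem isConnection_connExt :
    IsConnection (fun y => ExteriorAlgebra ℂ (V.F y)) V.ExtSmooth V.connExt where
  congr _ _ _ hv h := V.extendsUniquely_ext.inducedConn_congr hv h
  smooth _ _ _ hv hX := V.extendsUniquely_ext.inducedConn_smooth hv hX
    fun _ ha => V.connF_smooth ha hX
  add _ _ _ X hv hw := V.extendsUniquely_ext.inducedConn_add hv hw X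
  leibniz _ _ _ X hf hv := V.extendsUniquely_ext.inducedConn_fun_smul hf hv X
  add_tangent _ _ X Y hv := V.extendsUniquely_ext.inducedConn_add_tangent hv
    (fun a X Y => by rw [connF, map_add, map_add]; rfl) X Y
  smul_tangent x _ r X hv := V.extendsUniquely_ext.inducedConn_smul_tangent hv
    (fun a r X => by
      rw [connF, connF, ← map_smul]
      exact congrArg _ (map_smul (V.conn (fun y => (a y : H y)) x) r X)) r X

/-- On smooth sections the projection in `connDet` discards nothing: a section of `det F` is a
smooth multiple of a frame wedge, whose derivative stays in top degree. Everything about `det F`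
then follows from the exterior algebra. -/
theorem coe_connDet {v : ∀ y, V.DetFiber y} (hv : V.DetSmooth x v) (X : TangentSpace 𝓘(ℝ, E) x) :
    (V.connDet v x X : ExteriorAlgebra ℂ (V.F x)) =
      V.connExt (fun y => (v y : ExteriorAlgebra ℂ (V.F y))) x X := by
  obtain ⟨B⟩ := V.nonempty_dualFrame x
  have hN := V.isConnection_connExt
  have hU := V.extSmooth_ιMulti B.smooth_e
  refine DirectSum.decompose_of_mem_same (fun i : ℕ => ⋀[ℂ]^i (V.F x)) ?_
  rw [B.dual.self_of_nhds.finrank_eq, hN.congr x _ _ hv (V.eventually_eq_smul_ιMulti B v),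
    hN.leibniz x _ _ X (V.coeff_smooth B.smooth_f hv) hU]
  exact add_mem (Submodule.smul_mem _ _ (ExteriorAlgebra.ιMulti_range ℂ _ ⟨_, rfl⟩))
    (Submodule.smul_mem _ _ (V.connExt_ιMulti_mem B.smooth_e X))

theorem isConnection_connDet : IsConnection V.DetFiber V.DetSmooth V.connDet := by
  have hN := V.isConnection_connExt
  have hS := V.isSectionSheaf_extSmooth
  constructor
  · intro x v w hv h
    have hw : V.DetSmooth x w := AlgSmoothNear.congr hv (h.mono fun y hy => by rw [hy])
    funext X
    apply Subtype.ext
    rw [V.coe_connDet hv, V.coe_connDet hw, hN.congr x _ _ hv (h.mono fun y hy => by rw [hy])]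
  · intro x v X hv hX
    exact AlgSmoothNear.congr (hN.smooth x _ X hv hX)
      (hv.eventually.mono fun y hy => (V.coe_connDet hy (X y)).symm)
  · intro x v w X hv hw
    apply Subtype.ext
    rw [V.coe_connDet (v := fun y => v y + w y) (hS.add x _ _ hv hw), Submodule.coe_add,
      V.coe_connDet hv, V.coe_connDet hw]
    exact hN.add x _ _ X hv hw
  · intro x f v X hf hv
    apply Subtype.ext
    rw [V.coe_connDet (v := fun y => f y • v y) (hS.fun_smul x _ _ hf hv), Submodule.coe_add,
      Submodule.coe_smul, Submodule.coe_smul, V.coe_connDet hv]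
    exact hN.leibniz x f _ X hf hv
  · intro x v X Y hv
    apply Subtype.ext
    rw [Submodule.coe_add, V.coe_connDet hv, V.coe_connDet hv, V.coe_connDet hv]
    exact hN.add_tangent x _ X Y hv
  · intro x v r X hv
    apply Subtype.ext
    rw [Submodule.coe_smul, V.coe_connDet hv, V.coe_connDet hv]
    exact hN.smul_tangent x _ r X hv

variable {X Y : ∀ y : S, TangentSpace 𝓘(ℝ, E) y}

/-- A commutator of derivations is a derivation: the mixed first-order products are symmetric in `X`
and `Y` and cancel. -/
theorem curvatureOf_connExt_mul (hp : V.ExtSmooth x p) (hq : V.ExtSmooth x q)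
    (hX : SmoothFieldNear x X) (hY : SmoothFieldNear x Y) :
    curvatureOf V.connExt X Y (fun y => p y * q y) x =
      curvatureOf V.connExt X Y p x * q x + p x * curvatureOf V.connExt X Y q x := by
  have hN := V.isConnection_connExt
  have h2 : ∀ Z : ∀ y : S, TangentSpace 𝓘(ℝ, E) y, SmoothFieldNear x Z → ∀ u,
      V.connExt (fun y => V.connExt (fun z => p z * q z) y (Z y)) x u =
        V.connExt (fun y => V.connExt p y (Z y)) x u * q x +
          V.connExt p x (Z x) * V.connExt q x u +
        (V.connExt p x u * V.connExt q x (Z x) +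
          p x * V.connExt (fun y => V.connExt q y (Z y)) x u) := by
    intro Z hZ u
    have h3 := hN.smooth x p Z hp hZ
    have h4 := hN.smooth x q Z hq hZ
    rw [← V.connExt_mul h3 hq, ← V.connExt_mul hp h4, ← hN.add x _ _ u (h3.mul hq) (hp.mul h4)]
    refine congrFun (hN.congr x _ _ (hN.smooth x _ Z (hp.mul hq) hZ) ?_) u
    filter_upwards [hp.eventually, hq.eventually] with y h1 h2
    exact V.connExt_mul h1 h2 (Z y)
  rw [curvatureOf, curvatureOf, curvatureOf, h2 Y hY, h2 X hX, V.connExt_mul hp hq]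
  noncomm_ring

theorem curvatureOf_connExt_ι {a : ∀ y, V.F y} (ha : SmoothNear E Hm x fun y => (a y : H y))
    (hX : SmoothFieldNear x X) (hY : SmoothFieldNear x Y) :
    curvatureOf V.connExt X Y (fun y => ExteriorAlgebra.ι ℂ (a y)) x =
      ExteriorAlgebra.ι ℂ (curvatureOf V.connF X Y a x) := by
  have hN := V.isConnection_connExt
  have h2 : ∀ Z : ∀ y : S, TangentSpace 𝓘(ℝ, E) y, SmoothFieldNear x Z → ∀ u,
      V.connExt (fun y => V.connExt (fun z => ExteriorAlgebra.ι ℂ (a z)) y (Z y)) x u =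
        ExteriorAlgebra.ι ℂ (V.connF (fun y => V.connF a y (Z y)) x u) := by
    intro Z hZ u
    rw [← V.connExt_ι (V.connF_smooth ha hZ)]
    refine congrFun (hN.congr x _ _ (hN.smooth x _ Z (.generator ha) hZ) ?_) u
    filter_upwards [ha.eventually] with y h1
    exact V.connExt_ι h1 (Z y)
  rw [curvatureOf, curvatureOf, h2 Y hY, h2 X hX, V.connExt_ι ha, map_sub, map_sub]

theorem curvatureOf_connExt_ιMulti {n : ℕ} {e : Fin n → ∀ y, V.F y}
    (he : ∀ i, SmoothNear E Hm x fun y => (e i y : H y))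
    (hX : SmoothFieldNear x X) (hY : SmoothFieldNear x Y) :
    curvatureOf V.connExt X Y (fun y => ExteriorAlgebra.ιMulti ℂ n fun i => e i y) x =
      ∑ i, ExteriorAlgebra.ιMulti ℂ n
        (Function.update (fun i => e i x) i (curvatureOf V.connF X Y (e i) x)) := by
  induction n with
  | zero =>
    simp only [ExteriorAlgebra.ιMulti_zero_apply, Finset.univ_eq_empty, Finset.sum_empty]
    have h := V.isConnection_connExt.curvatureOf_fun_smul V.isSectionSheaf_extSmooth
      (.const 0) V.extSmooth_one hX hY
    -- A derivation kills `1`, since `1 · 1 = 1` gives `R 1 = R 1 + R 1`.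
    have h1 := V.curvatureOf_connExt_mul V.extSmooth_one V.extSmooth_one hX hY
    simp only [mul_one, one_mul] at h1
    exact left_eq_add.1 h1
  | succ n ih =>
    simp only [ExteriorAlgebra.ιMulti_succ_apply]
    have h := V.curvatureOf_connExt_mul (.generator (he 0))
      (V.extSmooth_ιMulti (e := fun i => e i.succ) fun i => he i.succ) hX hY
    rw [V.curvatureOf_connExt_ι (he 0) hX hY, ih fun i => he i.succ] at h
    refine h.trans ?_
    rw [Fin.sum_univ_succ, Function.update_self, Finset.mul_sum]
    congr 1
    refine Finset.sum_congr rfl fun i _ => ?_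
    rw [Function.update_of_ne (Fin.succ_ne_zero i).symm]
    congr 2
    funext j
    by_cases hj : j = i
    · subst hj
      simp [Matrix.vecTail]
    · simp [Matrix.vecTail, Function.update_of_ne hj,
        Function.update_of_ne (fun h => hj (Fin.succ_injective _ h))]

variable [ContMDiffVectorBundle ∞ Hm H 𝓘(ℝ, E)]

omit [FiniteDimensional ℂ E] in
/-- The curvature of `∇^F` is `-σ̄ ∧ σ`. -/
theorem curvatureOf_connF {a : ∀ y, V.F y} (ha : SmoothNear E Hm x fun y => (a y : H y))
    (hX : SmoothFieldNear x X) (hY : SmoothFieldNear x Y) :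
    curvatureOf V.connF X Y a x =
      -(V.sigmaBar x (X x) ∘ₗ V.sigma x (Y x) - V.sigmaBar x (Y x) ∘ₗ V.sigma x (X x)) (a x) := by
  -- The Gauss equation: inserting the projection to `F` between two derivatives drops the part that
  -- passes through `F̄`, which goes there by `σ` and returns by `σ̄`.
  have h2 : ∀ Z : ∀ y : S, TangentSpace 𝓘(ℝ, E) y, SmoothFieldNear x Z → ∀ u,
      V.connF (fun y => V.connF a y (Z y)) x u =
        (V.fiber x).prF (V.conn (fun y => V.conn (fun z => (a z : H z)) y (Z y)) x u) -
          V.sigmaBar x u (V.sigma x (Z x) (a x)) := by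
    intro Z hZ u
    have h3 := V.connF_smooth ha hZ
    have h4 := V.prFbar_smooth (V.conn_smooth x Z _ hZ ha)
    rw [V.sigma_apply x _ a ha, V.sigmaBar_apply u
      (fun y => (V.fiber y).prFbar (V.conn (fun z => (a z : H z)) y (Z y))) h4,
      eq_sub_iff_add_eq, connF, ← map_add, ← V.conn_add x _ _ u h3 h4]
    simp only [connF, PolarizedHodgeStructure.prF_add_prFbar]
  have hflat := V.flat x X Y _ hX hY ha
  rw [curvatureOf, sub_sub, sub_eq_zero] at hflat
  rw [curvatureOf, h2 Y hY, h2 X hX, hflat, connF]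
  simp only [map_add, LinearMap.sub_apply, LinearMap.comp_apply]
  abel

/-- The curvature of `∇^F` acts on a frame wedge as a derivation, that is by its trace; tensoriality
extends this to all multiples of the wedge. -/
theorem hasScalarCurvature_connDet :
    HasScalarCurvature V.DetFiber V.DetSmooth V.connDet (fun x X Y => -V.traceForm x X Y) := by
  intro x X Y v hX hY hv
  obtain ⟨B⟩ := V.nonempty_dualFrame x
  have hB := B.dual.self_of_nhds
  have hN := V.isConnection_connExt
  have hS := V.isSectionSheaf_extSmooth
  have h2 : ∀ Z : ∀ y : S, TangentSpace 𝓘(ℝ, E) y, SmoothFieldNear x Z → ∀ u,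
      (V.connDet (fun y => V.connDet v y (Z y)) x u : ExteriorAlgebra ℂ (V.F x)) =
        V.connExt (fun y => V.connExt (fun z => (v z : ExteriorAlgebra ℂ (V.F z))) y (Z y))
          x u := by
    intro Z hZ u
    rw [V.coe_connDet (V.isConnection_connDet.smooth x v Z hv hZ)]
    exact congrFun (hN.congr x _ _ (V.isConnection_connDet.smooth x v Z hv hZ)
      (hv.eventually.mono fun y hy => V.coe_connDet hy (Z y))) u
  have h3 : (curvatureOf V.connDet X Y v x : ExteriorAlgebra ℂ (V.F x)) =
      curvatureOf V.connExt X Y (fun y => (v y : ExteriorAlgebra ℂ (V.F y))) x := by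
    rw [curvatureOf, curvatureOf, Submodule.coe_sub, Submodule.coe_sub, h2 Y hY, h2 X hX,
      V.coe_connDet hv]
  have hev := V.eventually_eq_smul_ιMulti B v
  apply Subtype.ext
  rw [h3, Submodule.coe_smul, hN.curvatureOf_congr hS hv hX hY hev,
    hN.curvatureOf_fun_smul hS (V.coeff_smooth B.smooth_f hv) (V.extSmooth_ιMulti B.smooth_e) hX hY,
    V.curvatureOf_connExt_ιMulti B.smooth_e hX hY]
  simp only [V.curvatureOf_connF (B.smooth_e _) hX hY, ← LinearMap.neg_apply]
  rw [sum_ιMulti_update (d := fun i => (V.fiber x).formF (B.f i x)) hB.sum_F]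
  have htr : ∑ i, (V.fiber x).formF (B.f i x) ((-(V.sigmaBar x (X x) ∘ₗ V.sigma x (Y x) -
      V.sigmaBar x (Y x) ∘ₗ V.sigma x (X x))) (B.e i x)) = -V.traceForm x (X x) (Y x) := by
    rw [traceForm, ← map_neg, hB.trace_eq]
    rfl
  rw [htr, smul_comm, ← hev.self_of_nhds]

end PolarizedVHS

end

theorem mainTheorem2 {E S Hm : Type*}
    [NormedAddCommGroup E] [NormedSpace ℂ E] [FiniteDimensional ℂ E]
    [TopologicalSpace S] [ChartedSpace E S] [IsManifold 𝓘(ℂ, E) ω S]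
    [NormedAddCommGroup Hm] [NormedSpace ℂ Hm] [FiniteDimensional ℂ Hm]
    (H : S → Type*) [∀ x, AddCommGroup (H x)] [∀ x, Module ℂ (H x)]
    [TopologicalSpace (TotalSpace Hm H)] [∀ x, TopologicalSpace (H x)]
    [∀ x, IsTopologicalAddGroup (H x)] [∀ x, ContinuousSMul ℝ (H x)]
    [FiberBundle Hm H] [VectorBundle ℂ Hm H] [VectorBundle ℝ Hm H]
    [ContMDiffVectorBundle ∞ Hm H 𝓘(ℝ, E)]
    (V : PolarizedVHS E Hm H) :
    -- `∇^F̄` extends to `Sym F̄`, and `∇^F` to the exterior algebra of `F`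
    ExtendsUniquely (Hm := Hm) V.Fbar V.connFbar (fun y => SymmetricAlgebra ℂ (V.Fbar y))
      (fun y => SymmetricAlgebra.ι ℂ (V.Fbar y)) ∧
    ExtendsUniquely (Hm := Hm) V.F V.connF (fun y => ExteriorAlgebra ℂ (V.F y))
      (fun _ => ExteriorAlgebra.ι ℂ) ∧
    -- `∇^𝔽 = ∇^F̄ + ρ (s + s̄)` is a unitary connection on the Fock bundle
    IsConnection V.FockFiber V.FockSmooth V.connFock ∧
    IsUnitaryConnection V.FockFiber V.FockSmooth (fun x => (V.fiber x).innerFock) V.connFock ∧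
    -- its curvature is the scalar two-form `-½ tr (σ̄ ∧ σ)`
    HasScalarCurvature V.FockFiber V.FockSmooth V.connFock
      (fun x X Y => -(1 / 2) * V.traceForm x X Y) ∧
    -- which is half the curvature `-tr (σ̄ ∧ σ)` of the connection on `det F`
    IsConnection V.DetFiber V.DetSmooth V.connDet ∧
    HasScalarCurvature V.DetFiber V.DetSmooth V.connDet (fun x X Y => -V.traceForm x X Y) ∧
    IsProjectivelyFlat V.FockFiber V.FockSmooth V.connFock := by
  refine ⟨V.extendsUniquely_sym, V.extendsUniquely_ext, V.isConnection_connFock,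
    V.isUnitaryConnection_connFock, V.hasScalarCurvature_connFock, V.isConnection_connDet,
    V.hasScalarCurvature_connDet, _, V.hasScalarCurvature_connFock⟩
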